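/- Assume the Riemann Hypothesis. Then, as $t\to\infty$, $$\int_{t-h}^{t+h}\log\left|\zeta\left(\tfrac12+iu\right)\right|\,du=\Omega_{\pm}\left(h\sqrt{\frac{\log t}{\log\log t}}\right)$$ uniformly for $h\in[0,(\log\log t)^{-1}]$, in the following sense. There are absolute constants $c_1,c_2>0$ and $T_0$ such that for every $T\ge T_0$ and every $h\in[0,(\log\log T)^{-1}]$ there is a $t\in[T,2T]$ with $$\int_{t-h}^{t+h}\log\left|\zeta\left(\tfrac12+iu\right)\right|\,du\ \ge\ c_1\,h\sqrt{\frac{\log t}{\log\log t}},$$ and there is a $t'\in[T,2T]$ with $$\int_{t'-h}^{t'+h}\log\left|\zeta\left(\tfrac12+iu\right)\right|\,du\ \le\ -c_2\,h\sqrt{\frac{\log t'}{\log\log t'}}.$$ -/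

import Mathlib

/-!
The proof is by the resonance method. Under RH the function `(s - 1) ζ(s) / s`, whose modulus on
the critical line is that of `ζ`, has a holomorphic logarithm `l` on `Re s > 1/2`. Consider the
mean over `t`, with a Gaussian weight centred at `3T/2` times `|∑ r_a n_a^{-it}|²`, of `Re l`
at `σ + i(t + v)`. Moving the contour to `Re s = 2` and expanding `log ζ` into its Dirichlet
series, one finds that only the terms with `n_a m = n_b` survive, because the integers `n_a` are
much smaller than `T`. Letting `σ → 1/2` gives a mean value of `log |ζ|` on the critical line.

The resonator is supported on products of at most `k` primes from a range just above `log T`, with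
coefficients `ε^{|A|} ∏_{p ∈ A} ρ_p`. The surviving main term then has the sign of `ε = ±1`, and it
has size `√(log T / log log T)` relative to the total weight for every shift `|v| ≤ 1 / log log T`,
since there `cos (v log p)` stays bounded below. Averaging over `|v| ≤ h` and discarding the
Gaussian tails outside `[T, 2T]` produces a suitable `t`.
-/

open Filter

open MeasureTheory Set Topology Asymptotics

lemma setIntegral_Ioi_one_mul_cpow_eq_mellin (f : ℝ → ℂ) (s : ℂ) :
    ∫ t in Ioi (1 : ℝ), f t * (t : ℂ) ^ (-(s + 1)) = mellin ((Ioi 1).indicator f) (-s) := by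
  have hexp : -s - 1 = -(s + 1) := by ring
  have hind : ∀ t : ℝ, (t : ℂ) ^ (-s - 1) • (Ioi (1 : ℝ)).indicator f t
      = (Ioi (1 : ℝ)).indicator (fun t ↦ f t * (t : ℂ) ^ (-(s + 1))) t := by
    intro t
    by_cases ht : t ∈ Ioi (1 : ℝ)
    · simp only [indicator_of_mem ht, smul_eq_mul, hexp, mul_comm]
    · simp only [indicator_of_notMem ht, smul_zero]
  simp_rw [mellin, hind]
  rw [setIntegral_indicator measurableSet_Ioi,
    inter_eq_self_of_subset_right (Ioi_subset_Ioi zero_le_one)]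

lemma differentiableAt_setIntegral_Ioi_one_mul_cpow {f : ℝ → ℂ} (hm : Measurable f) {C : ℝ}
    (hb : ∀ t, ‖f t‖ ≤ C) {s : ℂ} (hs : 0 < s.re) :
    DifferentiableAt ℂ (fun s : ℂ ↦ ∫ t in Ioi (1 : ℝ), f t * (t : ℂ) ^ (-(s + 1))) s := by
  have hb' : ∀ t, ‖(Ioi (1 : ℝ)).indicator f t‖ ≤ C := fun t ↦
    (norm_indicator_le_norm_self f t).trans (hb t)
  have hloc : LocallyIntegrableOn ((Ioi (1 : ℝ)).indicator f) (Ioi 0) := by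
    refine LocallyIntegrable.locallyIntegrableOn (fun x ↦ ?_) _
    refine ⟨Icc (x - 1) (x + 1), Icc_mem_nhds (by linarith) (by linarith), ?_⟩
    exact Measure.integrableOn_of_bounded (M := C) (by simp)
      (hm.indicator measurableSet_Ioi).aestronglyMeasurable (ae_of_all _ hb')
  have htop : (Ioi (1 : ℝ)).indicator f =O[atTop] fun t : ℝ ↦ t ^ (-0 : ℝ) :=
    IsBigO.of_bound C (Eventually.of_forall fun t ↦ by simpa using hb' t)
  have hzero : (Ioi (1 : ℝ)).indicator f =O[𝓝[>] 0] fun t : ℝ ↦ t ^ (-(-s.re - 1)) := by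
    refine IsBigO.of_bound 1 ?_
    filter_upwards [(eventually_lt_nhds one_pos).filter_mono nhdsWithin_le_nhds] with t ht
    rw [indicator_of_notMem (notMem_Ioi.2 ht.le)]
    simp
  simp_rw [setIntegral_Ioi_one_mul_cpow_eq_mellin f]
  exact (mellin_differentiableAt_of_isBigO_rpow (s := -s) hloc htop (by simpa) hzero
    (by simp)).comp s differentiableAt_id.neg

lemma norm_setIntegral_Ioi_one_mul_cpow_le {f : ℝ → ℂ} {C : ℝ} (hb : ∀ t, ‖f t‖ ≤ C) {s : ℂ}
    (hs : 0 < s.re) : ‖∫ t in Ioi (1 : ℝ), f t * (t : ℂ) ^ (-(s + 1))‖ ≤ C / s.re := by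
  have hint : IntegrableOn (fun t : ℝ ↦ C * t ^ (-s.re - 1)) (Ioi 1) :=
    (integrableOn_Ioi_rpow_of_lt (by linarith) one_pos).const_mul C
  have hval : ∫ t in Ioi (1 : ℝ), C * t ^ (-s.re - 1) = C / s.re := by
    rw [integral_const_mul, integral_Ioi_rpow_of_lt (by linarith) one_pos]
    simp [div_eq_mul_inv]
  rw [← hval]
  refine norm_integral_le_of_norm_le hint ((ae_restrict_iff' measurableSet_Ioi).2
    (ae_of_all _ fun t ht ↦ ?_))
  have ht0 : (0 : ℝ) < t := one_pos.trans ht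
  have hre : (-(s + 1)).re = -s.re - 1 := by simp; ring
  rw [norm_mul, Complex.norm_cpow_eq_rpow_re_of_pos ht0, hre]
  gcongr
  exact hb t

/-- The integral `∫_1^∞ {t} t^{-s-1} dt`, which continues `ζ` to the half-plane `Re s > 0`. -/
noncomputable def fractMellin (s : ℂ) : ℂ :=
  ∫ t in Ioi (1 : ℝ), ((Int.fract t : ℝ) : ℂ) * (t : ℂ) ^ (-(s + 1))

lemma norm_ofReal_fract_le_one (t : ℝ) : ‖((Int.fract t : ℝ) : ℂ)‖ ≤ 1 := by
  rw [Complex.norm_real, Real.norm_of_nonneg (Int.fract_nonneg t)]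
  exact (Int.fract_lt_one t).le

lemma differentiableAt_fractMellin {s : ℂ} (hs : 0 < s.re) : DifferentiableAt ℂ fractMellin s :=
  differentiableAt_setIntegral_Ioi_one_mul_cpow (Complex.measurable_ofReal.comp measurable_fract)
    norm_ofReal_fract_le_one hs

lemma norm_fractMellin_le {s : ℂ} (hs : 0 < s.re) : ‖fractMellin s‖ ≤ 1 / s.re :=
  norm_setIntegral_Ioi_one_mul_cpow_le norm_ofReal_fract_le_one hs

lemma natCast_floor_mul_cpow {t : ℝ} (ht : 0 < t) (s : ℂ) :
    (⌊t⌋₊ : ℂ) * (t : ℂ) ^ (-(s + 1)) =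
      (t : ℂ) ^ (-s) - ((Int.fract t : ℝ) : ℂ) * (t : ℂ) ^ (-(s + 1)) := by
  have htc : (t : ℂ) ≠ 0 := by exact_mod_cast ht.ne'
  have hpow : (t : ℂ) ^ (-s) = t * (t : ℂ) ^ (-(s + 1)) := by
    rw [neg_add, ← sub_eq_add_neg, Complex.cpow_sub _ _ htc, Complex.cpow_one]
    field_simp
  have hfloor : (⌊t⌋₊ : ℂ) = t - (Int.fract t : ℝ) := by
    rw [← Complex.ofReal_sub, Int.self_sub_fract, ← natCast_floor_eq_intCast_floor ht.le,
      Complex.ofReal_natCast]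
  rw [hpow, hfloor, sub_mul]

lemma integral_natCast_floor_mul_cpow {s : ℂ} (hs : 1 < s.re) :
    ∫ t in Ioi (1 : ℝ), (⌊t⌋₊ : ℂ) * (t : ℂ) ^ (-(s + 1)) = 1 / (s - 1) - fractMellin s := by
  have hpow : IntegrableOn (fun t : ℝ ↦ (t : ℂ) ^ (-s)) (Ioi 1) :=
    integrableOn_Ioi_cpow_of_lt (by simpa using hs) one_pos
  have hfract : IntegrableOn (fun t : ℝ ↦ ((Int.fract t : ℝ) : ℂ) * (t : ℂ) ^ (-(s + 1)))
      (Ioi 1) :=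
    (integrableOn_Ioi_cpow_of_lt (by simp; linarith) one_pos).bdd_mul
      (Complex.measurable_ofReal.comp measurable_fract).aestronglyMeasurable
      (ae_of_all _ norm_ofReal_fract_le_one)
  have hs1 : s - 1 ≠ 0 := sub_ne_zero.2 fun h ↦ by simp [h] at hs
  have hs1' : -s + 1 ≠ 0 := by rwa [neg_add_eq_sub, ← neg_sub, neg_ne_zero]
  have hval : ∫ t in Ioi (1 : ℝ), (t : ℂ) ^ (-s) = 1 / (s - 1) := by
    rw [integral_Ioi_cpow_of_lt (by simpa using hs) one_pos, Complex.ofReal_one, Complex.one_cpow]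
    field_simp
    ring
  rw [setIntegral_congr_fun measurableSet_Ioi fun t ht ↦
    natCast_floor_mul_cpow (one_pos.trans ht) s, integral_sub hpow hfract, hval, fractMellin]

lemma riemannZeta_eq_fractMellin {s : ℂ} (hs : 1 < s.re) :
    riemannZeta s = s / (s - 1) - s * fractMellin s := by
  have habel := LSeries_eq_mul_integral_of_nonneg (fun _ ↦ 1) zero_le_one hs
    (by simpa using isBigO_refl _ _) (by simp)
  have hzeta : LSeries (fun _ ↦ ((1 : ℝ) : ℂ)) s = riemannZeta s := by
    rw [← LSeries_one_eq_riemannZeta hs]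
    congr
  rw [hzeta] at habel
  simp only [Finset.sum_const, Nat.card_Icc, add_tsub_cancel_right, nsmul_eq_mul, mul_one,
    Complex.ofReal_one, integral_natCast_floor_mul_cpow hs] at habel
  rw [habel]
  ring

lemma riemannZeta₁_eq {s : ℂ} (hs : 0 < s.re) :
    riemannZeta₁ s = s - s * (s - 1) * fractMellin s := by
  have hopen : IsOpen {s : ℂ | 0 < s.re} := isOpen_lt continuous_const Complex.continuous_re
  have hleft : AnalyticOnNhd ℂ riemannZeta₁ {s : ℂ | 0 < s.re} :=
    differentiable_riemannZeta₁.differentiableOn.analyticOnNhd hopen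
  have hright : AnalyticOnNhd ℂ (fun s ↦ s - s * (s - 1) * fractMellin s)
      {s : ℂ | 0 < s.re} := by
    refine DifferentiableOn.analyticOnNhd (fun z hz ↦ ?_) hopen
    have := differentiableAt_fractMellin (s := z) hz
    exact DifferentiableAt.differentiableWithinAt (by fun_prop)
  refine hleft.eqOn_of_preconnected_of_eventuallyEq hright
    (convex_halfSpace_re_gt 0).isPreconnected (z₀ := 2) (by simp) ?_ hs
  have hnear : ∀ᶠ z : ℂ in 𝓝 2, 1 < z.re :=
    (isOpen_lt continuous_const Complex.continuous_re).mem_nhds (by simp)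
  filter_upwards [hnear] with z hz
  have hz1 : z ≠ 1 := by rintro rfl; simp at hz
  have hz2 : z - 1 ≠ 0 := sub_ne_zero.2 hz1
  have hzeta := riemannZeta_eq_fractMellin hz
  rw [riemannZeta_eq_inv_sub_mul hz1] at hzeta
  field_simp at hzeta
  linear_combination hzeta

/-- The function `(s - 1) ζ(s) / s`, holomorphic away from `0`. Removing the pole in this way
leaves `|ζ|` unchanged on the critical line, where `|s - 1| = |s|`. -/
noncomputable def zetaQuot (s : ℂ) : ℂ := riemannZeta₁ s / s

lemma norm_zetaQuot_le {s : ℂ} (hs : 0 < s.re) : ‖zetaQuot s‖ ≤ 1 + (‖s‖ + 1) / s.re := by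
  have hs0 : s ≠ 0 := by rintro rfl; simp at hs
  have heq : zetaQuot s = 1 - (s - 1) * fractMellin s := by
    rw [zetaQuot, riemannZeta₁_eq hs]
    field_simp
  calc ‖zetaQuot s‖ ≤ ‖(1 : ℂ)‖ + ‖s - 1‖ * ‖fractMellin s‖ := by
        rw [heq, ← norm_mul]
        exact norm_sub_le _ _
    _ ≤ 1 + (‖s‖ + 1) * (1 / s.re) := by
        rw [norm_one]
        gcongr
        · exact (norm_sub_le _ _).trans_eq (by rw [norm_one])
        · exact norm_fractMellin_le hs
    _ = 1 + (‖s‖ + 1) / s.re := by ring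

lemma norm_zetaQuot_le_of_half_le {s : ℂ} (hs : 1 / 2 ≤ s.re) :
    ‖zetaQuot s‖ ≤ 3 + 2 * ‖s‖ := by
  have hs0 : 0 < s.re := by linarith
  refine (norm_zetaQuot_le hs0).trans ?_
  have hdiv : (‖s‖ + 1) / s.re ≤ (‖s‖ + 1) / (1 / 2) := by gcongr
  linarith

lemma zetaQuot_eq {s : ℂ} (hs : s ≠ 1) : zetaQuot s = (s - 1) / s * riemannZeta s := by
  rw [zetaQuot, riemannZeta_eq_inv_sub_mul hs]
  have : s - 1 ≠ 0 := sub_ne_zero.2 hs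
  field_simp

lemma zetaQuot_one : zetaQuot 1 = 1 := by simp [zetaQuot]

lemma differentiableOn_zetaQuot : DifferentiableOn ℂ zetaQuot {0}ᶜ := fun s hs ↦
  ((differentiable_riemannZeta₁ s).div differentiableAt_id hs).differentiableWithinAt

lemma norm_zetaQuot_half (t : ℝ) :
    ‖zetaQuot (1 / 2 + Complex.I * t)‖ = ‖riemannZeta (1 / 2 + Complex.I * t)‖ := by
  have hre : (1 / 2 + Complex.I * t : ℂ).re = 1 / 2 := by norm_num
  have hne_one : (1 / 2 + Complex.I * t : ℂ) ≠ 1 := fun h ↦ by norm_num [h] at hre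
  have hne_zero : (1 / 2 + Complex.I * t : ℂ) ≠ 0 := fun h ↦ by norm_num [h] at hre
  have hreflect : (1 / 2 + Complex.I * t - 1 : ℂ)
      = -(starRingEnd ℂ) (1 / 2 + Complex.I * t : ℂ) := by
    simp only [map_add, map_div₀, map_one, Complex.conj_ofNat, map_mul, Complex.conj_I,
      Complex.conj_ofReal]
    ring
  rw [zetaQuot_eq hne_one, norm_mul, norm_div, hreflect, norm_neg, Complex.norm_conj,
    div_self (norm_ne_zero_iff.2 hne_zero), one_mul]

lemma zetaQuot_ne_zero (hRH : RiemannHypothesis) {s : ℂ} (hs : 1 / 2 < s.re) :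
    zetaQuot s ≠ 0 := by
  by_cases hs1 : s = 1
  · simp [hs1, zetaQuot_one]
  have hs0 : s ≠ 0 := by rintro rfl; norm_num at hs
  rw [zetaQuot_eq hs1]
  refine mul_ne_zero (div_ne_zero (sub_ne_zero.2 hs1) hs0) fun hzero ↦ ?_
  have hnontrivial : ¬∃ n : ℕ, s = -2 * (n + 1) := by
    rintro ⟨n, rfl⟩
    have hre : (-2 * ((n : ℂ) + 1)).re = -2 * ((n : ℝ) + 1) := by simp
    linarith [n.cast_nonneg (α := ℝ)]
  exact hs.ne' (hRH s hzero hnontrivial hs1)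

lemma differentiableOn_of_exp_eq {U : Set ℂ} (hU : IsOpen U) {f l : ℂ → ℂ}
    (hf : DifferentiableOn ℂ f U) (hl : ContinuousOn l U)
    (hexp : ∀ z ∈ U, Complex.exp (l z) = f z) : DifferentiableOn ℂ l U := by
  intro z hz
  have hfz : f z ≠ 0 := hexp z hz ▸ Complex.exp_ne_zero _
  have hclose : ∀ᶠ w in 𝓝 z, ‖l w - l z‖ < 1 := by
    simpa only [dist_eq_norm] using
      (hl.continuousAt (hU.mem_nhds hz)).eventually (Metric.ball_mem_nhds (l z) one_pos)
  -- Near `z` the branch `l` stays within `1 < π` of `l z`, so it is a principal logarithm.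
  have hprincipal : l =ᶠ[𝓝 z] fun w ↦ l z + Complex.log (f w / f z) := by
    filter_upwards [hclose, hU.mem_nhds hz] with w hw hwU
    have him := abs_lt.1 ((Complex.abs_im_le_norm _).trans_lt hw)
    rw [← hexp w hwU, ← hexp z hz, ← Complex.exp_sub,
      Complex.log_exp (by linarith [Real.pi_gt_three]) (by linarith [Real.pi_gt_three])]
    ring
  have hlog : DifferentiableAt ℂ (fun w ↦ Complex.log (f w / f z)) z :=
    ((hf.differentiableAt (hU.mem_nhds hz)).div_const _).clog (by simp [div_self hfz])
  exact ((hlog.const_add _).congr_of_eventuallyEq hprincipal).differentiableWithinAt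

lemma exists_differentiableOn_exp_eq {U : Set ℂ} (hU : IsOpen U) (hconv : Convex ℝ U)
    (hne : U.Nonempty) {f : ℂ → ℂ} (hf : DifferentiableOn ℂ f U) (h0 : ∀ z ∈ U, f z ≠ 0) :
    ∃ l : ℂ → ℂ, DifferentiableOn ℂ l U ∧ ∀ z ∈ U, Complex.exp (l z) = f z := by
  have hsimply : IsSimplyConnected U := by
    have := hconv.contractibleSpace hne
    exact inferInstanceAs (SimplyConnectedSpace U)
  obtain ⟨l, hlc, hexp⟩ := Complex.exists_continuousOn_eqOn_exp_comp hsimply hU hf.continuousOn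
    (by rintro ⟨z, hz, hfz⟩; exact h0 z hz hfz)
  exact ⟨l, differentiableOn_of_exp_eq hU hf hlc fun z hz ↦ hexp hz, fun z hz ↦ hexp hz⟩

lemma eqOn_of_exp_eqOn {s : Set ℂ} (hs : IsPreconnected s) {f g : ℂ → ℂ}
    (hf : ContinuousOn f s) (hg : ContinuousOn g s)
    (hexp : ∀ z ∈ s, Complex.exp (f z) = Complex.exp (g z)) {z₀ : ℂ} (hz₀ : z₀ ∈ s)
    (h₀ : f z₀ = g z₀) : EqOn f g s :=
  Complex.isCoveringMap_exp.eqOn_of_comp_eqOn hs hf hg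
    (fun z hz ↦ Subtype.ext (hexp z hz)) hz₀ h₀

/-- The coefficients `Λ(k) / log k` of the Dirichlet series of `log ζ`; they vanish at `k = 0` and
`k = 1` because of the convention `x / 0 = 0`. -/
noncomputable def logZetaCoeff (k : ℕ) : ℝ := ArithmeticFunction.vonMangoldt k / Real.log k

lemma logZetaCoeff_nonneg (k : ℕ) : 0 ≤ logZetaCoeff k :=
  div_nonneg ArithmeticFunction.vonMangoldt_nonneg (Real.log_natCast_nonneg k)

lemma logZetaCoeff_le_one (k : ℕ) : logZetaCoeff k ≤ 1 :=
  div_le_one_of_le₀ ArithmeticFunction.vonMangoldt_le_log (Real.log_natCast_nonneg k)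

lemma logZetaCoeff_zero : logZetaCoeff 0 = 0 := by simp [logZetaCoeff]

/-- The Dirichlet series of `log ζ`, which converges for `Re s > 1`. -/
noncomputable def logZetaSeries (s : ℂ) : ℂ := ∑' k : ℕ, (logZetaCoeff k : ℂ) * (k : ℂ) ^ (-s)

lemma norm_logZetaTerm_le {s : ℂ} (hs : 2 ≤ s.re) (k : ℕ) :
    ‖(logZetaCoeff k : ℂ) * (k : ℂ) ^ (-s)‖ ≤ ((k : ℝ) ^ 2)⁻¹ := by
  rcases Nat.eq_zero_or_pos k with rfl | hk
  · simp [logZetaCoeff_zero]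
  have hk1 : (1 : ℝ) ≤ k := by exact_mod_cast hk
  calc ‖(logZetaCoeff k : ℂ) * (k : ℂ) ^ (-s)‖
      = logZetaCoeff k * (k : ℝ) ^ (-s.re) := by
        rw [norm_mul, Complex.norm_real, Real.norm_of_nonneg (logZetaCoeff_nonneg k),
          Complex.norm_natCast_cpow_of_pos hk, Complex.neg_re]
    _ ≤ 1 * (k : ℝ) ^ (-2 : ℝ) := by
        gcongr
        exact logZetaCoeff_le_one k
    _ = ((k : ℝ) ^ 2)⁻¹ := by rw [one_mul, Real.rpow_neg k.cast_nonneg, Real.rpow_two]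

lemma summable_inv_sq : Summable fun k : ℕ ↦ ((k : ℝ) ^ 2)⁻¹ :=
  Real.summable_nat_pow_inv.2 one_lt_two

lemma continuous_logZetaTerm (k : ℕ) :
    Continuous fun s : ℂ ↦ (logZetaCoeff k : ℂ) * (k : ℂ) ^ (-s) := by
  rcases Nat.eq_zero_or_pos k with rfl | hk
  · simpa [logZetaCoeff_zero] using continuous_const
  · exact continuous_const.mul (continuous_neg.const_cpow (Or.inl (Nat.cast_ne_zero.2 hk.ne')))

lemma continuousOn_logZetaSeries : ContinuousOn logZetaSeries {s | 2 ≤ s.re} :=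
  continuousOn_tsum (fun k ↦ (continuous_logZetaTerm k).continuousOn) summable_inv_sq
    fun k _ hs ↦ norm_logZetaTerm_le hs k

lemma norm_logZetaSeries_le {s : ℂ} (hs : 2 ≤ s.re) :
    ‖logZetaSeries s‖ ≤ ∑' k : ℕ, ((k : ℝ) ^ 2)⁻¹ :=
  tsum_of_norm_bounded summable_inv_sq.hasSum (norm_logZetaTerm_le hs)

lemma exp_logZetaSeries {s : ℂ} (hs : 1 < s.re) :
    Complex.exp (logZetaSeries s) = riemannZeta s := by
  rw [← riemannZeta_eq_exp_LSeries hs, LSeries_def₀ (by simp)]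
  congr 1
  refine tsum_congr fun k ↦ ?_
  rw [logZetaCoeff, Complex.cpow_neg, Complex.ofReal_div, Complex.natCast_log, ← div_eq_mul_inv]

/-- The principal logarithm of `1 - 1 / s`, which accounts for the factor `(s - 1) / s` of
`zetaQuot` to the right of `Re s = 1`. -/
noncomputable def logPoleFactor (s : ℂ) : ℂ := Complex.log (1 - s⁻¹)

lemma norm_inv_le_half {s : ℂ} (hs : 2 ≤ s.re) : ‖s⁻¹‖ ≤ 1 / 2 := by
  rw [norm_inv, one_div]
  exact inv_anti₀ two_pos (hs.trans (Complex.re_le_norm s))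

lemma one_sub_inv_mem_slitPlane {s : ℂ} (hs : 2 ≤ s.re) : 1 - s⁻¹ ∈ Complex.slitPlane := by
  left
  have hre := (Complex.re_le_norm s⁻¹).trans (norm_inv_le_half hs)
  rw [Complex.sub_re, Complex.one_re]
  linarith

lemma ne_zero_of_two_le_re {s : ℂ} (hs : 2 ≤ s.re) : s ≠ 0 := by
  rintro rfl
  norm_num at hs

lemma continuousOn_logPoleFactor : ContinuousOn logPoleFactor {s | 2 ≤ s.re} :=
  (continuousOn_const.sub (continuousOn_id.inv₀ fun _ hs ↦ ne_zero_of_two_le_re hs)).clog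
    fun _ hs ↦ one_sub_inv_mem_slitPlane hs

lemma norm_logPoleFactor_le {s : ℂ} (hs : 2 ≤ s.re) : ‖logPoleFactor s‖ ≤ 2 * ‖s⁻¹‖ := by
  have hlog := Complex.norm_log_one_add_half_le_self (z := -s⁻¹)
    (by rw [norm_neg]; exact norm_inv_le_half hs)
  rw [norm_neg, ← sub_eq_add_neg] at hlog
  rw [logPoleFactor]
  linarith [norm_nonneg s⁻¹]

lemma exp_logZetaSeries_add_logPoleFactor {s : ℂ} (hs : 2 ≤ s.re) :
    Complex.exp (logZetaSeries s + logPoleFactor s) = zetaQuot s := by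
  have hs0 := ne_zero_of_two_le_re hs
  have hs1 : s ≠ 1 := by rintro rfl; norm_num at hs
  rw [Complex.exp_add, exp_logZetaSeries (by linarith), logPoleFactor,
    Complex.exp_log (Complex.slitPlane_ne_zero (one_sub_inv_mem_slitPlane hs)), zetaQuot_eq hs1,
    mul_comm, sub_div, div_self hs0, one_div]

lemma norm_logZetaSeries_add_logPoleFactor_le {s : ℂ} (hs : 2 ≤ s.re) :
    ‖logZetaSeries s + logPoleFactor s‖ ≤ (∑' k : ℕ, ((k : ℝ) ^ 2)⁻¹) + 1 := by
  refine (norm_add_le _ _).trans (add_le_add (norm_logZetaSeries_le hs) ?_)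
  linarith [norm_logPoleFactor_le hs, norm_inv_le_half hs]

/-- `l` is the branch of `log ((s - 1) ζ(s) / s)` on the half-plane `Re s > 1/2` that is given by
the Dirichlet series of `log ζ` for `Re s ≥ 2`. -/
structure IsLogZetaQuot (l : ℂ → ℂ) : Prop where
  differentiableOn : DifferentiableOn ℂ l {s | 1 / 2 < s.re}
  exp_eq : ∀ s : ℂ, 1 / 2 < s.re → Complex.exp (l s) = zetaQuot s
  eq_logZetaSeries_add : ∀ s : ℂ, 2 ≤ s.re → l s = logZetaSeries s + logPoleFactor s

lemma exists_isLogZetaQuot (hRH : RiemannHypothesis) : ∃ l : ℂ → ℂ, IsLogZetaQuot l := by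
  obtain ⟨l, hl, hexp⟩ := exists_differentiableOn_exp_eq
    (isOpen_lt continuous_const Complex.continuous_re) (convex_halfSpace_re_gt (1 / 2))
    ⟨1, by norm_num⟩
    (differentiableOn_zetaQuot.mono fun s (hs : 1 / 2 < s.re) h ↦ by
      rw [mem_singleton_iff.1 h] at hs; norm_num at hs)
    fun s hs ↦ zetaQuot_ne_zero hRH hs
  set a : ℂ := logZetaSeries 2 + logPoleFactor 2 - l 2 with ha
  have hexpa : Complex.exp a = 1 := by
    rw [ha, Complex.exp_sub, exp_logZetaSeries_add_logPoleFactor (by norm_num),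
      hexp 2 (by norm_num), div_self (zetaQuot_ne_zero hRH (by norm_num))]
  have hexp' : ∀ s : ℂ, 1 / 2 < s.re → Complex.exp (l s + a) = zetaQuot s := fun s hs ↦ by
    rw [Complex.exp_add, hexpa, mul_one, hexp s hs]
  have hsub : {s : ℂ | 2 ≤ s.re} ⊆ {s | 1 / 2 < s.re} := fun s (hs : 2 ≤ s.re) ↦
    lt_of_lt_of_le (by norm_num : (1 / 2 : ℝ) < 2) hs
  refine ⟨fun s ↦ l s + a, hl.add_const _, hexp', eqOn_of_exp_eqOn
    (convex_halfSpace_re_ge 2).isPreconnected ((hl.add_const a).continuousOn.mono hsub)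
    (continuousOn_logZetaSeries.add continuousOn_logPoleFactor) (fun s hs ↦ ?_)
    (z₀ := 2) (by simp) (by simp [ha])⟩
  rw [hexp' s (hsub hs), exp_logZetaSeries_add_logPoleFactor hs]

namespace IsLogZetaQuot

variable {l : ℂ → ℂ}

lemma continuous_line (hl : IsLogZetaQuot l) {σ : ℝ} (hσ : 1 / 2 < σ) :
    Continuous fun t : ℝ ↦ l (σ + Complex.I * t) :=
  hl.differentiableOn.continuousOn.comp_continuous (by fun_prop) fun y ↦ by simpa using hσ

lemma re_eq (hl : IsLogZetaQuot l) {s : ℂ} (hs : 1 / 2 < s.re) :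
    (l s).re = Real.log ‖zetaQuot s‖ := by
  rw [← hl.exp_eq s hs, Complex.norm_exp, Real.log_exp]

lemma re_le (hl : IsLogZetaQuot l) {s : ℂ} (hs : 1 / 2 < s.re) : (l s).re ≤ 2 + 2 * ‖s‖ := by
  have hbound := norm_zetaQuot_le_of_half_le hs.le
  rw [← hl.exp_eq s hs, Complex.norm_exp] at hbound
  linarith [Real.add_one_le_exp (l s).re]

lemma norm_le_of_re_eq_two (hl : IsLogZetaQuot l) {s : ℂ} (hs : s.re = 2) :
    ‖l s‖ ≤ (∑' k : ℕ, ((k : ℝ) ^ 2)⁻¹) + 1 := by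
  rw [hl.eq_logZetaSeries_add s hs.ge]
  exact norm_logZetaSeries_add_logPoleFactor_le hs.ge

/-- The Borel–Carathéodory inequality on discs of radius `3/2` centred on the line `Re s = 2`. -/
lemma norm_line_le (hl : IsLogZetaQuot l) {x : ℝ} (hx : 1 / 2 < x) (hx2 : x ≤ 2) (y : ℝ) :
    ‖l (x + Complex.I * y)‖ ≤
      (30 * (1 + |y|) + 3 * ((∑' k : ℕ, ((k : ℝ) ^ 2)⁻¹) + 1)) / (x - 1 / 2) := by
  set c : ℂ := 2 + Complex.I * y with hc
  have hcre : c.re = 2 := by simp [hc]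
  have hball : ∀ z ∈ Metric.ball (0 : ℂ) (3 / 2), 1 / 2 < (c + z).re := fun z hz ↦ by
    have hre := (abs_lt.1 ((Complex.abs_re_le_norm z).trans_lt (mem_ball_zero_iff.1 hz))).1
    rw [Complex.add_re, hcre]
    linarith
  have hdiff : DifferentiableOn ℂ (fun z ↦ l (c + z)) (Metric.ball 0 (3 / 2)) :=
    hl.differentiableOn.comp (by fun_prop) hball
  have hre : MapsTo (fun z ↦ l (c + z)) (Metric.ball 0 (3 / 2))
      {z | z.re ≤ 10 * (1 + |y|)} := fun z hz ↦ by
    have hcnorm : ‖c‖ ≤ 2 + |y| := (norm_add_le _ _).trans (by simp)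
    have hnorm : ‖c + z‖ ≤ 2 + |y| + 3 / 2 :=
      (norm_add_le _ _).trans (add_le_add hcnorm (mem_ball_zero_iff.1 hz).le)
    simp only [Set.mem_ofPred_eq]
    linarith [hl.re_le (hball z hz), abs_nonneg y]
  have hnorm : ‖((x - 2 : ℝ) : ℂ)‖ = 2 - x := by
    rw [Complex.norm_real, Real.norm_eq_abs, abs_sub_comm, abs_of_nonneg (by linarith)]
  have hBC := Complex.borelCaratheodory (by positivity) hdiff hre (by norm_num)
    (mem_ball_zero_iff.2 (hnorm ▸ by linarith : ‖((x - 2 : ℝ) : ℂ)‖ < 3 / 2))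
  have hshift : c + ((x - 2 : ℝ) : ℂ) = x + Complex.I * y := by rw [hc]; push_cast; ring
  rw [hshift, add_zero, hnorm, ← add_div] at hBC
  have hcentre := hl.norm_le_of_re_eq_two hcre
  refine hBC.trans (div_le_div₀ (by positivity) (add_le_add ?_ ?_) (by linarith) (by linarith))
  · nlinarith [abs_nonneg y]
  · rw [mul_comm]
    exact mul_le_mul (by linarith) hcentre (norm_nonneg _) (by norm_num)

lemma exists_norm_le (hl : IsLogZetaQuot l) {σ : ℝ} (hσ : 1 / 2 < σ) :
    ∃ C : ℝ, 0 ≤ C ∧ ∀ x ∈ Icc σ 2, ∀ y : ℝ, ‖l (x + Complex.I * y)‖ ≤ C * (1 + |y|) := by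
  set A := (∑' k : ℕ, ((k : ℝ) ^ 2)⁻¹) + 1
  have hA0 : 0 ≤ A := add_nonneg (tsum_nonneg fun k ↦ by positivity) zero_le_one
  have hσ' : 0 < σ - 1 / 2 := by linarith
  refine ⟨(30 + 3 * A) / (σ - 1 / 2), by positivity, fun x hx y ↦ ?_⟩
  calc ‖l (x + Complex.I * y)‖ ≤ (30 * (1 + |y|) + 3 * A) / (x - 1 / 2) :=
        hl.norm_line_le (hσ.trans_le hx.1) hx.2 y
    _ ≤ ((30 + 3 * A) * (1 + |y|)) / (σ - 1 / 2) := by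
        refine div_le_div₀ (by positivity) ?_ hσ' (by linarith [hx.1])
        nlinarith [abs_nonneg y, mul_nonneg hA0 (abs_nonneg y)]
    _ = (30 + 3 * A) / (σ - 1 / 2) * (1 + |y|) := by rw [div_mul_eq_mul_div]

end IsLogZetaQuot

section VerticalLine

variable {H : ℂ → ℂ} {a b : ℝ}

lemma integral_rect_vertical_eq (hab : a ≤ b) (hd : DifferentiableOn ℂ H {s | s.re ∈ Icc a b})
    (n : ℝ) :
    (∫ x in a..b, H (x + ((-n : ℝ) : ℂ) * Complex.I)) - (∫ x in a..b, H (x + (n : ℂ) * Complex.I))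
      + Complex.I * ((∫ y in (-n)..n, H (b + Complex.I * y))
        - ∫ y in (-n)..n, H (a + Complex.I * y)) = 0 := by
  have hrect := Complex.integral_boundary_rect_eq_zero_of_differentiableOn H
    (a + (-n : ℝ) * Complex.I) (b + (n : ℝ) * Complex.I) (hd.mono fun s hs ↦ by
      simpa [uIcc_of_le hab] using hs.1)
  simp only [Complex.add_re, Complex.ofReal_re, Complex.mul_re, Complex.I_re, mul_zero,
    Complex.ofReal_im, Complex.I_im, mul_one, sub_self, add_zero, Complex.add_im,
    Complex.mul_im, zero_add, smul_eq_mul] at hrect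
  simp only [mul_comm Complex.I (Complex.ofReal _)]
  linear_combination hrect

lemma tendsto_integral_horizontal {B : ℝ → ℝ} (hab : a ≤ b)
    (hB : ∀ x ∈ Icc a b, ∀ y : ℝ, ‖H (x + Complex.I * y)‖ ≤ B y) {c : ℝ → ℝ}
    (hc : Tendsto (fun n ↦ B (c n)) atTop (𝓝 0)) :
    Tendsto (fun n : ℝ ↦ ∫ x in a..b, H (x + (c n : ℂ) * Complex.I)) atTop (𝓝 0) := by
  refine squeeze_zero_norm (a := fun n ↦ B (c n) * |b - a|) (fun n ↦ ?_)
    (by simpa using hc.mul_const |b - a|)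
  refine intervalIntegral.norm_integral_le_of_norm_le_const fun x hx ↦ ?_
  rw [uIoc_of_le hab] at hx
  rw [mul_comm]
  exact hB x ⟨hx.1.le, hx.2⟩ _

lemma integral_verticalLine_eq (hab : a ≤ b) (hd : DifferentiableOn ℂ H {s | s.re ∈ Icc a b})
    {B : ℝ → ℝ} (hB : ∀ x ∈ Icc a b, ∀ y : ℝ, ‖H (x + Complex.I * y)‖ ≤ B y)
    (hBi : Integrable B) (hBtop : Tendsto B atTop (𝓝 0)) (hBbot : Tendsto B atBot (𝓝 0)) :
    ∫ y : ℝ, H (a + Complex.I * y) = ∫ y : ℝ, H (b + Complex.I * y) := by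
  have hint : ∀ x ∈ Icc a b, Integrable fun y : ℝ ↦ H (x + Complex.I * y) := fun x hx ↦
    hBi.mono' (hd.continuousOn.comp_continuous (by fun_prop)
      fun y ↦ by simpa using hx).aestronglyMeasurable (ae_of_all _ (hB x hx))
  have hvert : ∀ x ∈ Icc a b, Tendsto (fun n : ℝ ↦ ∫ y in (-n)..n, H (x + Complex.I * y)) atTop
      (𝓝 (∫ y : ℝ, H (x + Complex.I * y))) := fun x hx ↦
    intervalIntegral_tendsto_integral (hint x hx) tendsto_neg_atTop_atBot tendsto_id
  have hlim := ((tendsto_integral_horizontal hab hB (hBbot.comp tendsto_neg_atTop_atBot)).sub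
    (tendsto_integral_horizontal hab hB (c := id) hBtop)).add
    (((hvert b ⟨hab, le_rfl⟩).sub (hvert a ⟨le_rfl, hab⟩)).const_mul Complex.I)
  have hzero := tendsto_nhds_unique hlim (tendsto_const_nhds.congr fun n ↦
    (integral_rect_vertical_eq hab hd n).symm)
  simp only [sub_self, zero_add, mul_eq_zero, Complex.I_ne_zero, false_or] at hzero
  exact (sub_eq_zero.1 hzero).symm

end VerticalLine

/-- The Gaussian weight of width `L` centred at `τ`. -/
noncomputable def gaussW (L τ u : ℝ) : ℝ := Real.exp (-((u - τ) / L) ^ 2)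

/-- The entire extension of `gaussW L τ`, used on the line to which the contour is shifted. -/
noncomputable def gaussC (L τ : ℝ) (z : ℂ) : ℂ := Complex.exp (-((z - τ) / L) ^ 2)

lemma gaussW_pos (L τ u : ℝ) : 0 < gaussW L τ u := Real.exp_pos _

lemma gaussW_le_one (L τ u : ℝ) : gaussW L τ u ≤ 1 := by
  rw [gaussW, Real.exp_le_one_iff]; nlinarith [sq_nonneg ((u - τ) / L)]

lemma continuous_gaussW (L τ : ℝ) : Continuous (gaussW L τ) := by
  unfold gaussW; fun_prop

lemma differentiable_gaussC (L τ : ℝ) : Differentiable ℂ (gaussC L τ) := by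
  unfold gaussC; fun_prop

lemma gaussC_ofReal (L τ u : ℝ) : gaussC L τ u = (gaussW L τ u : ℂ) := by
  simp [gaussC, gaussW]

lemma norm_gaussC (L τ u δ : ℝ) :
    ‖gaussC L τ (u - Complex.I * δ)‖ = Real.exp ((δ / L) ^ 2) * gaussW L τ u := by
  rw [gaussC, gaussW, Complex.norm_exp, ← Real.exp_add]
  congr 1
  have hsplit : (u - Complex.I * δ - τ : ℂ) / L =
      (((u - τ) / L : ℝ) : ℂ) - ((δ / L : ℝ) : ℂ) * Complex.I := by
    push_cast; ring
  rw [hsplit]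
  simp only [sq, Complex.neg_re, Complex.mul_re, Complex.sub_re, Complex.sub_im,
    Complex.ofReal_re, Complex.ofReal_im, Complex.I_re, Complex.I_im, Complex.mul_im]
  ring

lemma gaussW_eq (L τ u : ℝ) : gaussW L τ u = Real.exp (-(L⁻¹ ^ 2) * (u - τ) ^ 2) := by
  rw [gaussW]; congr 1; ring

lemma integrable_gaussW {L : ℝ} (hL : 0 < L) (τ : ℝ) : Integrable (gaussW L τ) := by
  have h := (integrable_exp_neg_mul_sq (b := L⁻¹ ^ 2) (by positivity)).comp_sub_right τ
  exact h.congr (ae_of_all _ fun u ↦ (gaussW_eq L τ u).symm)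

lemma integral_gaussW {L : ℝ} (hL : 0 < L) (τ : ℝ) :
    ∫ u, gaussW L τ u = L * √Real.pi := by
  simp_rw [gaussW_eq]
  rw [integral_sub_right_eq_self (fun u ↦ Real.exp (-(L⁻¹ ^ 2) * u ^ 2)) τ, integral_gaussian]
  rw [inv_pow, div_inv_eq_mul, mul_comm, Real.sqrt_mul (by positivity), Real.sqrt_sq hL.le]

lemma integrable_abs_mul_exp_neg_mul_sq {b : ℝ} (hb : 0 < b) :
    Integrable fun u : ℝ ↦ |u| * Real.exp (-b * u ^ 2) := by
  refine (integrable_mul_exp_neg_mul_sq hb).norm.congr (ae_of_all _ fun u ↦ ?_)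
  simp [abs_of_pos (Real.exp_pos _)]

lemma integral_Ioi_mul_exp_neg_mul_sq {b : ℝ} (hb : 0 < b) :
    ∫ r in Ioi (0 : ℝ), r * Real.exp (-b * r ^ 2) = (2 * b)⁻¹ := by
  have hcomplex := integral_mul_cexp_neg_mul_sq (b := (b : ℂ)) (by simpa)
  have hcast : ((∫ r in Ioi (0 : ℝ), r * Real.exp (-b * r ^ 2) : ℝ) : ℂ) =
      (((2 * b)⁻¹ : ℝ) : ℂ) := by
    rw [← integral_complex_ofReal]
    push_cast
    exact hcomplex
  exact_mod_cast hcast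

lemma integral_abs_mul_exp_neg_mul_sq {b : ℝ} (hb : 0 < b) :
    ∫ u : ℝ, |u| * Real.exp (-b * u ^ 2) = b⁻¹ := by
  have heven := integral_comp_abs (f := fun u ↦ u * Real.exp (-b * u ^ 2))
  simp only [sq_abs] at heven
  rw [heven, integral_Ioi_mul_exp_neg_mul_sq hb]
  field_simp

lemma integrable_one_add_abs_sub_mul_gaussW {L : ℝ} (hL : 0 < L) (τ : ℝ) :
    Integrable fun u ↦ (1 + |u - τ|) * gaussW L τ u := by
  have hb : 0 < L⁻¹ ^ 2 := by positivity
  simp_rw [gaussW_eq, add_mul, one_mul]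
  exact ((integrable_exp_neg_mul_sq hb).add
    (integrable_abs_mul_exp_neg_mul_sq hb)).comp_sub_right τ

lemma integral_one_add_abs_sub_mul_gaussW {L : ℝ} (hL : 0 < L) (τ : ℝ) :
    ∫ u, (1 + |u - τ|) * gaussW L τ u = L * √Real.pi + L ^ 2 := by
  have hb : 0 < L⁻¹ ^ 2 := by positivity
  have hmass := integral_gaussW hL 0
  simp_rw [gaussW_eq, sub_zero] at hmass
  simp_rw [gaussW_eq, add_mul, one_mul]
  rw [integral_sub_right_eq_self
    (fun u ↦ Real.exp (-(L⁻¹ ^ 2) * u ^ 2) + |u| * Real.exp (-(L⁻¹ ^ 2) * u ^ 2)) τ,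
    integral_add (integrable_exp_neg_mul_sq hb) (integrable_abs_mul_exp_neg_mul_sq hb), hmass,
    integral_abs_mul_exp_neg_mul_sq hb, inv_pow, inv_inv]

lemma one_add_abs_le (t τ : ℝ) : 1 + |t| ≤ (1 + |τ|) * (1 + |t - τ|) := by
  have htriangle : |t| ≤ |τ| + |t - τ| := by simpa using abs_add_le τ (t - τ)
  nlinarith [mul_nonneg (abs_nonneg τ) (abs_nonneg (t - τ))]

lemma one_add_abs_mul_gaussW_le (L τ u : ℝ) :
    (1 + |u|) * gaussW L τ u ≤ (1 + |τ|) * ((1 + |u - τ|) * gaussW L τ u) := by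
  rw [← mul_assoc]
  exact mul_le_mul_of_nonneg_right (one_add_abs_le u τ) (gaussW_pos L τ u).le

lemma integrable_one_add_abs_mul_gaussW {L : ℝ} (hL : 0 < L) (τ : ℝ) :
    Integrable fun u ↦ (1 + |u|) * gaussW L τ u := by
  refine ((integrable_one_add_abs_sub_mul_gaussW hL τ).const_mul (1 + |τ|)).mono'
    (by have := continuous_gaussW L τ; fun_prop) (ae_of_all _ fun u ↦ ?_)
  have := gaussW_pos L τ u
  rw [Real.norm_of_nonneg (by positivity)]
  exact one_add_abs_mul_gaussW_le L τ u

lemma integral_one_add_abs_mul_gaussW_le {L : ℝ} (hL : 0 < L) (τ : ℝ) :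
    ∫ u, (1 + |u|) * gaussW L τ u ≤ (1 + |τ|) * (L * √Real.pi + L ^ 2) := by
  rw [← integral_one_add_abs_sub_mul_gaussW hL τ, ← integral_const_mul]
  exact integral_mono (integrable_one_add_abs_mul_gaussW hL τ)
    ((integrable_one_add_abs_sub_mul_gaussW hL τ).const_mul _) (one_add_abs_mul_gaussW_le L τ)

lemma tendsto_one_add_abs_mul_gaussW {L : ℝ} (hL : 0 < L) (τ : ℝ) :
    Tendsto (fun u ↦ (1 + |u|) * gaussW L τ u) (cocompact ℝ) (𝓝 0) := by
  have hpow (k : ℝ) :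
      Tendsto (fun u : ℝ ↦ |u| ^ k * Real.exp (-(L⁻¹ ^ 2) * u ^ 2)) (cocompact ℝ) (𝓝 0) :=
    tendsto_rpow_abs_mul_exp_neg_mul_sq_cocompact (by positivity) k
  have hbound := (((hpow 0).add (hpow 1)).comp
    (Homeomorph.subRight τ).isClosedEmbedding.tendsto_cocompact).const_mul (1 + |τ|)
  simp only [Real.rpow_zero, Real.rpow_one, add_zero, mul_zero, ← add_mul] at hbound
  refine squeeze_zero (fun u ↦ by have := gaussW_pos L τ u; positivity) (fun u ↦ ?_) hbound
  simpa only [Function.comp, Homeomorph.subRight_apply, ← gaussW_eq] using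
    one_add_abs_mul_gaussW_le L τ u

lemma ofReal_pi_div_inv_sq_cpow_half {L : ℝ} (hL : 0 < L) :
    ((Real.pi : ℂ) / -((-(L⁻¹ ^ 2) : ℝ) : ℂ)) ^ (1 / 2 : ℂ) = ((L * √Real.pi : ℝ) : ℂ) := by
  have hbase : (Real.pi : ℂ) / -((-(L⁻¹ ^ 2) : ℝ) : ℂ) = ((L ^ 2 * Real.pi : ℝ) : ℂ) := by
    push_cast; field_simp
  have hhalf : (1 / 2 : ℂ) = ((1 / 2 : ℝ) : ℂ) := by push_cast; ring
  rw [hbase, hhalf, ← Complex.ofReal_cpow (by positivity), ← Real.sqrt_eq_rpow,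
    Real.sqrt_mul (by positivity), Real.sqrt_sq hL.le]

lemma integral_cexp_mul_gaussC {L : ℝ} (hL : 0 < L) (τ δ μ : ℝ) :
    ∫ t : ℝ, Complex.exp (Complex.I * μ * t) * gaussC L τ (t - Complex.I * δ) =
      (L * √Real.pi : ℝ) *
        Complex.exp (-(L ^ 2 * μ ^ 2 / 4 : ℝ) + Complex.I * μ * (τ + Complex.I * δ)) := by
  have hLc : (L : ℂ) ≠ 0 := by exact_mod_cast hL.ne'
  have hb : (((-(L⁻¹ ^ 2) : ℝ) : ℂ)).re < 0 := by
    rw [Complex.ofReal_re, neg_lt_zero]; positivity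
  have hquad := integral_cexp_quadratic hb
    (Complex.I * μ + 2 * (τ + Complex.I * δ) / L ^ 2) (-(τ + Complex.I * δ) ^ 2 / L ^ 2)
  rw [ofReal_pi_div_inv_sq_cpow_half hL] at hquad
  convert hquad using 1
  · congr 1; ext t
    rw [gaussC, ← Complex.exp_add]
    congr 1
    push_cast
    field_simp
    ring
  · congr 2
    push_cast
    field_simp
    ring_nf
    simp only [Complex.I_sq]
    ring

lemma sqrt_pi_le_two : √Real.pi ≤ 2 := by
  rw [Real.sqrt_le_left (by norm_num)]
  linarith [Real.pi_lt_four]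

/-- The Gaussian `gaussC L τ` modulated by the frequency `μ`; a product `(m / n) ^ (i t)` of the
squared resonator enters as the frequency `μ = log m - log n`. -/
noncomputable def twistKernel (L τ μ : ℝ) (z : ℂ) : ℂ :=
  Complex.exp (Complex.I * μ * z) * gaussC L τ z

lemma differentiable_twistKernel (L τ μ : ℝ) : Differentiable ℂ (twistKernel L τ μ) :=
  Differentiable.mul (by fun_prop) (differentiable_gaussC L τ)

lemma continuous_twistKernel_ofReal (L τ μ : ℝ) : Continuous fun t : ℝ ↦ twistKernel L τ μ t :=
  (differentiable_twistKernel L τ μ).continuous.comp Complex.continuous_ofReal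

lemma continuous_twistKernel_line (L τ μ δ : ℝ) :
    Continuous fun t : ℝ ↦ twistKernel L τ μ (t - Complex.I * δ) :=
  (differentiable_twistKernel L τ μ).continuous.comp (by fun_prop)

lemma norm_twistKernel_line (L τ μ δ t : ℝ) :
    ‖twistKernel L τ μ (t - Complex.I * δ)‖ =
      Real.exp (μ * δ) * Real.exp ((δ / L) ^ 2) * gaussW L τ t := by
  rw [twistKernel, norm_mul, norm_gaussC, Complex.norm_exp, ← mul_assoc]
  congr 3
  simp

lemma norm_twistKernel_ofReal (L τ μ t : ℝ) : ‖twistKernel L τ μ t‖ = gaussW L τ t := by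
  simpa using norm_twistKernel_line L τ μ 0 t

lemma norm_twistKernel_line_le (L τ μ t : ℝ) {δ : ℝ} (hδ0 : 0 ≤ δ) (hδ2 : δ ≤ 2) :
    ‖twistKernel L τ μ (t - Complex.I * δ)‖ ≤
      Real.exp (|μ| * 2) * Real.exp ((2 / L) ^ 2) * gaussW L τ t := by
  rw [norm_twistKernel_line]
  have hμ : μ * δ ≤ |μ| * 2 := mul_le_mul (le_abs_self μ) hδ2 hδ0 (abs_nonneg μ)
  have hL : (δ / L) ^ 2 ≤ (2 / L) ^ 2 := by
    rw [div_pow, div_pow]; gcongr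
  have := gaussW_pos L τ t
  gcongr

lemma integrable_twistKernel_line {L : ℝ} (hL : 0 < L) (τ μ δ : ℝ) :
    Integrable fun t : ℝ ↦ twistKernel L τ μ (t - Complex.I * δ) :=
  ((integrable_gaussW hL τ).const_mul _).mono'
    (continuous_twistKernel_line L τ μ δ).aestronglyMeasurable
    (ae_of_all _ fun t ↦ (norm_twistKernel_line L τ μ δ t).le)

lemma IsLogZetaQuot.integral_shift {l : ℂ → ℂ} (hl : IsLogZetaQuot l) {σ : ℝ} (hσ : 1 / 2 < σ)
    (hσ2 : σ ≤ 2) {L : ℝ} (hL : 0 < L) (τ μ : ℝ) :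
    ∫ t : ℝ, l (σ + Complex.I * t) * twistKernel L τ μ t =
      ∫ t : ℝ, l (2 + Complex.I * t) * twistKernel L τ μ (t - Complex.I * (2 - σ : ℝ)) := by
  obtain ⟨C, hC0, hC⟩ := hl.exists_norm_le hσ
  have hdiff : DifferentiableOn ℂ (fun s ↦ l s * twistKernel L τ μ (-Complex.I * (s - σ)))
      {s | s.re ∈ Icc σ 2} :=
    (hl.differentiableOn.mono fun s hs ↦ lt_of_lt_of_le hσ hs.1).mul
      ((differentiable_twistKernel L τ μ).comp (by fun_prop)).differentiableOn
  have harg (x y : ℝ) : -Complex.I * ((x : ℂ) + Complex.I * y - σ) =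
      y - Complex.I * (x - σ : ℝ) := by
    push_cast
    linear_combination (-(y : ℂ)) * Complex.I_sq
  set K : ℝ := C * (Real.exp (|μ| * 2) * Real.exp ((2 / L) ^ 2))
  have hbound : ∀ x ∈ Icc σ 2, ∀ y : ℝ, ‖l (x + Complex.I * y) *
      twistKernel L τ μ (-Complex.I * ((x : ℂ) + Complex.I * y - σ))‖ ≤
        K * ((1 + |y|) * gaussW L τ y) := by
    intro x hx y
    rw [harg, norm_mul]
    calc _ ≤ (C * (1 + |y|)) *
          (Real.exp (|μ| * 2) * Real.exp ((2 / L) ^ 2) * gaussW L τ y) := by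
          gcongr
          · exact hC x hx y
          · exact norm_twistKernel_line_le L τ μ y (by linarith [hx.1]) (by linarith [hx.2])
      _ = K * ((1 + |y|) * gaussW L τ y) := by ring
  have hdecay := (tendsto_one_add_abs_mul_gaussW hL τ).const_mul K
  rw [mul_zero] at hdecay
  have hshift := integral_verticalLine_eq hσ2 hdiff hbound
    ((integrable_one_add_abs_mul_gaussW hL τ).const_mul K)
    (hdecay.mono_left atTop_le_cocompact) (hdecay.mono_left atBot_le_cocompact)
  simp only [harg] at hshift
  simpa only [sub_self, Complex.ofReal_zero, mul_zero, sub_zero,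
    Complex.ofReal_ofNat] using hshift

/-- The `k`-th term of the Dirichlet series of `log ζ` on the line `Re s = 2`, integrated against a
twisted Gaussian moved by `δ` into the lower half-plane. -/
noncomputable def gaussTerm (L τ δ μ : ℝ) (k : ℕ) : ℂ :=
  ∫ t : ℝ, (logZetaCoeff k : ℂ) * (k : ℂ) ^ (-(2 + Complex.I * t)) *
    twistKernel L τ μ (t - Complex.I * δ)

lemma natCast_cpow_neg_two_add {k : ℕ} (hk : 0 < k) (t : ℝ) :
    (k : ℂ) ^ (-(2 + Complex.I * t)) =
      (((k : ℝ) ^ 2)⁻¹ : ℝ) * Complex.exp (-(Complex.I * Real.log k * t)) := by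
  have hkc : (k : ℂ) ≠ 0 := by exact_mod_cast hk.ne'
  rw [neg_add, Complex.cpow_add _ _ hkc, Complex.cpow_neg]
  congr 1
  · push_cast
    congr 1
    exact_mod_cast Complex.cpow_natCast (k : ℂ) 2
  · rw [Complex.cpow_def_of_ne_zero hkc, ← Complex.natCast_log]
    congr 1
    ring

lemma gaussTerm_eq {L : ℝ} (hL : 0 < L) (τ δ μ : ℝ) {k : ℕ} (hk : 0 < k) :
    gaussTerm L τ δ μ k =
      (logZetaCoeff k * ((k : ℝ) ^ 2)⁻¹ * Real.exp (μ * δ) * (L * √Real.pi) : ℝ) *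
      Complex.exp (-(L ^ 2 * (μ - Real.log k) ^ 2 / 4 : ℝ) +
        Complex.I * (μ - Real.log k : ℝ) * (τ + Complex.I * δ)) := by
  have hgauss := integral_cexp_mul_gaussC hL τ δ (μ - Real.log k)
  have hshift (t : ℝ) : Complex.exp (Complex.I * μ * (t - Complex.I * δ)) =
      Complex.exp (μ * δ) * Complex.exp (Complex.I * μ * t) := by
    rw [← Complex.exp_add]
    congr 1
    linear_combination (-(μ : ℂ) * δ) * Complex.I_sq
  have htwist (t : ℝ) : Complex.exp (Complex.I * (μ - Real.log k : ℝ) * t) =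
      Complex.exp (Complex.I * μ * t) * Complex.exp (-(Complex.I * Real.log k * t)) := by
    rw [← Complex.exp_add]
    congr 1
    push_cast
    ring
  rw [Complex.ofReal_mul, mul_assoc, ← hgauss, gaussTerm, ← integral_const_mul]
  congr 1
  ext t
  rw [natCast_cpow_neg_two_add hk, twistKernel, hshift, htwist]
  push_cast
  ring

lemma norm_gaussTerm {L : ℝ} (hL : 0 < L) (τ δ μ : ℝ) {k : ℕ} (hk : 0 < k) :
    ‖gaussTerm L τ δ μ k‖ =
      logZetaCoeff k * ((k : ℝ) ^ 2)⁻¹ * Real.exp (μ * δ) * (L * √Real.pi) *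
      Real.exp (-(L ^ 2 * (μ - Real.log k) ^ 2 / 4) - (μ - Real.log k) * δ) := by
  have := logZetaCoeff_nonneg k
  rw [gaussTerm_eq hL τ δ μ hk, norm_mul, Complex.norm_real, Complex.norm_exp,
    Real.norm_of_nonneg (by positivity)]
  congr 2
  generalize μ - Real.log k = ν
  simp [-Complex.ofReal_pow, -Complex.ofReal_mul, -Complex.ofReal_div]
  ring

lemma gaussTerm_zero (L τ δ μ : ℝ) : gaussTerm L τ δ μ 0 = 0 := by
  simp [gaussTerm, logZetaCoeff_zero]

lemma gaussTerm_log {L : ℝ} (hL : 0 < L) (τ σ : ℝ) {k : ℕ} (hk : 0 < k) :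
    gaussTerm L τ (2 - σ) (Real.log k) k =
      (L * √Real.pi * (logZetaCoeff k * (k : ℝ) ^ (-σ)) : ℝ) := by
  have hk' : (0 : ℝ) < k := by exact_mod_cast hk
  have hpow : Real.exp (Real.log k * (2 - σ)) = (k : ℝ) ^ 2 * (k : ℝ) ^ (-σ) := by
    rw [← Real.rpow_def_of_pos hk', sub_eq_add_neg, Real.rpow_add hk', Real.rpow_two]
  have hcoeff : logZetaCoeff k * ((k : ℝ) ^ 2)⁻¹ * ((k : ℝ) ^ 2 * (k : ℝ) ^ (-σ)) *
      (L * √Real.pi) = L * √Real.pi * (logZetaCoeff k * (k : ℝ) ^ (-σ)) := by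
    field_simp
  rw [gaussTerm_eq hL τ _ _ hk, hpow, sub_self, hcoeff]
  simp

lemma inv_le_abs_log_sub_log {a b N : ℕ} (ha : 0 < a) (hb : 0 < b) (hab : a ≠ b)
    (hN : a ≤ N) : 1 / (2 * N : ℝ) ≤ |Real.log a - Real.log b| := by
  wlog h : a < b generalizing a b
  · rw [abs_sub_comm]
    exact this hb ha hab.symm (by omega) (by omega)
  have ha' : (1 : ℝ) ≤ a := by exact_mod_cast ha
  have hb' : (0 : ℝ) < b := by exact_mod_cast hb
  have hsucc : (a : ℝ) + 1 ≤ b := by exact_mod_cast h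
  have haN : (a : ℝ) ≤ N := by exact_mod_cast hN
  calc 1 / (2 * N : ℝ) ≤ 1 - a / b := by
        rw [one_sub_div hb'.ne', div_le_div_iff₀ (by linarith) hb']
        nlinarith
    _ ≤ Real.log b - Real.log a := by
        rw [← Real.log_div hb'.ne' (by linarith), ← inv_div]
        exact Real.one_sub_inv_le_log_of_pos (div_pos hb' (by linarith))
    _ ≤ |Real.log a - Real.log b| := by
        rw [abs_sub_comm]
        exact le_abs_self _

lemma inv_le_abs_log_div_sub_log {m n k N : ℕ} (hm : 0 < m) (hn : 0 < n) (hk : 0 < k)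
    (hmN : m ≤ N) (hne : k * n ≠ m) :
    1 / (2 * N : ℝ) ≤ |Real.log m - Real.log n - Real.log k| := by
  have hk' : (k : ℝ) ≠ 0 := by exact_mod_cast hk.ne'
  have hn' : (n : ℝ) ≠ 0 := by exact_mod_cast hn.ne'
  have hgap := inv_le_abs_log_sub_log hm (Nat.mul_pos hk hn) hne.symm hmN
  rwa [Nat.cast_mul, Real.log_mul hk' hn', add_comm, ← sub_sub] at hgap

lemma exp_neg_le_inv {x : ℝ} (hx : 0 < x) : Real.exp (-x) ≤ x⁻¹ := by
  rw [Real.exp_neg]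
  apply inv_anti₀ hx
  linarith [Real.add_one_le_exp x]

-- Since `L² |ν| ≥ 16`, half of the Gaussian exponent absorbs the linear term.
lemma exp_neg_sq_sub_mul_le {L δ ν N : ℝ} (hN : 0 < N) (hν : 1 / (2 * N) ≤ |ν|)
    (hLN : 32 * N ≤ L ^ 2) (hδ0 : 0 ≤ δ) (hδ : δ ≤ 2) :
    Real.exp (-(L ^ 2 * ν ^ 2 / 4) - ν * δ) ≤ 32 * N ^ 2 / L ^ 2 := by
  have hν0 : 0 < |ν| := lt_of_lt_of_le (by positivity) hν
  have hL0 : 0 < L ^ 2 := lt_of_lt_of_le (by positivity) hLN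
  have hlarge : 16 ≤ L ^ 2 * |ν| := by
    calc (16 : ℝ) = 32 * N * (1 / (2 * N)) := by field_simp; norm_num
      _ ≤ L ^ 2 * |ν| := by gcongr
  have hlinear : -(ν * δ) ≤ |ν| * 2 := by
    calc -(ν * δ) ≤ |ν * δ| := neg_le_abs _
      _ = |ν| * δ := by rw [abs_mul, abs_of_nonneg hδ0]
      _ ≤ |ν| * 2 := by gcongr
  have habsorb : -(L ^ 2 * ν ^ 2 / 4) - ν * δ ≤ -(L ^ 2 * ν ^ 2 / 8) := by
    rw [← sq_abs ν]
    nlinarith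
  have hpos : 0 < L ^ 2 * ν ^ 2 / 8 := by
    rw [← sq_abs ν]; positivity
  calc Real.exp (-(L ^ 2 * ν ^ 2 / 4) - ν * δ)
      ≤ Real.exp (-(L ^ 2 * ν ^ 2 / 8)) := Real.exp_le_exp.2 habsorb
    _ ≤ (L ^ 2 * |ν| ^ 2 / 8)⁻¹ := by rw [sq_abs]; exact exp_neg_le_inv hpos
    _ ≤ (L ^ 2 * (1 / (2 * N)) ^ 2 / 8)⁻¹ := by gcongr
    _ = 32 * N ^ 2 / L ^ 2 := by field_simp; norm_num

lemma exp_log_sub_log_mul_le {m n N : ℕ} (hm : 0 < m) (hmN : m ≤ N) {δ : ℝ} (hδ0 : 0 ≤ δ)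
    (hδ : δ ≤ 2) : Real.exp ((Real.log m - Real.log n) * δ) ≤ (N : ℝ) ^ 2 := by
  have hmlog : Real.log m ≤ Real.log N :=
    Real.log_le_log (by exact_mod_cast hm) (by exact_mod_cast hmN)
  have hN : (0 : ℝ) < N := by exact_mod_cast hm.trans_le hmN
  calc Real.exp ((Real.log m - Real.log n) * δ) ≤ Real.exp (Real.log N * 2) := by
        apply Real.exp_le_exp.2
        nlinarith [Real.log_natCast_nonneg n, Real.log_natCast_nonneg N]
    _ = (N : ℝ) ^ 2 := by rw [← Real.rpow_def_of_pos hN, Real.rpow_two]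

lemma norm_gaussTerm_le_of_ne {L : ℝ} (hL : 0 < L) (τ : ℝ) {δ : ℝ} (hδ0 : 0 ≤ δ) (hδ : δ ≤ 2)
    {m n N k : ℕ} (hm : 0 < m) (hn : 0 < n) (hmN : m ≤ N)
    (hLN : 32 * (N : ℝ) ≤ L ^ 2) (hne : k * n ≠ m) :
    ‖gaussTerm L τ δ (Real.log m - Real.log n) k‖ ≤
      ((k : ℝ) ^ 2)⁻¹ * ((N : ℝ) ^ 2 * (L * √Real.pi) * (32 * N ^ 2 / L ^ 2)) := by
  rcases Nat.eq_zero_or_pos k with rfl | hk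
  · simp [gaussTerm_zero]
  have hN : (0 : ℝ) < N := by exact_mod_cast hm.trans_le hmN
  have := logZetaCoeff_nonneg k
  rw [norm_gaussTerm hL _ _ _ hk]
  calc _ ≤ 1 * ((k : ℝ) ^ 2)⁻¹ * (N : ℝ) ^ 2 * (L * √Real.pi) * (32 * N ^ 2 / L ^ 2) := by
        gcongr
        · exact logZetaCoeff_le_one k
        · exact exp_log_sub_log_mul_le hm hmN hδ0 hδ
        · exact exp_neg_sq_sub_mul_le hN (inv_le_abs_log_div_sub_log hm hn hk hmN hne)
            hLN hδ0 hδ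
    _ = _ := by ring

/-- The coefficient of `(m / n) ^ (-s)` in the Dirichlet series of `log ζ`, taken with its size
`(m / n) ^ (-σ)`: the only term of the series that resonates with the frequency `log m - log n`. -/
noncomputable def diagTerm (σ : ℝ) (m n : ℕ) : ℝ :=
  if n ∣ m then logZetaCoeff (m / n) * ((m / n : ℕ) : ℝ) ^ (-σ) else 0

/-- The implied constant in the error term of the twisted Gaussian averages of `log ζ`. -/
noncomputable def twistConst : ℝ := 32 * √Real.pi * (∑' k : ℕ, ((k : ℝ) ^ 2)⁻¹) + 24 * Real.exp 4

lemma tsum_inv_sq_nonneg : 0 ≤ ∑' k : ℕ, ((k : ℝ) ^ 2)⁻¹ := tsum_nonneg fun k ↦ by positivity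

lemma twistConst_nonneg : 0 ≤ twistConst := by
  have := tsum_inv_sq_nonneg
  unfold twistConst; positivity

lemma hasSum_gaussTerm {L : ℝ} (hL : 0 < L) (τ δ μ : ℝ) :
    HasSum (gaussTerm L τ δ μ) (∫ t : ℝ, logZetaSeries (2 + Complex.I * t) *
      twistKernel L τ μ (t - Complex.I * δ)) := by
  have hK := integrable_twistKernel_line hL τ μ δ
  have hterm (k : ℕ) (t : ℝ) : ‖(logZetaCoeff k : ℂ) * (k : ℂ) ^ (-(2 + Complex.I * t)) *
      twistKernel L τ μ (t - Complex.I * δ)‖ ≤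
        ((k : ℝ) ^ 2)⁻¹ * ‖twistKernel L τ μ (t - Complex.I * δ)‖ := by
    rw [norm_mul]
    exact mul_le_mul_of_nonneg_right (norm_logZetaTerm_le (by simp) k) (norm_nonneg _)
  have hint (k : ℕ) : Integrable fun t : ℝ ↦ (logZetaCoeff k : ℂ) *
      (k : ℂ) ^ (-(2 + Complex.I * t)) * twistKernel L τ μ (t - Complex.I * δ) :=
    (hK.norm.const_mul _).mono' (((continuous_logZetaTerm k).comp (by fun_prop)).mul
      (continuous_twistKernel_line L τ μ δ)).aestronglyMeasurable (ae_of_all _ (hterm k))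
  have hsum := hasSum_integral_of_summable_integral_norm hint
    (Summable.of_nonneg_of_le (fun k ↦ integral_nonneg fun t ↦ norm_nonneg _) (fun k ↦ by
        rw [← integral_const_mul]
        exact integral_mono (hint k).norm (hK.norm.const_mul _) (hterm k))
      (summable_inv_sq.mul_right (∫ t : ℝ, ‖twistKernel L τ μ (t - Complex.I * δ)‖)))
  simp only [tsum_mul_right] at hsum
  exact hsum

lemma norm_logPoleFactor_le_div (t τ : ℝ) :
    ‖logPoleFactor (2 + Complex.I * t)‖ ≤ 4 / (1 + |τ|) * (1 + |t - τ|) := by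
  have hre := Complex.abs_re_le_norm (2 + Complex.I * t : ℂ)
  have him := Complex.abs_im_le_norm (2 + Complex.I * t : ℂ)
  simp only [Complex.add_re, Complex.re_ofNat, Complex.mul_re, Complex.I_re, Complex.ofReal_re,
    zero_mul, Complex.I_im, Complex.ofReal_im, mul_zero, sub_self, add_zero, Nat.abs_ofNat,
    Complex.add_im, Complex.im_ofNat, Complex.mul_im, one_mul, zero_add] at hre him
  have hpeetre : 1 + |τ| ≤ (1 + |t|) * (1 + |t - τ|) := by
    rw [abs_sub_comm]; exact one_add_abs_le τ t
  have := abs_nonneg t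
  have := abs_nonneg τ
  calc ‖logPoleFactor (2 + Complex.I * t)‖
      ≤ 2 * ‖(2 + Complex.I * t : ℂ)‖⁻¹ := by
        rw [← norm_inv]; exact norm_logPoleFactor_le (by simp)
    _ ≤ 2 * ((1 + |t|) / 2)⁻¹ := by gcongr; linarith
    _ = 4 / (1 + |t|) := by field_simp; norm_num
    _ ≤ 4 / (1 + |τ|) * (1 + |t - τ|) := by
        rw [div_mul_eq_mul_div, div_le_div_iff₀ (by positivity) (by positivity)]
        linarith

lemma norm_integral_logPoleFactor_mul_le {L : ℝ} (hL : 1 ≤ L) (τ : ℝ) {m n N : ℕ} (hm : 0 < m)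
    (hmN : m ≤ N) {δ : ℝ} (hδ0 : 0 ≤ δ) (hδ2 : δ ≤ 2) :
    ‖∫ t : ℝ, logPoleFactor (2 + Complex.I * t) *
      twistKernel L τ (Real.log m - Real.log n) (t - Complex.I * δ)‖ ≤
        24 * Real.exp 4 * (N : ℝ) ^ 2 * (L ^ 2 / (1 + |τ|)) := by
  have hL0 : 0 < L := by linarith
  have := abs_nonneg τ
  have hexpδ : Real.exp ((δ / L) ^ 2) ≤ Real.exp 4 := by
    apply Real.exp_le_exp.2
    have : δ / L ≤ 2 := (div_le_self hδ0 hL).trans hδ2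
    have : 0 ≤ δ / L := by positivity
    nlinarith
  have hpointwise (t : ℝ) : ‖logPoleFactor (2 + Complex.I * t) *
      twistKernel L τ (Real.log m - Real.log n) (t - Complex.I * δ)‖ ≤
        (4 / (1 + |τ|) * ((N : ℝ) ^ 2 * Real.exp 4)) * ((1 + |t - τ|) * gaussW L τ t) := by
    have := gaussW_pos L τ t
    rw [norm_mul, norm_twistKernel_line]
    calc _ ≤ (4 / (1 + |τ|) * (1 + |t - τ|)) * ((N : ℝ) ^ 2 * Real.exp 4 * gaussW L τ t) := by
          gcongr
          · exact norm_logPoleFactor_le_div t τ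
          · exact exp_log_sub_log_mul_le hm hmN hδ0 hδ2
      _ = _ := by ring
  refine (norm_integral_le_of_norm_le ((integrable_one_add_abs_sub_mul_gaussW hL0 τ).const_mul _)
    (ae_of_all _ hpointwise)).trans ?_
  rw [integral_const_mul, integral_one_add_abs_sub_mul_gaussW hL0]
  have hmass : L * √Real.pi + L ^ 2 ≤ 6 * L ^ 2 := by nlinarith [sqrt_pi_le_two]
  calc _ ≤ 4 / (1 + |τ|) * ((N : ℝ) ^ 2 * Real.exp 4) * (6 * L ^ 2) := by gcongr
    _ = _ := by ring

lemma hasSum_diagTerm {L : ℝ} (hL : 0 < L) (τ σ : ℝ) {m n : ℕ} (hm : 0 < m) (hn : 0 < n) :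
    HasSum (fun k : ℕ ↦
        if k * n = m then gaussTerm L τ (2 - σ) (Real.log m - Real.log n) k else 0)
      ((L * √Real.pi * diagTerm σ m n : ℝ) : ℂ) := by
  by_cases hnm : n ∣ m
  · obtain ⟨k, rfl⟩ := hnm
    have hk : 0 < k := Nat.pos_of_mul_pos_left hm
    have hfreq : Real.log (n * k : ℕ) - Real.log n = Real.log k := by
      rw [Nat.cast_mul, Real.log_mul (by exact_mod_cast hn.ne') (by exact_mod_cast hk.ne')]
      ring
    convert hasSum_single k fun j hj ↦ if_neg fun h ↦ hj ?_ using 1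
    · rw [if_pos (mul_comm _ _), hfreq, gaussTerm_log hL τ σ hk, diagTerm,
        if_pos (Dvd.intro k rfl), Nat.mul_div_cancel_left k hn]
    · rw [mul_comm] at h
      exact Nat.eq_of_mul_eq_mul_left hn h
  · have hzero : (fun k : ℕ ↦ if k * n = m then
        gaussTerm L τ (2 - σ) (Real.log m - Real.log n) k else 0) = fun _ ↦ 0 := by
      funext k
      exact if_neg fun h ↦ hnm ⟨k, by rw [← h, mul_comm]⟩
    rw [hzero, diagTerm, if_neg hnm, mul_zero, Complex.ofReal_zero]
    exact hasSum_zero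

lemma norm_integral_logZetaSeries_sub_diagTerm_le {σ : ℝ} (hσ0 : 0 ≤ σ) (hσ2 : σ ≤ 2) {L : ℝ}
    (hL : 0 < L) (τ : ℝ) {m n N : ℕ} (hm : 0 < m) (hn : 0 < n) (hmN : m ≤ N)
    (hLN : 32 * (N : ℝ) ≤ L ^ 2) :
    ‖(∫ t : ℝ, logZetaSeries (2 + Complex.I * t) *
        twistKernel L τ (Real.log m - Real.log n) (t - Complex.I * (2 - σ : ℝ))) -
      (L * √Real.pi * diagTerm σ m n : ℝ)‖ ≤
        32 * √Real.pi * (∑' k : ℕ, ((k : ℝ) ^ 2)⁻¹) * (N : ℝ) ^ 2 * ((N : ℝ) ^ 2 / L) := by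
  have hoff := (hasSum_gaussTerm hL τ (2 - σ) (Real.log m - Real.log n)).sub
    (hasSum_diagTerm hL τ σ hm hn)
  rw [← hoff.tsum_eq]
  refine (tsum_of_norm_bounded (summable_inv_sq.hasSum.mul_right
    ((N : ℝ) ^ 2 * (L * √Real.pi) * (32 * N ^ 2 / L ^ 2))) fun k ↦ ?_).trans (le_of_eq ?_)
  · by_cases hkm : k * n = m
    · rw [if_pos hkm, sub_self, norm_zero]
      positivity
    · rw [if_neg hkm, sub_zero]
      exact norm_gaussTerm_le_of_ne hL τ (by linarith) (by linarith) hm hn hmN hLN hkm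
  · field_simp

lemma IsLogZetaQuot.integral_line_two_mul_twistKernel {l : ℂ → ℂ} (hl : IsLogZetaQuot l) {L : ℝ}
    (hL : 0 < L) (τ μ δ : ℝ) :
    ∫ t : ℝ, l (2 + Complex.I * t) * twistKernel L τ μ (t - Complex.I * δ) =
      (∫ t : ℝ, logZetaSeries (2 + Complex.I * t) * twistKernel L τ μ (t - Complex.I * δ)) +
        ∫ t : ℝ, logPoleFactor (2 + Complex.I * t) * twistKernel L τ μ (t - Complex.I * δ) := by
  have hline (t : ℝ) : 2 ≤ (2 + Complex.I * t).re := by simp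
  have hK := integrable_twistKernel_line hL τ μ δ
  have hseries : Integrable fun t : ℝ ↦ logZetaSeries (2 + Complex.I * t) *
      twistKernel L τ μ (t - Complex.I * δ) :=
    hK.bdd_mul (continuousOn_logZetaSeries.comp_continuous (by fun_prop)
      hline).aestronglyMeasurable (ae_of_all _ fun t ↦ norm_logZetaSeries_le (hline t))
  have hpole : Integrable fun t : ℝ ↦ logPoleFactor (2 + Complex.I * t) *
      twistKernel L τ μ (t - Complex.I * δ) :=
    hK.bdd_mul (c := 1) (continuousOn_logPoleFactor.comp_continuous (by fun_prop)
      hline).aestronglyMeasurable (ae_of_all _ fun t ↦ by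
        linarith [norm_logPoleFactor_le (hline t), norm_inv_le_half (hline t)])
  rw [← integral_add hseries hpole]
  congr 1; ext t
  rw [hl.eq_logZetaSeries_add _ (hline t), add_mul]

lemma IsLogZetaQuot.norm_integral_sub_diagTerm_le {l : ℂ → ℂ} (hl : IsLogZetaQuot l) {σ : ℝ}
    (hσ : 1 / 2 < σ) (hσ2 : σ ≤ 2) {L : ℝ} (hL : 1 ≤ L) (τ : ℝ)
    {m n N : ℕ} (hm : 0 < m) (hn : 0 < n) (hmN : m ≤ N)
    (hLN : 32 * (N : ℝ) ≤ L ^ 2) :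
    ‖(∫ t : ℝ, l (σ + Complex.I * t) * twistKernel L τ (Real.log m - Real.log n) t) -
      (L * √Real.pi * diagTerm σ m n : ℝ)‖ ≤
      twistConst * (N : ℝ) ^ 2 * ((N : ℝ) ^ 2 / L + L ^ 2 / (1 + |τ|)) := by
  have hL0 : 0 < L := by linarith
  rw [hl.integral_shift hσ hσ2 hL0, hl.integral_line_two_mul_twistKernel hL0, add_sub_right_comm]
  refine (norm_add_le _ _).trans ((add_le_add
    (norm_integral_logZetaSeries_sub_diagTerm_le (by linarith) hσ2 hL0 τ hm hn hmN hLN)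
    (norm_integral_logPoleFactor_mul_le hL τ hm hmN (by linarith) (by linarith))).trans ?_)
  have hseries : 0 ≤ (N : ℝ) ^ 2 * ((N : ℝ) ^ 2 / L) := by positivity
  have hpole : 0 ≤ (N : ℝ) ^ 2 * (L ^ 2 / (1 + |τ|)) := by positivity
  have hc : 0 ≤ 32 * √Real.pi * ∑' k : ℕ, ((k : ℝ) ^ 2)⁻¹ :=
    mul_nonneg (by positivity) tsum_inv_sq_nonneg
  rw [twistConst]
  nlinarith [mul_nonneg (by positivity : 0 ≤ 24 * Real.exp 4) hseries, mul_nonneg hc hpole]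

/-- `log |(s - 1) ζ(s) / s|` at `s = σ + iu`. Its restriction to the critical line is
`log |ζ(1/2 + iu)|`, without the singularity that the pole of `ζ` causes for `σ` near `1`. -/
noncomputable def logNormQuot (σ u : ℝ) : ℝ := Real.log ‖zetaQuot (σ + Complex.I * u)‖

lemma logNormQuot_half (u : ℝ) :
    logNormQuot (1 / 2) u = Real.log ‖riemannZeta (1 / 2 + Complex.I * u)‖ := by
  rw [logNormQuot, ← norm_zetaQuot_half]
  norm_num

lemma ofReal_add_I_mul_ne_zero {σ : ℝ} (hσ : σ ≠ 0) (u : ℝ) : (σ + Complex.I * u : ℂ) ≠ 0 :=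
  fun h ↦ hσ (by simpa using congrArg Complex.re h)

lemma continuous_zetaQuot_line {σ : ℝ} (hσ : σ ≠ 0) :
    Continuous fun u : ℝ ↦ zetaQuot (σ + Complex.I * u) :=
  differentiableOn_zetaQuot.continuousOn.comp_continuous (by fun_prop)
    (ofReal_add_I_mul_ne_zero hσ)

lemma measurable_logNormQuot {σ : ℝ} (hσ : σ ≠ 0) : Measurable (logNormQuot σ) :=
  Real.measurable_log.comp (continuous_zetaQuot_line hσ).norm.measurable

lemma logNormQuot_le {σ : ℝ} (hσ : 1 / 2 ≤ σ) (hσ2 : σ ≤ 2) (u : ℝ) :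
    logNormQuot σ u ≤ 7 * (1 + |u|) := by
  have hnorm : ‖(σ + Complex.I * u : ℂ)‖ ≤ 2 + |u| := by
    refine (norm_add_le _ _).trans ?_
    simp only [Complex.norm_real, norm_mul, Complex.norm_I, one_mul, Real.norm_eq_abs]
    rw [abs_of_nonneg (by linarith)]
    linarith
  calc logNormQuot σ u ≤ ‖zetaQuot (σ + Complex.I * u)‖ := Real.log_le_self (norm_nonneg _)
    _ ≤ 3 + 2 * ‖(σ + Complex.I * u : ℂ)‖ := norm_zetaQuot_le_of_half_le (by simpa using hσ)
    _ ≤ 7 * (1 + |u|) := by linarith [abs_nonneg u]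

lemma twistKernel_zero_ofReal (L τ u : ℝ) : twistKernel L τ 0 u = (gaussW L τ u : ℂ) := by
  simp [twistKernel, gaussC_ofReal]

lemma abs_gaussW (L τ u : ℝ) : |gaussW L τ u| = gaussW L τ u := abs_of_pos (gaussW_pos L τ u)

/-- The constant in the bound for the Gaussian-weighted `L¹` norm of `logNormQuot`. -/
noncomputable def logL1Const : ℝ := 42 + 2 * twistConst

lemma logL1Const_nonneg : 0 ≤ logL1Const := by
  linarith [twistConst_nonneg, show logL1Const = 42 + 2 * twistConst from rfl]

namespace IsLogZetaQuot

variable {l : ℂ → ℂ}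

lemma re_line (hl : IsLogZetaQuot l) {σ : ℝ} (hσ : 1 / 2 < σ) (u : ℝ) :
    (l (σ + Complex.I * u)).re = logNormQuot σ u :=
  hl.re_eq (by simpa using hσ)

lemma integrable_mul (hl : IsLogZetaQuot l) {σ : ℝ} (hσ : 1 / 2 < σ)
    (hσ2 : σ ≤ 2) {L : ℝ} (hL : 0 < L) (τ : ℝ) {G : ℝ → ℂ} (hG : Continuous G) {K : ℝ}
    (hK : ∀ u, ‖G u‖ ≤ K * gaussW L τ u) :
    Integrable fun u : ℝ ↦ l (σ + Complex.I * u) * G u := by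
  obtain ⟨C, hC0, hC⟩ := hl.exists_norm_le hσ
  refine ((integrable_one_add_abs_mul_gaussW hL τ).const_mul (C * K)).mono'
    ((hl.continuous_line hσ).mul hG).aestronglyMeasurable (ae_of_all _ fun u ↦ ?_)
  rw [norm_mul]
  calc _ ≤ (C * (1 + |u|)) * (K * gaussW L τ u) :=
        mul_le_mul (hC σ ⟨le_rfl, hσ2⟩ u) (hK u) (norm_nonneg _) (by positivity)
    _ = _ := by ring

lemma integrable_logNormQuot_mul (hl : IsLogZetaQuot l) {σ : ℝ}
    (hσ : 1 / 2 < σ) (hσ2 : σ ≤ 2) {L : ℝ} (hL : 0 < L) (τ : ℝ) {G : ℝ → ℝ} (hG : Continuous G)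
    {K : ℝ} (hK : ∀ u, |G u| ≤ K * gaussW L τ u) :
    Integrable fun u : ℝ ↦ logNormQuot σ u * G u := by
  refine (hl.integrable_mul hσ hσ2 hL τ (G := fun u ↦ (G u : ℂ)) (by fun_prop)
    (by simpa using hK)).re.congr (ae_of_all _ fun u ↦ ?_)
  simp [hl.re_line hσ]

lemma integral_logNormQuot_mul_eq_re (hl : IsLogZetaQuot l) {σ : ℝ} (hσ : 1 / 2 < σ)
    (hσ2 : σ ≤ 2) {L : ℝ} (hL : 0 < L) (τ : ℝ) {G : ℝ → ℝ} (hG : Continuous G) {K : ℝ}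
    (hK : ∀ u, |G u| ≤ K * gaussW L τ u) :
    ∫ u, logNormQuot σ u * G u = (∫ u : ℝ, l (σ + Complex.I * u) * (G u : ℂ)).re := by
  rw [← RCLike.re_to_complex, ← integral_re (hl.integrable_mul hσ hσ2 hL τ
    (G := fun u ↦ (G u : ℂ)) (by fun_prop) (by simpa using hK))]
  simp [hl.re_line hσ]

lemma integrable_logNormQuot_mul_gaussW (hl : IsLogZetaQuot l) {σ : ℝ} (hσ : 1 / 2 < σ)
    (hσ2 : σ ≤ 2) {L : ℝ} (hL : 0 < L) (τ : ℝ) :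
    Integrable fun u : ℝ ↦ logNormQuot σ u * gaussW L τ u :=
  hl.integrable_logNormQuot_mul hσ hσ2 hL τ (continuous_gaussW L τ) (K := 1) fun u ↦ by
    rw [one_mul, abs_gaussW]

lemma integrable_abs_logNormQuot_mul_gaussW (hl : IsLogZetaQuot l) {σ : ℝ} (hσ : 1 / 2 < σ)
    (hσ2 : σ ≤ 2) {L : ℝ} (hL : 0 < L) (τ : ℝ) :
    Integrable fun u : ℝ ↦ |logNormQuot σ u| * gaussW L τ u :=
  (hl.integrable_logNormQuot_mul_gaussW hσ hσ2 hL τ).norm.congr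
    (ae_of_all _ fun u ↦ by simp [abs_gaussW])

lemma abs_integral_logNormQuot_mul_gaussW_le (hl : IsLogZetaQuot l) {σ : ℝ} (hσ : 1 / 2 < σ)
    (hσ2 : σ ≤ 2) {L : ℝ} (hL : 6 ≤ L) (τ : ℝ) :
    |∫ u, logNormQuot σ u * gaussW L τ u| ≤ 2 * twistConst * L ^ 2 := by
  have hL0 : 0 < L := by linarith
  have htwist : ‖∫ u : ℝ, l (σ + Complex.I * u) * (gaussW L τ u : ℂ)‖ ≤
      twistConst * (1 / L + L ^ 2 / (1 + |τ|)) := by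
    simpa [diagTerm, logZetaCoeff, twistKernel_zero_ofReal] using
      hl.norm_integral_sub_diagTerm_le hσ hσ2 (by linarith : 1 ≤ L) τ (m := 1) (n := 1) (N := 1)
        one_pos one_pos le_rfl (by norm_num; nlinarith)
  have hinv : 1 / L ≤ L ^ 2 := by
    rw [div_le_iff₀ hL0]; nlinarith [sq_nonneg L]
  have hdiv : L ^ 2 / (1 + |τ|) ≤ L ^ 2 := div_le_self (by positivity) (by linarith [abs_nonneg τ])
  rw [hl.integral_logNormQuot_mul_eq_re hσ hσ2 hL0 τ (continuous_gaussW L τ) (K := 1)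
    fun u ↦ by rw [one_mul, abs_gaussW]]
  refine (Complex.abs_re_le_norm _).trans (htwist.trans ?_)
  nlinarith [mul_le_mul_of_nonneg_left (add_le_add hinv hdiv) twistConst_nonneg]

-- Since `logNormQuot σ u ≤ 7 (1 + |u|)`, its absolute value is at most `14 (1 + |u|)` minus itself.
lemma integral_abs_logNormQuot_mul_gaussW_le (hl : IsLogZetaQuot l) {σ : ℝ}
    (hσ : 1 / 2 < σ) (hσ2 : σ ≤ 2) {L : ℝ} (hL : 6 ≤ L) (τ : ℝ) :
    ∫ u, |logNormQuot σ u| * gaussW L τ u ≤ logL1Const * (1 + |τ|) * L ^ 2 := by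
  have hL0 : 0 < L := by linarith
  have hi := hl.integrable_logNormQuot_mul_gaussW hσ hσ2 hL0 τ
  have hlin := (integrable_one_add_abs_mul_gaussW hL0 τ).const_mul 14
  have hpointwise (u : ℝ) : |logNormQuot σ u| * gaussW L τ u ≤
      14 * ((1 + |u|) * gaussW L τ u) - logNormQuot σ u * gaussW L τ u := by
    have hle := logNormQuot_le hσ.le hσ2 u
    have habs : |logNormQuot σ u| ≤ 14 * (1 + |u|) - logNormQuot σ u := by
      rw [abs_le]; constructor <;> linarith [abs_nonneg u]
    calc _ ≤ (14 * (1 + |u|) - logNormQuot σ u) * gaussW L τ u := by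
          gcongr; exact (gaussW_pos L τ u).le
      _ = _ := by ring
  have hmono := integral_mono (hl.integrable_abs_logNormQuot_mul_gaussW hσ hσ2 hL0 τ)
    (hlin.sub hi) hpointwise
  rw [integral_sub' hlin hi, integral_const_mul] at hmono
  have hmoment : ∫ u, (1 + |u|) * gaussW L τ u ≤ 3 * ((1 + |τ|) * L ^ 2) :=
    calc _ ≤ (1 + |τ|) * (L * √Real.pi + L ^ 2) := integral_one_add_abs_mul_gaussW_le hL0 τ
      _ ≤ (1 + |τ|) * (3 * L ^ 2) := by gcongr; nlinarith [sqrt_pi_le_two]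
      _ = _ := by ring
  have hmain := (abs_le.1 (hl.abs_integral_logNormQuot_mul_gaussW_le hσ hσ2 hL τ)).1
  have hτ : 0 ≤ 2 * twistConst * L ^ 2 * |τ| := by
    have := twistConst_nonneg
    positivity
  rw [logL1Const]
  linarith

end IsLogZetaQuot

lemma countable_setOf_zetaQuot_half_eq_zero :
    {u : ℝ | zetaQuot ((1 / 2 : ℝ) + Complex.I * u) = 0}.Countable := by
  have hinj : Function.Injective fun u : ℝ ↦ (1 / 2 + Complex.I * u : ℂ) := fun a b h ↦ by
    simpa using h
  have hsub : {u : ℝ | zetaQuot ((1 / 2 : ℝ) + Complex.I * u) = 0} ⊆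
      ⋃ k : ℕ, (fun u : ℝ ↦ (1 / 2 + Complex.I * u : ℂ)) ⁻¹'
        (Metric.closedBall 0 k ∩ riemannZetaZeros) := by
    intro u hu
    obtain ⟨k, hk⟩ := exists_nat_ge ‖(1 / 2 + Complex.I * u : ℂ)‖
    refine mem_iUnion.2 ⟨k, by simpa using hk, ?_⟩
    rw [mem_riemannZetaZeros, ← norm_eq_zero, ← norm_zetaQuot_half, norm_eq_zero]
    simpa using hu
  have hfinite (k : ℕ) := (isCompact_closedBall (0 : ℂ) (k : ℝ)).inter_riemannZetaZeros_finite
  exact (countable_iUnion fun k ↦ ((hfinite k).preimage hinj.injOn).countable).mono hsub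

lemma ae_tendsto_logNormQuot :
    ∀ᵐ u : ℝ, Tendsto (fun σ ↦ logNormQuot σ u) (𝓝[>] (1 / 2)) (𝓝 (logNormQuot (1 / 2) u)) := by
  filter_upwards [countable_setOf_zetaQuot_half_eq_zero.ae_notMem volume] with u hu
  have hcont : ContinuousAt (fun σ : ℝ ↦ zetaQuot (σ + Complex.I * u)) (1 / 2) :=
    ContinuousAt.comp (f := fun σ : ℝ ↦ (σ + Complex.I * u : ℂ))
      (differentiableOn_zetaQuot.differentiableAt (isOpen_compl_singleton.mem_nhds
        (ofReal_add_I_mul_ne_zero (by norm_num) u))).continuousAt (by fun_prop)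
  exact (hcont.norm.log (norm_ne_zero_iff.2 hu)).tendsto.mono_left nhdsWithin_le_nhds

lemma exists_eventually_abs_log_norm_le {𝕜 E : Type*} [NontriviallyNormedField 𝕜]
    [NormedAddCommGroup E] [NormedSpace 𝕜 E] {f : 𝕜 → E} {z₀ : 𝕜} (hf : AnalyticAt 𝕜 f z₀)
    (hne : ¬ ∀ᶠ z in 𝓝 z₀, f z = 0) :
    ∃ (n : ℕ) (K : ℝ), ∀ᶠ z in 𝓝[≠] z₀,
      |Real.log ‖f z‖| ≤ n * |Real.log ‖z - z₀‖| + K := by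
  obtain ⟨n, g, hg, hg0, hfg⟩ := (hf.exists_eventuallyEq_pow_smul_nonzero_iff).2 hne
  have hbound : ∀ᶠ z in 𝓝 z₀, |Real.log ‖g z‖| < |Real.log ‖g z₀‖| + 1 :=
    (hg.continuousAt.norm.log (norm_ne_zero_iff.2 hg0)).abs.eventually
      (gt_mem_nhds (lt_add_one _))
  refine ⟨n, |Real.log ‖g z₀‖| + 1, ?_⟩
  filter_upwards [nhdsWithin_le_nhds hfg, nhdsWithin_le_nhds hbound,
    nhdsWithin_le_nhds (hg.continuousAt.eventually_ne hg0), self_mem_nhdsWithin]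
    with z hfz hgz hgz0 hz
  have hz0 : ‖z - z₀‖ ≠ 0 := norm_ne_zero_iff.2 (sub_ne_zero.2 hz)
  rw [hfz, norm_smul, norm_pow, Real.log_mul (pow_ne_zero _ hz0) (norm_ne_zero_iff.2 hgz0),
    Real.log_pow]
  refine (abs_add_le _ _).trans (add_le_add ?_ hgz.le)
  rw [abs_mul, Nat.abs_cast]

lemma abs_log_norm_le_abs_log_im {z : ℂ} (hz : ‖z‖ ≤ 1) (him : z.im ≠ 0) :
    |Real.log ‖z‖| ≤ |Real.log z.im| := by
  rw [abs_of_nonpos (Real.log_nonpos (norm_nonneg z) hz), ← Real.log_abs z.im]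
  exact (neg_le_neg (Real.log_le_log (abs_pos.2 him) (Complex.abs_im_le_norm z))).trans
    (neg_le_abs _)

/-- The functions `logNormQuot σ`, for `σ` slightly larger than `1 / 2`, are dominated on `S` by
one locally integrable function; this is what dominated convergence as `σ → 1 / 2` requires. -/
def DominatedNearHalf (S : Set ℝ) : Prop :=
  ∃ b : ℝ → ℝ, (∀ x y, IntervalIntegrable b volume x y) ∧
    ∀ᶠ σ in 𝓝[>] (1 / 2 : ℝ), ∀ᵐ u : ℝ, u ∈ S → |logNormQuot σ u| ≤ b u

lemma DominatedNearHalf.union {S T : Set ℝ} (hS : DominatedNearHalf S)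
    (hT : DominatedNearHalf T) : DominatedNearHalf (S ∪ T) := by
  obtain ⟨b, hb, hbS⟩ := hS
  obtain ⟨c, hc, hcT⟩ := hT
  refine ⟨fun u ↦ |b u| + |c u|, fun x y ↦ (hb x y).abs.add (hc x y).abs, ?_⟩
  filter_upwards [hbS, hcT] with σ hσS hσT
  filter_upwards [hσS, hσT] with u huS huT hu
  rcases hu with hu | hu
  · linarith [huS hu, le_abs_self (b u), abs_nonneg (c u)]
  · linarith [huT hu, le_abs_self (c u), abs_nonneg (b u)]

lemma not_eventually_zetaQuot_eq_zero (hRH : RiemannHypothesis) (u : ℝ) :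
    ¬ ∀ᶠ s in 𝓝 ((1 / 2 : ℝ) + Complex.I * u : ℂ), zetaQuot s = 0 := by
  intro hzero
  have hcont : Continuous fun σ : ℝ ↦ (σ + Complex.I * u : ℂ) := by fun_prop
  have hlim : Tendsto (fun σ : ℝ ↦ (σ + Complex.I * u : ℂ)) (𝓝[>] (1 / 2))
      (𝓝 ((1 / 2 : ℝ) + Complex.I * u)) := (hcont.tendsto _).mono_left nhdsWithin_le_nhds
  obtain ⟨σ, hσ0, hσ⟩ := ((hlim.eventually hzero).and self_mem_nhdsWithin).exists
  exact zetaQuot_ne_zero hRH (by simpa using hσ) hσ0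

lemma exists_mem_nhds_dominatedNearHalf (hRH : RiemannHypothesis) (u₀ : ℝ) :
    ∃ S ∈ 𝓝 u₀, DominatedNearHalf S := by
  set s₀ : ℂ := (1 / 2 : ℝ) + Complex.I * u₀ with hs₀
  have han : AnalyticAt ℂ zetaQuot s₀ := differentiableOn_zetaQuot.analyticAt
    (isOpen_compl_singleton.mem_nhds (ofReal_add_I_mul_ne_zero (by norm_num) u₀))
  obtain ⟨n, K, hlog⟩ :=
    exists_eventually_abs_log_norm_le han (not_eventually_zetaQuot_eq_zero hRH u₀)
  have hnear := (eventually_nhdsWithin_iff.1 hlog).and (Metric.closedBall_mem_nhds s₀ one_pos)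
  have hcont : Continuous fun p : ℝ × ℝ ↦ (p.1 + Complex.I * p.2 : ℂ) := by fun_prop
  have hprod := (hcont.tendsto (1 / 2, u₀)).eventually hnear
  rw [nhds_prod_eq, eventually_prod_iff] at hprod
  obtain ⟨P, hP, Q, hQ, hPQ⟩ := hprod
  refine ⟨{u | Q u}, hQ, fun u ↦ n * |Real.log (u - u₀)| + K, fun x y ↦ ?_, ?_⟩
  · have hshift : IntervalIntegrable (fun u ↦ Real.log (u - u₀)) volume x y := by
      simpa using
        (intervalIntegral.intervalIntegrable_log' (a := x - u₀) (b := y - u₀)).comp_sub_right u₀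
    exact (hshift.abs.const_mul n).add intervalIntegrable_const
  filter_upwards [nhdsWithin_le_nhds hP] with σ hσ
  filter_upwards [(countable_singleton u₀).ae_notMem volume] with u hu hQu
  obtain ⟨hbound, hball⟩ := hPQ hσ hQu
  have him : (σ + Complex.I * u - s₀ : ℂ).im = u - u₀ := by simp [hs₀]
  have hu0 : u - u₀ ≠ 0 := sub_ne_zero.2 hu
  have hne : (σ + Complex.I * u : ℂ) ≠ s₀ := fun h ↦ hu0 (by rw [← him, h, sub_self]; rfl)
  have hcomp := abs_log_norm_le_abs_log_im (mem_closedBall_iff_norm.1 hball) (by rwa [him])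
  rw [him] at hcomp
  exact (hbound hne).trans (by gcongr)

lemma dominatedNearHalf_Icc (hRH : RiemannHypothesis) (A B : ℝ) :
    DominatedNearHalf (Icc A B) := by
  refine isCompact_Icc.induction_on ⟨0, fun _ _ ↦ IntervalIntegrable.zero, by simp⟩ ?_
    (fun _ _ ↦ DominatedNearHalf.union) fun u _ ↦ ?_
  · rintro S T hST ⟨b, hb, hbT⟩
    exact ⟨b, hb, hbT.mono fun σ hσ ↦ hσ.mono fun u hu hS ↦ hu (hST hS)⟩
  · obtain ⟨S, hS, hdom⟩ := exists_mem_nhds_dominatedNearHalf hRH u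
    exact ⟨S, mem_nhdsWithin_of_mem_nhds hS, hdom⟩

lemma integrable_and_integral_le_of_tendsto {α : Type*} [MeasurableSpace α] {μ : Measure α}
    {F : ℕ → α → ℝ} {f : α → ℝ} {M : ℝ} (hF : ∀ n, Integrable (F n) μ) (hF0 : ∀ n x, 0 ≤ F n x)
    (hlim : ∀ᵐ x ∂μ, Tendsto (fun n ↦ F n x) atTop (𝓝 (f x))) (hM : ∀ n, ∫ x, F n x ∂μ ≤ M) :
    Integrable f μ ∧ ∫ x, f x ∂μ ≤ M := by
  have hM0 : 0 ≤ M := (integral_nonneg (hF0 0)).trans (hM 0)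
  have hmeas := aestronglyMeasurable_of_tendsto_ae _ (fun n ↦ (hF n).aestronglyMeasurable) hlim
  have hbound (n : ℕ) : eLpNorm (F n) 1 μ ≤ ENNReal.ofReal M := by
    rw [eLpNorm_one_eq_lintegral_enorm, ← ofReal_integral_norm_eq_lintegral_enorm (hF n)]
    simp_rw [Real.norm_of_nonneg (hF0 n _)]
    exact ENNReal.ofReal_le_ofReal (hM n)
  have hle : eLpNorm f 1 μ ≤ ENNReal.ofReal M :=
    (Lp.eLpNorm_lim_le_liminf_eLpNorm (fun n ↦ (hF n).aestronglyMeasurable) f hlim).trans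
      ((liminf_le_liminf (Eventually.of_forall hbound)).trans_eq (liminf_const _))
  have hint : Integrable f μ :=
    memLp_one_iff_integrable.1 ⟨hmeas, hle.trans_lt ENNReal.ofReal_lt_top⟩
  refine ⟨hint, ?_⟩
  rw [eLpNorm_one_eq_lintegral_enorm, ← ofReal_integral_norm_eq_lintegral_enorm hint,
    ENNReal.ofReal_le_ofReal_iff hM0] at hle
  exact (integral_mono hint hint.norm fun x ↦ Real.le_norm_self (f x)).trans hle

lemma IsLogZetaQuot.integrable_half_and_integral_le {l : ℂ → ℂ} (hl : IsLogZetaQuot l) {L : ℝ}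
    (hL : 6 ≤ L) (τ : ℝ) :
    Integrable (fun u ↦ |logNormQuot (1 / 2) u| * gaussW L τ u) ∧
      ∫ u, |logNormQuot (1 / 2) u| * gaussW L τ u ≤ logL1Const * (1 + |τ|) * L ^ 2 := by
  obtain ⟨σ, -, hσ, hσlim⟩ := exists_seq_strictAnti_tendsto' (show (1 / 2 : ℝ) < 2 by norm_num)
  have hlim : Tendsto σ atTop (𝓝[>] (1 / 2)) :=
    tendsto_nhdsWithin_iff.2 ⟨hσlim, Eventually.of_forall fun n ↦ (hσ n).1⟩
  refine integrable_and_integral_le_of_tendsto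
    (F := fun n u ↦ |logNormQuot (σ n) u| * gaussW L τ u)
    (fun n ↦ hl.integrable_abs_logNormQuot_mul_gaussW (hσ n).1 (hσ n).2.le (by linarith) τ)
    (fun n u ↦ mul_nonneg (abs_nonneg _) (gaussW_pos L τ u).le) ?_
    fun n ↦ hl.integral_abs_logNormQuot_mul_gaussW_le (hσ n).1 (hσ n).2.le hL τ
  filter_upwards [ae_tendsto_logNormQuot] with u hu
  exact (hu.comp hlim).abs.mul_const _

lemma gaussW_le_exp_mul_gaussW_two_mul {L : ℝ} (hL : 0 < L) {τ u d : ℝ} (hd : 0 ≤ d)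
    (hdu : d ≤ |u - τ|) :
    gaussW L τ u ≤ Real.exp (-(3 / 4 * (d / L) ^ 2)) * gaussW (2 * L) τ u := by
  have hsq : (d / L) ^ 2 ≤ ((u - τ) / L) ^ 2 := by
    rw [div_pow, div_pow, ← sq_abs (u - τ)]
    gcongr
  have hwide : ((u - τ) / (2 * L)) ^ 2 = ((u - τ) / L) ^ 2 / 4 := by
    field_simp
    norm_num
  rw [gaussW, gaussW, ← Real.exp_add, Real.exp_le_exp, hwide]
  linarith

lemma exists_gaussW_le_mul_gaussW_two_mul {L : ℝ} (hL : 0 < L) (τ : ℝ) {ε : ℝ} (hε : 0 < ε) :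
    ∃ A : ℝ, 0 < A ∧ ∀ u, u ∉ Icc (-A) A → gaussW L τ u ≤ ε * gaussW (2 * L) τ u := by
  refine ⟨|τ| + 2 * L * (1 + ε⁻¹), by positivity, fun u hu ↦ ?_⟩
  have hεi : 0 < ε⁻¹ := by positivity
  have hfar : 2 * L * (1 + ε⁻¹) ≤ |u - τ| := by
    have hu' : |τ| + 2 * L * (1 + ε⁻¹) < |u| := by
      by_contra! h
      exact hu (abs_le.1 h)
    linarith [abs_sub_abs_le_abs_sub u τ]
  have hexponent : ε⁻¹ ≤ 3 / 4 * (2 * L * (1 + ε⁻¹) / L) ^ 2 := by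
    field_simp
    nlinarith
  refine (gaussW_le_exp_mul_gaussW_two_mul hL (by positivity) hfar).trans ?_
  refine mul_le_mul_of_nonneg_right ?_ (gaussW_pos _ _ _).le
  calc _ ≤ (3 / 4 * (2 * L * (1 + ε⁻¹) / L) ^ 2)⁻¹ := exp_neg_le_inv (hεi.trans_le hexponent)
    _ ≤ (ε⁻¹)⁻¹ := inv_anti₀ hεi hexponent
    _ = ε := inv_inv ε

lemma intervalIntegrable_logNormQuot_half (x y : ℝ) :
    IntervalIntegrable (logNormQuot (1 / 2)) volume x y := by
  have hmero : MeromorphicOn (fun u : ℝ ↦ zetaQuot ((1 / 2 : ℝ) + Complex.I * u)) (uIcc x y) := by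
    intro u _
    have han : AnalyticAt ℝ zetaQuot ((1 / 2 : ℝ) + Complex.I * u) :=
      (differentiableOn_zetaQuot.analyticAt (isOpen_compl_singleton.mem_nhds
        (ofReal_add_I_mul_ne_zero (by norm_num) u))).restrictScalars
    have hline : AnalyticAt ℝ (fun u : ℝ ↦ ((1 / 2 : ℝ) + Complex.I * u : ℂ)) u :=
      analyticAt_const.add (analyticAt_const.mul (Complex.ofRealCLM.analyticAt u))
    exact (AnalyticAt.comp (g := zetaQuot) (f := fun u : ℝ ↦ ((1 / 2 : ℝ) + Complex.I * u : ℂ))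
      han hline).meromorphicAt
  exact hmero.intervalIntegrable_log_norm

lemma IsLogZetaQuot.integrable_half_mul {l : ℂ → ℂ} (hl : IsLogZetaQuot l) {L : ℝ} (hL : 6 ≤ L)
    (τ : ℝ) {G : ℝ → ℝ} (hG : Continuous G) {K : ℝ} (hK : ∀ u, |G u| ≤ K * gaussW L τ u) :
    Integrable fun u ↦ logNormQuot (1 / 2) u * G u := by
  refine ((hl.integrable_half_and_integral_le hL τ).1.const_mul K).mono'
    ((measurable_logNormQuot (by norm_num)).mul hG.measurable).aestronglyMeasurable
    (ae_of_all _ fun u ↦ ?_)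
  rw [norm_mul, Real.norm_eq_abs, Real.norm_eq_abs]
  calc _ ≤ |logNormQuot (1 / 2) u| * (K * gaussW L τ u) := by
        gcongr; exact hK u
    _ = _ := by ring

lemma tendsto_setIntegral_Icc_logNormQuot_mul (hRH : RiemannHypothesis) (A B : ℝ) {G : ℝ → ℝ}
    (hG : Continuous G) {K : ℝ} (hK : ∀ u, |G u| ≤ K) :
    Tendsto (fun σ ↦ ∫ u in Icc A B, logNormQuot σ u * G u) (𝓝[>] (1 / 2))
      (𝓝 (∫ u in Icc A B, logNormQuot (1 / 2) u * G u)) := by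
  obtain ⟨b, hb, hbound⟩ := dominatedNearHalf_Icc hRH A B
  refine tendsto_integral_filter_of_dominated_convergence (fun u ↦ b u * K) ?_ ?_ ?_ ?_
  · filter_upwards [self_mem_nhdsWithin] with σ (hσ : 1 / 2 < σ)
    exact ((measurable_logNormQuot (by linarith)).mul hG.measurable).aestronglyMeasurable
  · filter_upwards [hbound] with σ hσ
    rw [ae_restrict_iff' measurableSet_Icc]
    filter_upwards [hσ] with u hu hmem
    rw [norm_mul]
    exact mul_le_mul (hu hmem) (hK u) (abs_nonneg _) ((abs_nonneg _).trans (hu hmem))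
  · exact ((intervalIntegrable_iff' (by finiteness)).1 ((hb A B).mul_const K)).mono_set
      Icc_subset_uIcc
  · refine ae_restrict_of_ae ?_
    filter_upwards [ae_tendsto_logNormQuot] with u hu
    exact hu.mul_const _

lemma abs_setIntegral_mul_le {α : Type*} [MeasurableSpace α] {μ : Measure α} {S : Set α}
    (hS : MeasurableSet S) {f G w : α → ℝ} {c M : ℝ} (hw : ∀ x, 0 ≤ w x)
    (hG : ∀ x ∈ S, |G x| ≤ c * w x) (hc : 0 ≤ c) (hf : Integrable (fun x ↦ |f x| * w x) μ)
    (hM : ∫ x, |f x| * w x ∂μ ≤ M) :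
    |∫ x in S, f x * G x ∂μ| ≤ c * M := by
  have hbound : ∀ᵐ x ∂μ.restrict S, ‖f x * G x‖ ≤ c * (|f x| * w x) := by
    rw [ae_restrict_iff' hS]
    refine ae_of_all _ fun x hx ↦ ?_
    rw [norm_mul, Real.norm_eq_abs, Real.norm_eq_abs, mul_left_comm]
    gcongr
    exact hG x hx
  calc |∫ x in S, f x * G x ∂μ| ≤ ∫ x in S, c * (|f x| * w x) ∂μ :=
        norm_integral_le_of_norm_le (hf.integrableOn.const_mul _) hbound
    _ = c * ∫ x in S, |f x| * w x ∂μ := integral_const_mul _ _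
    _ ≤ c * M := by
        gcongr
        exact (setIntegral_le_integral hf
          (ae_of_all _ fun x ↦ mul_nonneg (abs_nonneg _) (hw x))).trans hM

lemma tendsto_integral_of_tendsto_setIntegral {α ι E : Type*} [MeasurableSpace α]
    {μ : Measure α} [NormedAddCommGroup E] [NormedSpace ℝ E] {p : Filter ι} {F : ι → α → E}
    {f : α → E} (hF : ∀ᶠ i in p, Integrable (F i) μ) (hf : Integrable f μ)
    (htail : ∀ ε > 0, ∃ S, MeasurableSet S ∧
      Tendsto (fun i ↦ ∫ x in S, F i x ∂μ) p (𝓝 (∫ x in S, f x ∂μ)) ∧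
      (∀ᶠ i in p, ‖∫ x in Sᶜ, F i x ∂μ‖ ≤ ε) ∧ ‖∫ x in Sᶜ, f x ∂μ‖ ≤ ε) :
    Tendsto (fun i ↦ ∫ x, F i x ∂μ) p (𝓝 (∫ x, f x ∂μ)) := by
  rw [Metric.tendsto_nhds]
  intro ε hε
  obtain ⟨S, hS, hlim, hFtail, hftail⟩ := htail (ε / 4) (by positivity)
  filter_upwards [hF, hFtail, Metric.tendsto_nhds.1 hlim (ε / 2) (by positivity)]
    with i hFi hFtail hdist
  rw [← integral_add_compl hS hFi, ← integral_add_compl hS hf]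
  calc _ ≤ dist (∫ x in S, F i x ∂μ) (∫ x in S, f x ∂μ) +
        dist (∫ x in Sᶜ, F i x ∂μ) (∫ x in Sᶜ, f x ∂μ) := dist_add_add_le _ _ _ _
    _ ≤ dist (∫ x in S, F i x ∂μ) (∫ x in S, f x ∂μ) + (ε / 4 + ε / 4) := by
        gcongr
        rw [dist_eq_norm]
        exact (norm_sub_le _ _).trans (add_le_add hFtail hftail)
    _ < ε := by linarith

lemma IsLogZetaQuot.tendsto_integral {l : ℂ → ℂ} (hl : IsLogZetaQuot l)
    (hRH : RiemannHypothesis) {L : ℝ} (hL : 6 ≤ L)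
    (τ : ℝ) {G : ℝ → ℝ} (hG : Continuous G) {K : ℝ} (hK : ∀ u, |G u| ≤ K * gaussW L τ u) :
    Tendsto (fun σ ↦ ∫ u, logNormQuot σ u * G u) (𝓝[>] (1 / 2))
      (𝓝 (∫ u, logNormQuot (1 / 2) u * G u)) := by
  have hL0 : 0 < L := by linarith
  have hL2 : 6 ≤ 2 * L := by linarith
  have hK0 : 0 ≤ K := nonneg_of_mul_nonneg_left ((abs_nonneg _).trans (hK 0)) (gaussW_pos L τ 0)
  have hright : ∀ᶠ σ in 𝓝[>] (1 / 2 : ℝ), σ ∈ Ioo (1 / 2) 2 := Ioo_mem_nhdsGT (by norm_num)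
  set M := logL1Const * (1 + |τ|) * (2 * L) ^ 2
  have hM0 : 0 ≤ M := by
    have := logL1Const_nonneg
    positivity
  refine tendsto_integral_of_tendsto_setIntegral
    (hright.mono fun σ hσ ↦ hl.integrable_logNormQuot_mul hσ.1 hσ.2.le hL0 τ hG hK)
    (hl.integrable_half_mul hL τ hG hK) fun ε hε ↦ ?_
  set η := ε / (K * M + 1)
  have hη : 0 < η := by positivity
  have hηε : K * η * M ≤ ε :=
    calc K * η * M ≤ η * (K * M + 1) := by nlinarith
      _ = ε := div_mul_cancel₀ _ (by positivity)
  obtain ⟨A, -, hA⟩ := exists_gaussW_le_mul_gaussW_two_mul hL0 τ hη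
  have hsmall {f : ℝ → ℝ} (hf : Integrable fun u ↦ |f u| * gaussW (2 * L) τ u)
      (hfM : ∫ u, |f u| * gaussW (2 * L) τ u ≤ M) :
      ‖∫ u in (Icc (-A) A)ᶜ, f u * G u‖ ≤ ε :=
    (abs_setIntegral_mul_le measurableSet_Icc.compl (fun u ↦ (gaussW_pos _ _ u).le)
      (fun u hu ↦ ((hK u).trans (by gcongr; exact hA u hu)).trans_eq (mul_assoc _ _ _).symm)
      (by positivity) hf hfM).trans hηε
  refine ⟨Icc (-A) A, measurableSet_Icc, tendsto_setIntegral_Icc_logNormQuot_mul hRH (-A) A hG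
    fun u ↦ (hK u).trans (mul_le_of_le_one_right hK0 (gaussW_le_one _ _ _)),
    hright.mono fun σ hσ ↦ ?_, ?_⟩
  · exact hsmall (hl.integrable_abs_logNormQuot_mul_gaussW hσ.1 hσ.2.le (by linarith) τ)
      (hl.integral_abs_logNormQuot_mul_gaussW_le hσ.1 hσ.2.le hL2 τ)
  · obtain ⟨hint, hle⟩ := hl.integrable_half_and_integral_le hL2 τ
    exact hsmall hint hle

/-- The resonator `∑ a ∈ S, r a * (n a) ^ (it)`: a Dirichlet polynomial with real coefficients,
whose frequencies `n a` and coefficients `r a` are indexed by a finite set `S`. -/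
noncomputable def resonator {ι : Type*} (S : Finset ι) (n : ι → ℕ) (r : ι → ℝ) (t : ℝ) : ℂ :=
  ∑ a ∈ S, (r a : ℂ) * Complex.exp (Complex.I * Real.log (n a) * t)

section Resonator

variable {ι : Type*} {S : Finset ι} {n : ι → ℕ} {r : ι → ℝ}

lemma continuous_resonator : Continuous (resonator S n r) := by
  unfold resonator; fun_prop

lemma norm_resonator_le (t : ℝ) : ‖resonator S n r t‖ ≤ ∑ a ∈ S, |r a| := by
  refine (norm_sum_le _ _).trans (le_of_eq (Finset.sum_congr rfl fun a _ ↦ ?_))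
  rw [norm_mul, Complex.norm_real, Real.norm_eq_abs, mul_assoc, ← Complex.ofReal_mul,
    mul_comm Complex.I, Complex.norm_exp_ofReal_mul_I, mul_one]

lemma norm_sq_resonator (t : ℝ) : ((‖resonator S n r t‖ ^ 2 : ℝ) : ℂ) =
    ∑ a ∈ S, ∑ b ∈ S, ((r a * r b : ℝ) : ℂ) *
      Complex.exp (Complex.I * (Real.log (n a) - Real.log (n b) : ℝ) * t) := by
  rw [← Complex.normSq_eq_norm_sq, ← Complex.mul_conj, resonator, map_sum, Finset.sum_mul_sum]
  refine Finset.sum_congr rfl fun a _ ↦ Finset.sum_congr rfl fun b _ ↦ ?_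
  rw [map_mul, Complex.conj_ofReal, ← Complex.exp_conj]
  simp only [map_mul, Complex.conj_I, Complex.conj_ofReal]
  rw [mul_mul_mul_comm, ← Complex.exp_add]
  push_cast
  congr 2
  ring

/-- The Gaussian-damped square of the resonator: the weight against which the resonance method
averages `log |ζ|`. -/
noncomputable def resonatorWeight (S : Finset ι) (n : ι → ℕ) (r : ι → ℝ) (L τ t : ℝ) : ℝ :=
  ‖resonator S n r t‖ ^ 2 * gaussW L τ t

lemma resonatorWeight_nonneg (L τ t : ℝ) : 0 ≤ resonatorWeight S n r L τ t :=
  mul_nonneg (by positivity) (gaussW_pos _ _ _).le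

lemma continuous_resonatorWeight (L τ : ℝ) : Continuous (resonatorWeight S n r L τ) :=
  (continuous_resonator.norm.pow 2).mul (continuous_gaussW L τ)

lemma resonatorWeight_le (L τ t : ℝ) :
    resonatorWeight S n r L τ t ≤ (∑ a ∈ S, |r a|) ^ 2 * gaussW L τ t := by
  have := (gaussW_pos L τ t).le
  unfold resonatorWeight
  gcongr
  exact norm_resonator_le t

lemma gaussW_sub (L τ u v : ℝ) : gaussW L τ (u - v) = gaussW L (τ + v) u := by
  unfold gaussW; congr 3; ring

lemma abs_resonatorWeight_sub_le (L τ v u : ℝ) :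
    |resonatorWeight S n r L τ (u - v)| ≤ (∑ a ∈ S, |r a|) ^ 2 * gaussW L (τ + v) u := by
  rw [abs_of_nonneg (resonatorWeight_nonneg _ _ _), ← gaussW_sub]
  exact resonatorWeight_le _ _ _

/-- The main term, up to the factor `L √π`, of the average of `logNormQuot σ` against the resonator
weight translated by `v`. -/
noncomputable def resonanceMain (S : Finset ι) (n : ι → ℕ) (r : ι → ℝ) (σ v : ℝ) : ℝ :=
  ∑ a ∈ S, ∑ b ∈ S, r a * r b * (Real.cos ((Real.log (n a) - Real.log (n b)) * v) *
    diagTerm σ (n a) (n b))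

lemma ofReal_resonatorWeight_sub (L τ v u : ℝ) :
    (resonatorWeight S n r L τ (u - v) : ℂ) = ∑ a ∈ S, ∑ b ∈ S, ((r a * r b : ℝ) : ℂ) *
      Complex.exp ((-((Real.log (n a) - Real.log (n b)) * v) : ℝ) * Complex.I) *
        twistKernel L (τ + v) (Real.log (n a) - Real.log (n b)) u := by
  rw [resonatorWeight, Complex.ofReal_mul, norm_sq_resonator, gaussW_sub, Finset.sum_mul]
  refine Finset.sum_congr rfl fun a _ ↦ ?_
  rw [Finset.sum_mul]
  refine Finset.sum_congr rfl fun b _ ↦ ?_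
  rw [twistKernel, gaussC_ofReal, ← mul_assoc, mul_assoc _ (Complex.exp _) (Complex.exp _),
    ← Complex.exp_add]
  congr 3
  push_cast
  ring

lemma mul_resonanceMain_eq_re (c σ v : ℝ) :
    c * resonanceMain S n r σ v = (∑ a ∈ S, ∑ b ∈ S, ((r a * r b : ℝ) : ℂ) *
      Complex.exp ((-((Real.log (n a) - Real.log (n b)) * v) : ℝ) * Complex.I) *
        ((c * diagTerm σ (n a) (n b) : ℝ) : ℂ)).re := by
  rw [resonanceMain, Finset.mul_sum, Complex.re_sum]
  refine Finset.sum_congr rfl fun a _ ↦ ?_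
  rw [Finset.mul_sum, Complex.re_sum]
  refine Finset.sum_congr rfl fun b _ ↦ ?_
  rw [Complex.re_mul_ofReal, Complex.re_ofReal_mul, Complex.exp_ofReal_mul_I_re, Real.cos_neg]
  ring

lemma norm_sum_sum_mul_sub_le {c : ι → ι → ℝ} {I J : ι → ι → ℂ} {E : ℝ}
    (hIJ : ∀ a ∈ S, ∀ b ∈ S, ‖I a b - J a b‖ ≤ E) :
    ‖(∑ a ∈ S, ∑ b ∈ S, ((r a * r b : ℝ) : ℂ) * Complex.exp (c a b * Complex.I) * I a b) -
      ∑ a ∈ S, ∑ b ∈ S, ((r a * r b : ℝ) : ℂ) * Complex.exp (c a b * Complex.I) * J a b‖ ≤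
        (∑ a ∈ S, |r a|) ^ 2 * E := by
  rw [← Finset.sum_sub_distrib, sq, Finset.sum_mul_sum, Finset.sum_mul]
  refine norm_sum_le_of_le _ fun a ha ↦ ?_
  rw [← Finset.sum_sub_distrib, Finset.sum_mul]
  refine norm_sum_le_of_le _ fun b hb ↦ ?_
  rw [← mul_sub, norm_mul, norm_mul, Complex.norm_real, Real.norm_eq_abs, abs_mul,
    Complex.norm_exp_ofReal_mul_I, mul_one]
  gcongr
  exact hIJ a ha b hb

lemma IsLogZetaQuot.integral_mul_resonatorWeight_sub {l : ℂ → ℂ} (hl : IsLogZetaQuot l)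
    {σ : ℝ} (hσ : 1 / 2 < σ) (hσ2 : σ ≤ 2) {L : ℝ} (hL : 0 < L) (τ v : ℝ) :
    ∫ u : ℝ, l (σ + Complex.I * u) * (resonatorWeight S n r L τ (u - v) : ℂ) =
      ∑ a ∈ S, ∑ b ∈ S, ((r a * r b : ℝ) : ℂ) *
        Complex.exp ((-((Real.log (n a) - Real.log (n b)) * v) : ℝ) * Complex.I) *
          ∫ u : ℝ, l (σ + Complex.I * u) *
            twistKernel L (τ + v) (Real.log (n a) - Real.log (n b)) u := by
  have hint (a b : ι) : Integrable fun u : ℝ ↦ l (σ + Complex.I * u) *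
      twistKernel L (τ + v) (Real.log (n a) - Real.log (n b)) u :=
    hl.integrable_mul hσ hσ2 hL (τ + v) (continuous_twistKernel_ofReal _ _ _) (K := 1) fun u ↦ by
      rw [norm_twistKernel_ofReal, one_mul]
  simp_rw [ofReal_resonatorWeight_sub, Finset.mul_sum, mul_left_comm (l _)]
  rw [integral_finsetSum _ fun a _ ↦ integrable_finsetSum _ fun b _ ↦ (hint a b).const_mul _]
  refine Finset.sum_congr rfl fun a _ ↦ ?_
  rw [integral_finsetSum _ fun b _ ↦ (hint a b).const_mul _]
  exact Finset.sum_congr rfl fun b _ ↦ integral_const_mul _ _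

lemma IsLogZetaQuot.abs_integral_sub_resonanceMain_le_of_lt {l : ℂ → ℂ} (hl : IsLogZetaQuot l)
    {σ : ℝ} (hσ : 1 / 2 < σ) (hσ2 : σ ≤ 2) {L : ℝ} (hL : 1 ≤ L) (τ v : ℝ) {N : ℕ}
    (hn : ∀ a ∈ S, 0 < n a ∧ n a ≤ N) (hLN : 32 * (N : ℝ) ≤ L ^ 2) :
    |(∫ u, logNormQuot σ u * resonatorWeight S n r L τ (u - v)) -
      L * √Real.pi * resonanceMain S n r σ v| ≤ (∑ a ∈ S, |r a|) ^ 2 *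
        (twistConst * (N : ℝ) ^ 2 * ((N : ℝ) ^ 2 / L + L ^ 2 / (1 + |τ + v|))) := by
  have hL0 : 0 < L := by linarith
  have hcont : Continuous fun u ↦ resonatorWeight S n r L τ (u - v) :=
    (continuous_resonatorWeight L τ).comp (by fun_prop)
  rw [hl.integral_logNormQuot_mul_eq_re hσ hσ2 hL0 (τ + v) hcont
      (abs_resonatorWeight_sub_le L τ v), hl.integral_mul_resonatorWeight_sub hσ hσ2 hL0,
    mul_resonanceMain_eq_re, ← Complex.sub_re]
  exact (Complex.abs_re_le_norm _).trans (norm_sum_sum_mul_sub_le fun a ha b hb ↦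
    hl.norm_integral_sub_diagTerm_le hσ hσ2 hL (τ + v) (hn a ha).1 (hn b hb).1 (hn a ha).2 hLN)

lemma tendsto_resonanceMain (hn : ∀ a ∈ S, 0 < n a) (v : ℝ) :
    Tendsto (fun σ ↦ resonanceMain S n r σ v) (𝓝[>] (1 / 2))
      (𝓝 (resonanceMain S n r (1 / 2) v)) := by
  refine Tendsto.mono_left ?_ nhdsWithin_le_nhds
  unfold resonanceMain
  refine tendsto_finsetSum _ fun a ha ↦ tendsto_finsetSum _ fun b hb ↦ ?_
  refine Tendsto.const_mul _ (Tendsto.const_mul _ ?_)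
  unfold diagTerm
  split_ifs with hdvd
  · have hpos : ((n a / n b : ℕ) : ℝ) ≠ 0 :=
      mod_cast (Nat.div_pos (Nat.le_of_dvd (hn a ha) hdvd) (hn b hb)).ne'
    have hcont : Continuous fun σ : ℝ ↦ ((n a / n b : ℕ) : ℝ) ^ (-σ) :=
      continuous_const.rpow (by fun_prop) fun _ ↦ Or.inl hpos
    exact (hcont.tendsto _).const_mul _
  · exact tendsto_const_nhds

lemma IsLogZetaQuot.abs_integral_sub_resonanceMain_le {l : ℂ → ℂ} (hl : IsLogZetaQuot l)
    (hRH : RiemannHypothesis) {L : ℝ} (hL : 6 ≤ L) (τ v : ℝ) {N : ℕ}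
    (hn : ∀ a ∈ S, 0 < n a ∧ n a ≤ N) (hLN : 32 * (N : ℝ) ≤ L ^ 2) :
    |(∫ u, logNormQuot (1 / 2) u * resonatorWeight S n r L τ (u - v)) -
      L * √Real.pi * resonanceMain S n r (1 / 2) v| ≤ (∑ a ∈ S, |r a|) ^ 2 *
        (twistConst * (N : ℝ) ^ 2 * ((N : ℝ) ^ 2 / L + L ^ 2 / (1 + |τ + v|))) := by
  have hcont : Continuous fun u ↦ resonatorWeight S n r L τ (u - v) :=
    (continuous_resonatorWeight L τ).comp (by fun_prop)
  have hintegral := hl.tendsto_integral hRH hL (τ + v) hcont (abs_resonatorWeight_sub_le L τ v)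
  have hmain :=
    (tendsto_resonanceMain (r := r) (fun a ha ↦ (hn a ha).1) v).const_mul (L * √Real.pi)
  have hright : ∀ᶠ σ in 𝓝[>] (1 / 2 : ℝ), σ ∈ Ioo (1 / 2) 2 := Ioo_mem_nhdsGT (by norm_num)
  exact le_of_tendsto (hintegral.sub hmain).abs (hright.mono fun σ hσ ↦
    hl.abs_integral_sub_resonanceMain_le_of_lt hσ.1 hσ.2.le (by linarith) τ v hn hLN)

lemma abs_integral_sub_le_of_abs_setIntegral_compl_le {α : Type*} [MeasurableSpace α]
    {μ : Measure α} {F : α → ℝ} (hF : Integrable F μ) {U : Set α} (hU : MeasurableSet U)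
    {M E₁ E₂ : ℝ} (hwhole : |∫ x, F x ∂μ - M| ≤ E₁) (htail : |∫ x in Uᶜ, F x ∂μ| ≤ E₂) :
    |∫ x in U, F x ∂μ - M| ≤ E₁ + E₂ := by
  rw [← integral_add_compl hU hF] at hwhole
  rw [abs_le] at hwhole htail ⊢
  constructor <;> linarith [hwhole.1, hwhole.2, htail.1, htail.2]

lemma IsLogZetaQuot.abs_setIntegral_sub_resonanceMain_le {l : ℂ → ℂ} (hl : IsLogZetaQuot l)
    (hRH : RiemannHypothesis) {T L : ℝ} (hL : 6 ≤ L) (hLT : L ^ 2 = T) (v : ℝ) {N : ℕ}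
    (hn : ∀ a ∈ S, 0 < n a ∧ n a ≤ N) (hLN : 32 * (N : ℝ) ≤ L ^ 2) :
    |(∫ t in T..(2 * T), logNormQuot (1 / 2) (t - v) * resonatorWeight S n r L (3 / 2 * T) t) -
      L * √Real.pi * resonanceMain S n r (1 / 2) (-v)| ≤ (∑ a ∈ S, |r a|) ^ 2 *
        (twistConst * (N : ℝ) ^ 2 * ((N : ℝ) ^ 2 / L + L ^ 2 / (1 + |3 / 2 * T - v|)) +
          Real.exp (-(3 / 16 * T)) * (logL1Const * (1 + |3 / 2 * T - v|) * (2 * L) ^ 2)) := by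
  have hL0 : 0 < L := by linarith
  have hT : 0 < T := by rw [← hLT]; positivity
  set τ := 3 / 2 * T with hτ
  have hcont : Continuous fun u ↦ resonatorWeight S n r L τ (u - -v) :=
    (continuous_resonatorWeight L τ).comp (by fun_prop)
  have htranslate : ∫ t in T..(2 * T), logNormQuot (1 / 2) (t - v) * resonatorWeight S n r L τ t =
      ∫ u in Ioc (T - v) (2 * T - v),
        logNormQuot (1 / 2) u * resonatorWeight S n r L τ (u - -v) := by
    rw [← intervalIntegral.integral_of_le (by linarith), ← intervalIntegral.integral_comp_sub_right]
    simp only [sub_neg_eq_add, sub_add_cancel]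
  have hweight : ∀ u ∈ (Ioc (T - v) (2 * T - v))ᶜ, |resonatorWeight S n r L τ (u - -v)| ≤
      (∑ a ∈ S, |r a|) ^ 2 * Real.exp (-(3 / 16 * T)) * gaussW (2 * L) (τ - v) u := by
    intro u hu
    have hfar : T / 2 ≤ |u - (τ - v)| := by
      by_contra! hnear
      rw [abs_lt] at hnear
      exact hu ⟨by linarith, by linarith⟩
    have hexponent : 3 / 4 * (T / 2 / L) ^ 2 = 3 / 16 * T := by
      rw [div_pow, hLT]
      field_simp
      norm_num
    refine (abs_resonatorWeight_sub_le L τ (-v) u).trans ?_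
    rw [mul_assoc, ← hexponent, ← sub_eq_add_neg]
    gcongr
    exact gaussW_le_exp_mul_gaussW_two_mul hL0 (by positivity) hfar
  obtain ⟨hint, hle⟩ := hl.integrable_half_and_integral_le (by linarith : 6 ≤ 2 * L) (τ - v)
  have htail := abs_setIntegral_mul_le measurableSet_Ioc.compl (fun u ↦ (gaussW_pos _ _ u).le)
    hweight (by positivity) hint hle
  have hwhole := hl.abs_integral_sub_resonanceMain_le (r := r) hRH hL τ (-v) hn hLN
  rw [← sub_eq_add_neg] at hwhole
  rw [htranslate, mul_add, ← mul_assoc _ (Real.exp _)]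
  exact abs_integral_sub_le_of_abs_setIntegral_compl_le (hl.integrable_half_mul hL (τ + -v) hcont
    (abs_resonatorWeight_sub_le L τ (-v))) measurableSet_Ioc hwhole htail

lemma integrable_resonatorWeight {L : ℝ} (hL : 0 < L) (τ : ℝ) :
    Integrable (resonatorWeight S n r L τ) :=
  ((integrable_gaussW hL τ).const_mul ((∑ a ∈ S, |r a|) ^ 2)).mono'
    (continuous_resonatorWeight L τ).aestronglyMeasurable (ae_of_all _ fun t ↦ by
      rw [Real.norm_of_nonneg (resonatorWeight_nonneg _ _ _)]
      exact resonatorWeight_le _ _ _)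

lemma norm_integral_twistKernel {L : ℝ} (hL : 0 < L) (τ μ : ℝ) :
    ‖∫ t : ℝ, twistKernel L τ μ t‖ = L * √Real.pi * Real.exp (-(L ^ 2 * μ ^ 2 / 4)) := by
  have hfourier := integral_cexp_mul_gaussC hL τ 0 μ
  simp only [Complex.ofReal_zero, mul_zero, sub_zero, add_zero] at hfourier
  simp_rw [twistKernel]
  rw [hfourier, norm_mul, Complex.norm_real, Real.norm_of_nonneg (by positivity), Complex.norm_exp,
    mul_assoc Complex.I, ← Complex.ofReal_mul, Complex.add_re, Complex.I_mul_re, Complex.ofReal_im,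
    ← Complex.ofReal_neg, Complex.ofReal_re, neg_zero, add_zero]

lemma norm_integral_twistKernel_log_sub_log_le {L : ℝ} (hL : 0 < L) (τ : ℝ) {m k N : ℕ}
    (hm : 0 < m) (hk : 0 < k) (hmk : m ≠ k) (hmN : m ≤ N) :
    ‖∫ t : ℝ, twistKernel L τ (Real.log m - Real.log k) t‖ ≤
      L * √Real.pi * (16 * N ^ 2 / L ^ 2) := by
  have hN : (0 : ℝ) < N := mod_cast hm.trans_le hmN
  have hgap : (1 / (2 * N : ℝ)) ^ 2 ≤ (Real.log m - Real.log k) ^ 2 := by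
    rw [← sq_abs (Real.log m - Real.log k)]
    gcongr
    exact inv_le_abs_log_sub_log hm hk hmk hmN
  have hexponent : L ^ 2 / (16 * N ^ 2) ≤ L ^ 2 * (Real.log m - Real.log k) ^ 2 / 4 :=
    calc L ^ 2 / (16 * N ^ 2) = L ^ 2 * (1 / (2 * N : ℝ)) ^ 2 / 4 := by field_simp; norm_num
      _ ≤ _ := by gcongr
  rw [norm_integral_twistKernel hL]
  gcongr
  calc _ ≤ Real.exp (-(L ^ 2 / (16 * N ^ 2))) := by gcongr
    _ ≤ (L ^ 2 / (16 * N ^ 2))⁻¹ := exp_neg_le_inv (by positivity)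
    _ = _ := inv_div _ _

lemma ofReal_integral_resonatorWeight {L : ℝ} (hL : 0 < L) (τ : ℝ) :
    ((∫ t, resonatorWeight S n r L τ t : ℝ) : ℂ) = ∑ a ∈ S, ∑ b ∈ S, ((r a * r b : ℝ) : ℂ) *
      ∫ t : ℝ, twistKernel L τ (Real.log (n a) - Real.log (n b)) t := by
  have hint (a b : ι) : Integrable fun t : ℝ ↦
      twistKernel L τ (Real.log (n a) - Real.log (n b)) t := by
    simpa using integrable_twistKernel_line hL τ (Real.log (n a) - Real.log (n b)) 0
  have hpoint (t : ℝ) : (resonatorWeight S n r L τ t : ℂ) = ∑ a ∈ S, ∑ b ∈ S,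
      ((r a * r b : ℝ) : ℂ) * twistKernel L τ (Real.log (n a) - Real.log (n b)) t := by
    simpa using ofReal_resonatorWeight_sub (S := S) (n := n) (r := r) L τ 0 t
  rw [← integral_complex_ofReal]
  simp_rw [hpoint]
  rw [integral_finsetSum _ fun a _ ↦ integrable_finsetSum _ fun b _ ↦ (hint a b).const_mul _]
  refine Finset.sum_congr rfl fun a _ ↦ ?_
  rw [integral_finsetSum _ fun b _ ↦ (hint a b).const_mul _]
  exact Finset.sum_congr rfl fun b _ ↦ integral_const_mul _ _

lemma sum_sum_abs_mul_ite_add [DecidableEq ι] (E : ℝ) :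
    ∑ a ∈ S, ∑ b ∈ S, |r a| * |r b| * ((if a = b then 1 else 0) + E) =
      ∑ a ∈ S, r a ^ 2 + (∑ a ∈ S, |r a|) ^ 2 * E := by
  simp only [mul_add, mul_ite, mul_one, mul_zero, Finset.sum_add_distrib, Finset.sum_ite_eq]
  rw [sq (∑ a ∈ S, |r a|), Finset.sum_mul_sum]
  simp only [Finset.sum_mul]
  congr 1
  exact Finset.sum_congr rfl fun a ha ↦ by rw [if_pos ha, abs_mul_abs_self, sq]

lemma integral_resonatorWeight_le {L : ℝ} (hL : 0 < L) (τ : ℝ) {N : ℕ}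
    (hn : ∀ a ∈ S, 0 < n a ∧ n a ≤ N) (hinj : InjOn n S) :
    ∫ t, resonatorWeight S n r L τ t ≤
      L * √Real.pi * (∑ a ∈ S, r a ^ 2 + (∑ a ∈ S, |r a|) ^ 2 * (16 * N ^ 2 / L ^ 2)) := by
  classical
  have hE : 0 ≤ 16 * (N : ℝ) ^ 2 / L ^ 2 := by positivity
  have hterm : ∀ a ∈ S, ∀ b ∈ S,
      ‖∫ t : ℝ, twistKernel L τ (Real.log (n a) - Real.log (n b)) t‖ ≤
        L * √Real.pi * ((if a = b then 1 else 0) + 16 * N ^ 2 / L ^ 2) := by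
    intro a ha b hb
    split_ifs with hab
    · rw [norm_integral_twistKernel hL, hab]
      gcongr
      simpa using hE
    · rw [zero_add]
      exact norm_integral_twistKernel_log_sub_log_le hL τ (hn a ha).1 (hn b hb).1
        (fun h ↦ hab (hinj ha hb h)) (hn a ha).2
  calc ∫ t, resonatorWeight S n r L τ t
      ≤ ‖((∫ t, resonatorWeight S n r L τ t : ℝ) : ℂ)‖ := by
        rw [Complex.norm_real]
        exact Real.le_norm_self _
    _ ≤ ∑ a ∈ S, ∑ b ∈ S, L * √Real.pi *
          (|r a| * |r b| * ((if a = b then 1 else 0) + 16 * N ^ 2 / L ^ 2)) := by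
        rw [ofReal_integral_resonatorWeight hL]
        refine norm_sum_le_of_le _ fun a ha ↦ norm_sum_le_of_le _ fun b hb ↦ ?_
        rw [norm_mul, Complex.norm_real, Real.norm_eq_abs, abs_mul, mul_left_comm]
        gcongr
        exact hterm a ha b hb
    _ = _ := by
        rw [← sum_sum_abs_mul_ite_add]
        simp only [Finset.mul_sum]

end Resonator

/-- The primes in `(x, y]`. -/
noncomputable def primesIoc (x y : ℝ) : Finset ℕ := {p ∈ Finset.Ioc ⌊x⌋₊ ⌊y⌋₊ | p.Prime}

lemma mem_primesIoc {x y : ℝ} (hx : 0 ≤ x) (hy : 0 ≤ y) {p : ℕ} :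
    p ∈ primesIoc x y ↔ x < p ∧ (p : ℝ) ≤ y ∧ p.Prime := by
  rw [primesIoc, Finset.mem_filter, Finset.mem_Ioc, Nat.floor_lt hx, Nat.le_floor_iff hy, and_assoc]

lemma sum_primesIoc_add {x y z : ℝ} (hxy : x ≤ y) (hyz : y ≤ z) (f : ℕ → ℝ) :
    ∑ p ∈ primesIoc x z, f p = ∑ p ∈ primesIoc x y, f p + ∑ p ∈ primesIoc y z, f p := by
  unfold primesIoc
  rw [← Finset.Ioc_union_Ioc_eq_Ioc (Nat.floor_mono hxy) (Nat.floor_mono hyz), Finset.filter_union,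
    Finset.sum_union]
  refine Finset.disjoint_filter_filter ?_
  exact Finset.Ioc_disjoint_Ioc_of_le le_rfl

lemma theta_sub_theta {x y : ℝ} (hxy : x ≤ y) :
    Chebyshev.theta y - Chebyshev.theta x = ∑ p ∈ primesIoc x y, Real.log p := by
  have h := Nat.floor_mono hxy
  rw [Chebyshev.theta, Chebyshev.theta, primesIoc,
    ← Finset.Ioc_union_Ioc_eq_Ioc (Nat.zero_le _) h, Finset.filter_union, Finset.sum_union]
  · ring
  · exact Finset.disjoint_filter_filter (Finset.Ioc_disjoint_Ioc_of_le le_rfl)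

lemma isLittleO_sqrt_mul_log : (fun x : ℝ ↦ √x * Real.log x) =o[atTop] fun x ↦ x := by
  refine ((isBigO_refl (fun x : ℝ ↦ x ^ (1 / 2 : ℝ)) atTop).mul_isLittleO
    (isLittleO_log_rpow_atTop (show (0 : ℝ) < 1 / 2 by norm_num))).congr' ?_ ?_
  · exact Eventually.of_forall fun x ↦ by simp only [Real.sqrt_eq_rpow]
  · filter_upwards [eventually_gt_atTop 0] with x hx
    rw [← Real.rpow_add hx, add_halves, Real.rpow_one]

lemma eventually_sqrt_mul_log_le {c : ℝ} (hc : 0 < c) :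
    ∀ᶠ x : ℝ in atTop, √x * Real.log x ≤ c * x := by
  filter_upwards [isLittleO_sqrt_mul_log.bound hc, eventually_ge_atTop 0] with x hx hx0
  exact (Real.le_norm_self _).trans (hx.trans_eq (by rw [Real.norm_of_nonneg hx0]))

lemma log_add_two_le_sqrt_mul_log {x : ℝ} (hx : 4 ≤ x) : Real.log (x + 2) ≤ √x * Real.log x := by
  have hlog : 0 ≤ Real.log x := Real.log_nonneg (by linarith)
  have hsqrt : 2 ≤ √x := Real.le_sqrt_of_sq_le (by linarith)
  calc Real.log (x + 2) ≤ Real.log (x ^ 2) := Real.log_le_log (by linarith) (by nlinarith)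
    _ = 2 * Real.log x := by rw [Real.log_pow, Nat.cast_ofNat]
    _ ≤ √x * Real.log x := by gcongr

lemma log_four_eq : Real.log 4 = 2 * Real.log 2 := by
  rw [show (4 : ℝ) = 2 ^ 2 by norm_num, Real.log_pow, Nat.cast_ofNat]

lemma eventually_le_theta_sub_theta :
    ∀ᶠ x : ℝ in atTop, x ≤ Chebyshev.theta (4 * x) - Chebyshev.theta x := by
  have hmul : Tendsto (fun x : ℝ ↦ 4 * x) atTop atTop := tendsto_id.const_mul_atTop (by norm_num)
  filter_upwards [hmul.eventually (eventually_sqrt_mul_log_le (c := 1 / 80) (by norm_num)),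
    eventually_ge_atTop (100 : ℝ)] with x hsqrt hx
  have hlower := Chebyshev.theta_ge' (x := 4 * x) (by linarith)
  have hupper := Chebyshev.theta_le_log4_mul_x (x := x) (by linarith)
  rw [log_four_eq] at hupper
  have hlog := log_add_two_le_sqrt_mul_log (x := 4 * x) (by linarith)
  have hgap : x * 0.693 ≤ x * Real.log 2 := by gcongr; linarith [Real.log_two_gt_d9]
  linarith [Real.log_two_lt_d9]

lemma quarter_le_sum_primesIoc {x : ℝ} (hx : 0 < x)
    (h : x ≤ Chebyshev.theta (4 * x) - Chebyshev.theta x) :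
    1 / 4 ≤ ∑ p ∈ primesIoc x (4 * x), Real.log p / p := by
  rw [theta_sub_theta (by linarith)] at h
  calc 1 / 4 ≤ (∑ p ∈ primesIoc x (4 * x), Real.log p) / (4 * x) := by
        rw [le_div_iff₀ (by linarith)]
        linarith
    _ ≤ ∑ p ∈ primesIoc x (4 * x), Real.log p / p := by
        rw [Finset.sum_div]
        refine Finset.sum_le_sum fun p hp ↦ ?_
        obtain ⟨hxp, hpx, -⟩ := (mem_primesIoc hx.le (by linarith)).1 hp
        have := Real.log_natCast_nonneg p
        have : (0 : ℝ) < p := by linarith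
        gcongr

lemma eventually_sum_primesIoc_pow : ∀ᶠ x : ℝ in atTop, ∀ J : ℕ,
    (J : ℝ) / 4 ≤ ∑ p ∈ primesIoc x (4 ^ J * x), Real.log p / p := by
  obtain ⟨x₀, hx₀⟩ := eventually_atTop.1 eventually_le_theta_sub_theta
  filter_upwards [eventually_ge_atTop x₀, eventually_gt_atTop 0] with x hx hx0 J
  induction J with
  | zero => simp [primesIoc]
  | succ J ih =>
    have hxJ : x ≤ 4 ^ J * x := le_mul_of_one_le_left hx0.le (one_le_pow₀ (by norm_num))
    have hblock := quarter_le_sum_primesIoc (x := 4 ^ J * x) (by positivity) (hx₀ _ (hx.trans hxJ))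
    have hsucc : 4 ^ (J + 1) * x = 4 * (4 ^ J * x) := by ring
    rw [hsucc, sum_primesIoc_add hxJ (by linarith), Nat.cast_succ]
    linarith

lemma sum_log_div_primesIoc_le {x y : ℝ} (hx : 0 ≤ x) (hy : 0 ≤ y) :
    ∑ p ∈ primesIoc x y, Real.log p / p ≤ Real.log y * ∑ p ∈ primesIoc x y, (p : ℝ)⁻¹ := by
  rw [Finset.mul_sum]
  refine Finset.sum_le_sum fun p hp ↦ ?_
  obtain ⟨hxp, hpy, -⟩ := (mem_primesIoc hx hy).1 hp
  rw [div_eq_mul_inv]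
  exact mul_le_mul_of_nonneg_right (Real.log_le_log (by linarith) hpy) (by positivity)

lemma primesIoc_mono_right {x y z : ℝ} (hyz : y ≤ z) : primesIoc x y ⊆ primesIoc x z :=
  Finset.filter_subset_filter _ (Finset.Ioc_subset_Ioc_right (Nat.floor_mono hyz))

lemma exists_four_pow_mul_le_rpow {x : ℝ} (hx : 1 < x) :
    ∃ J : ℕ, Real.log x / (2 * Real.log 4) - 1 ≤ J ∧ 4 ^ J * x ≤ x ^ (3 / 2 : ℝ) := by
  have hx0 : 0 < x := by linarith
  have hlog : 0 ≤ Real.log x := Real.log_nonneg hx.le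
  have : 0 < Real.log 4 := Real.log_pos (by norm_num)
  refine ⟨⌊Real.log x / (2 * Real.log 4)⌋₊, (Nat.sub_one_lt_floor _).le, ?_⟩
  have hJ := Nat.floor_le (show 0 ≤ Real.log x / (2 * Real.log 4) by positivity)
  rw [le_div_iff₀ (by positivity)] at hJ
  rw [← Real.log_le_log_iff (by positivity) (by positivity), Real.log_mul (by positivity) hx0.ne',
    Real.log_pow, Real.log_rpow hx0]
  linarith

lemma eventually_sum_inv_primesIoc : ∀ᶠ x : ℝ in atTop,
    1 / 30 ≤ ∑ p ∈ primesIoc x (x ^ (3 / 2 : ℝ)), (p : ℝ)⁻¹ := by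
  filter_upwards [eventually_sum_primesIoc_pow, eventually_gt_atTop 1,
    Real.tendsto_log_atTop.eventually_ge_atTop 10] with x hsum hx hlog
  have hx0 : 0 < x := by linarith
  obtain ⟨J, hJ, hpow⟩ := exists_four_pow_mul_le_rpow hx
  have hquot : Real.log x / 2.8 ≤ Real.log x / (2 * Real.log 4) := by
    rw [log_four_eq]
    have := Real.log_two_gt_d9
    gcongr
    linarith [Real.log_two_lt_d9]
  have hupper : (J : ℝ) / 4 ≤
      (3 / 2 * Real.log x) * ∑ p ∈ primesIoc x (x ^ (3 / 2 : ℝ)), (p : ℝ)⁻¹ :=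
    calc (J : ℝ) / 4 ≤ ∑ p ∈ primesIoc x (4 ^ J * x), Real.log p / p := hsum J
      _ ≤ ∑ p ∈ primesIoc x (x ^ (3 / 2 : ℝ)), Real.log p / p :=
        Finset.sum_le_sum_of_subset_of_nonneg (primesIoc_mono_right hpow) fun p _ _ ↦
          div_nonneg (Real.log_natCast_nonneg p) p.cast_nonneg
      _ ≤ _ := by
        rw [← Real.log_rpow hx0]
        exact sum_log_div_primesIoc_le hx0.le (by positivity)
  have hmul : Real.log x * (1 / 30) ≤
      Real.log x * ∑ p ∈ primesIoc x (x ^ (3 / 2 : ℝ)), (p : ℝ)⁻¹ := by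
    norm_num at hquot
    linarith
  exact le_of_mul_le_mul_left hmul (by linarith)

/-- The coefficient `ε ^ |A| ∏ p ∈ A, ρ p` of the resonator at `∏ p ∈ A, p`. Each step up in the
number of primes changes the sign by `ε = ± 1`, which decides the sign of the main term. -/
noncomputable def resCoeff (ε : ℝ) (ρ : ℕ → ℝ) (A : Finset ℕ) : ℝ := ε ^ A.card * ∏ p ∈ A, ρ p

/-- The frequency of the resonator attached to a finite set of primes. -/
def resInt (A : Finset ℕ) : ℕ := ∏ p ∈ A, p

/-- The subsets of `P` with at most `k` elements. For a set `P` of primes they index the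
squarefree integers composed of at most `k` primes of `P`. -/
def smallSubsets {ι : Type*} (P : Finset ι) (k : ℕ) : Finset (Finset ι) :=
  {A ∈ P.powerset | A.card ≤ k}

section SmallSubsets

variable {ι : Type*} {P : Finset ι}

lemma mem_smallSubsets {k : ℕ} {A : Finset ι} : A ∈ smallSubsets P k ↔ A ⊆ P ∧ A.card ≤ k := by
  rw [smallSubsets, Finset.mem_filter, Finset.mem_powerset]

lemma smallSubsets_mono {j k : ℕ} (hjk : j ≤ k) : smallSubsets P j ⊆ smallSubsets P k :=
  fun _ hA ↦ mem_smallSubsets.2 ((mem_smallSubsets.1 hA).imp_right fun h ↦ h.trans hjk)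

lemma insert_mem_smallSubsets_succ [DecidableEq ι] {k : ℕ} {p : ι} {B : Finset ι}
    (hB : B ∈ smallSubsets P k) (hp : p ∈ P) : insert p B ∈ smallSubsets P (k + 1) := by
  obtain ⟨hBP, hBk⟩ := mem_smallSubsets.1 hB
  exact mem_smallSubsets.2
    ⟨Finset.insert_subset hp hBP, (Finset.card_insert_le _ _).trans (by omega)⟩

lemma smallSubsets_succ [DecidableEq ι] (P : Finset ι) (k : ℕ) :
    smallSubsets P (k + 1) = smallSubsets P k ∪ P.powersetCard (k + 1) := by
  ext A
  simp only [mem_smallSubsets, Finset.mem_union, Finset.mem_powersetCard]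
  grind

lemma sum_powersetCard_succ_sum [DecidableEq ι] (f : Finset ι → ι → ℝ) (P : Finset ι) (j : ℕ) :
    ∑ A ∈ P.powersetCard (j + 1), ∑ p ∈ A, f A p =
      ∑ B ∈ P.powersetCard j, ∑ p ∈ P \ B, f (insert p B) p := by
  rw [Finset.sum_sigma', Finset.sum_sigma']
  refine Finset.sum_bij' (fun x _ ↦ ⟨x.1.erase x.2, x.2⟩) (fun x _ ↦ ⟨insert x.2 x.1, x.2⟩)
    ?_ ?_ ?_ ?_ ?_
  · rintro ⟨A, p⟩ h
    simp only [Finset.mem_sigma, Finset.mem_powersetCard, Finset.mem_sdiff] at h ⊢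
    obtain ⟨⟨hA, hc⟩, hp⟩ := h
    refine ⟨⟨(Finset.erase_subset _ _).trans hA, ?_⟩, hA hp, Finset.notMem_erase _ _⟩
    rw [Finset.card_erase_of_mem hp, hc, Nat.add_sub_cancel]
  · rintro ⟨B, p⟩ h
    simp only [Finset.mem_sigma, Finset.mem_powersetCard, Finset.mem_sdiff] at h ⊢
    obtain ⟨⟨hB, hc⟩, hp, hpB⟩ := h
    refine ⟨⟨Finset.insert_subset hp hB, ?_⟩, Finset.mem_insert_self _ _⟩
    rw [Finset.card_insert_of_notMem hpB, hc]
  · rintro ⟨A, p⟩ h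
    simp only [Finset.mem_sigma] at h
    simp only [Finset.insert_erase h.2]
  · rintro ⟨B, p⟩ h
    simp only [Finset.mem_sigma, Finset.mem_sdiff] at h
    simp only [Finset.erase_insert h.2.2]
  · rintro ⟨A, p⟩ h
    simp only [Finset.mem_sigma] at h
    simp only [Finset.insert_erase h.2]

lemma sum_prod_powersetCard_succ [DecidableEq ι] (w : ι → ℝ) (P : Finset ι) (j : ℕ) :
    (j + 1 : ℝ) * ∑ A ∈ P.powersetCard (j + 1), ∏ p ∈ A, w p =
      ∑ B ∈ P.powersetCard j, (∑ p ∈ P \ B, w p) * ∏ q ∈ B, w q :=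
  calc (j + 1 : ℝ) * ∑ A ∈ P.powersetCard (j + 1), ∏ p ∈ A, w p
      = ∑ A ∈ P.powersetCard (j + 1), ∑ _p ∈ A, ∏ q ∈ A, w q := by
        rw [Finset.mul_sum]
        refine Finset.sum_congr rfl fun A hA ↦ ?_
        rw [Finset.sum_const, (Finset.mem_powersetCard.1 hA).2, nsmul_eq_mul, Nat.cast_succ]
    _ = ∑ B ∈ P.powersetCard j, ∑ p ∈ P \ B, ∏ q ∈ insert p B, w q :=
        sum_powersetCard_succ_sum (fun A _ ↦ ∏ q ∈ A, w q) P j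
    _ = _ := by
        refine Finset.sum_congr rfl fun B _ ↦ ?_
        rw [Finset.sum_mul]
        exact Finset.sum_congr rfl fun p hp ↦ Finset.prod_insert (Finset.mem_sdiff.1 hp).2

lemma sum_powersetCard_succ_le {w : ι → ℝ} (hw : ∀ p ∈ P, 0 ≤ w p) {j : ℕ}
    (hP : ∑ p ∈ P, w p ≤ j + 1) :
    ∑ A ∈ P.powersetCard (j + 1), ∏ p ∈ A, w p ≤ ∑ A ∈ P.powersetCard j, ∏ p ∈ A, w p := by
  classical
  refine le_of_mul_le_mul_left (a := (j + 1 : ℝ)) ?_ (by positivity)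
  rw [sum_prod_powersetCard_succ, Finset.mul_sum]
  refine Finset.sum_le_sum fun B hB ↦ ?_
  have hBP := (Finset.mem_powersetCard.1 hB).1
  refine mul_le_mul_of_nonneg_right (le_trans ?_ hP) (Finset.prod_nonneg fun q hq ↦ hw q (hBP hq))
  exact Finset.sum_le_sum_of_subset_of_nonneg Finset.sdiff_subset fun p hp _ ↦ hw p hp

lemma sum_smallSubsets_succ_le {w : ι → ℝ} (hw : ∀ p ∈ P, 0 ≤ w p) {k : ℕ}
    (hP : ∑ p ∈ P, w p ≤ k + 1) :
    ∑ A ∈ smallSubsets P (k + 1), ∏ p ∈ A, w p ≤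
      2 * ∑ A ∈ smallSubsets P k, ∏ p ∈ A, w p := by
  classical
  have hdisj : Disjoint (smallSubsets P k) (P.powersetCard (k + 1)) :=
    Finset.disjoint_left.2 fun A hA hA' ↦ by
      have := (mem_smallSubsets.1 hA).2
      have := (Finset.mem_powersetCard.1 hA').2
      omega
  have hsub : P.powersetCard k ⊆ smallSubsets P k := fun A hA ↦
    mem_smallSubsets.2 ((Finset.mem_powersetCard.1 hA).imp_right le_of_eq)
  rw [smallSubsets_succ, Finset.sum_union hdisj, two_mul]
  refine add_le_add_right ((sum_powersetCard_succ_le hw hP).trans ?_) _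
  exact Finset.sum_le_sum_of_subset_of_nonneg hsub fun A hA _ ↦
    Finset.prod_nonneg fun p hp ↦ hw p ((mem_smallSubsets.1 hA).1 hp)

end SmallSubsets

section PrimeResonator

variable {P A B : Finset ℕ} {p : ℕ} {ε v c : ℝ} {ρ : ℕ → ℝ}

lemma resCoeff_sq (hε : ε ^ 2 = 1) (A : Finset ℕ) :
    resCoeff ε ρ A ^ 2 = ∏ p ∈ A, ρ p ^ 2 := by
  rw [resCoeff, mul_pow, ← pow_mul, mul_comm A.card, pow_mul, hε, one_pow, one_mul,
    Finset.prod_pow]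

lemma resCoeff_insert (hp : p ∉ B) : resCoeff ε ρ (insert p B) = ε * ρ p * resCoeff ε ρ B := by
  rw [resCoeff, resCoeff, Finset.card_insert_of_notMem hp, Finset.prod_insert hp]
  ring

lemma resInt_insert (hp : p ∉ B) : resInt (insert p B) = p * resInt B :=
  Finset.prod_insert hp

lemma resInt_pos (hA : ∀ p ∈ A, p.Prime) : 0 < resInt A :=
  Finset.prod_pos fun p hp ↦ (hA p hp).pos

lemma primeFactors_resInt (hA : ∀ p ∈ A, p.Prime) : (resInt A).primeFactors = A :=
  Nat.primeFactors_prod hA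

lemma logZetaCoeff_prime (hp : p.Prime) : logZetaCoeff p = 1 := by
  rw [logZetaCoeff, ArithmeticFunction.vonMangoldt_apply_prime hp, div_self hp.log_ne_zero]

lemma isPrimePow_of_logZetaCoeff_ne_zero {n : ℕ} (hn : logZetaCoeff n ≠ 0) : IsPrimePow n := by
  contrapose! hn
  rw [logZetaCoeff, ArithmeticFunction.vonMangoldt_eq_zero_iff.2 hn, zero_div]

lemma diagTerm_insert (hB : ∀ q ∈ B, q.Prime) (hp : p.Prime) (hpB : p ∉ B) (σ : ℝ) :
    diagTerm σ (resInt (insert p B)) (resInt B) = (p : ℝ) ^ (-σ) := by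
  rw [resInt_insert hpB, diagTerm, if_pos (Dvd.intro_left p rfl),
    Nat.mul_div_cancel _ (resInt_pos hB), logZetaCoeff_prime hp, one_mul]

lemma exists_insert_of_diagTerm_ne_zero (hA : ∀ q ∈ A, q.Prime) (hB : ∀ q ∈ B, q.Prime) {σ : ℝ}
    (h : diagTerm σ (resInt A) (resInt B) ≠ 0) : ∃ p ∉ B, A = insert p B := by
  rw [diagTerm, ite_ne_right_iff] at h
  obtain ⟨hdvd, hne⟩ := h
  have hBA : B ⊆ A := by
    have := Nat.primeFactors_mono hdvd (resInt_pos hA).ne'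
    rwa [primeFactors_resInt hA, primeFactors_resInt hB] at this
  have hprod : resInt A = resInt (A \ B) * resInt B := (Finset.prod_sdiff hBA).symm
  rw [hprod, Nat.mul_div_cancel _ (resInt_pos hB)] at hne
  have hcard := isPrimePow_iff_card_primeFactors_eq_one.1
    (isPrimePow_of_logZetaCoeff_ne_zero (left_ne_zero_of_mul hne))
  rw [primeFactors_resInt fun q hq ↦ hA q (Finset.mem_sdiff.1 hq).1] at hcard
  obtain ⟨p, hp⟩ := Finset.card_eq_one.1 hcard
  have hpAB : p ∈ A \ B := hp ▸ Finset.mem_singleton_self p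
  refine ⟨p, (Finset.mem_sdiff.1 hpAB).2, ?_⟩
  rw [← Finset.sdiff_union_of_subset hBA, hp, Finset.insert_eq]

/-- The `(A, B)` term of `ε * resonanceMain` on the critical line; the factor `ε` makes the nonzero
terms, those with `A = insert p B`, nonnegative. -/
noncomputable def resonanceTerm (ε : ℝ) (ρ : ℕ → ℝ) (v : ℝ) (A B : Finset ℕ) : ℝ :=
  ε * (resCoeff ε ρ A * resCoeff ε ρ B * (Real.cos ((Real.log (resInt A) - Real.log (resInt B)) * v)
    * diagTerm (1 / 2) (resInt A) (resInt B)))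

lemma mul_resonanceMain_eq_sum (S : Finset (Finset ℕ)) :
    ε * resonanceMain S resInt (resCoeff ε ρ) (1 / 2) v =
      ∑ B ∈ S, ∑ A ∈ S, resonanceTerm ε ρ v A B := by
  simp only [resonanceMain, resonanceTerm, Finset.mul_sum]
  exact Finset.sum_comm

lemma resonanceTerm_insert (hε : ε ^ 2 = 1) (hB : ∀ q ∈ B, q.Prime) (hp : p.Prime) (hpB : p ∉ B) :
    resonanceTerm ε ρ v (insert p B) B =
      resCoeff ε ρ B ^ 2 * (ρ p * (p : ℝ) ^ (-(1 / 2) : ℝ)) * Real.cos (Real.log p * v) := by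
  have hp0 : (p : ℝ) ≠ 0 := Nat.cast_ne_zero.2 hp.ne_zero
  have hB0 : (resInt B : ℝ) ≠ 0 := Nat.cast_ne_zero.2 (resInt_pos hB).ne'
  rw [resonanceTerm, diagTerm_insert hB hp hpB, resCoeff_insert hpB, resInt_insert hpB,
    Nat.cast_mul, Real.log_mul hp0 hB0, add_sub_cancel_right]
  linear_combination (ρ p * resCoeff ε ρ B ^ 2 * Real.cos (Real.log p * v) *
    (p : ℝ) ^ (-(1 / 2) : ℝ)) * hε

variable (hP : ∀ p ∈ P, p.Prime) (hε : ε ^ 2 = 1) (hρ : ∀ p ∈ P, 0 ≤ ρ p) (hc : 0 ≤ c)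
  (hv : ∀ p ∈ P, c ≤ Real.cos (Real.log p * v))
include hP hε hρ hc hv

lemma resonanceTerm_nonneg (hA : A ⊆ P) (hB : B ⊆ P) : 0 ≤ resonanceTerm ε ρ v A B := by
  have hBprime : ∀ q ∈ B, q.Prime := fun q hq ↦ hP q (hB hq)
  by_cases hd : diagTerm (1 / 2) (resInt A) (resInt B) = 0
  · rw [resonanceTerm, hd, mul_zero, mul_zero, mul_zero]
  · obtain ⟨p, hpB, rfl⟩ :=
      exists_insert_of_diagTerm_ne_zero (fun q hq ↦ hP q (hA hq)) hBprime hd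
    have hpP : p ∈ P := hA (Finset.mem_insert_self p B)
    have hρp := hρ p hpP
    have hcos := hc.trans (hv p hpP)
    rw [resonanceTerm_insert hε hBprime (hP p hpP) hpB]
    positivity

lemma mul_sum_sdiff_le_sum_resonanceTerm {k : ℕ} (hB : B ∈ smallSubsets P k) :
    c * (resCoeff ε ρ B ^ 2 * ∑ p ∈ P \ B, ρ p * (p : ℝ) ^ (-(1 / 2) : ℝ)) ≤
      ∑ A ∈ smallSubsets P (k + 1), resonanceTerm ε ρ v A B := by
  have hBP := (mem_smallSubsets.1 hB).1
  have hinj : InjOn (insert · B) (P \ B : Finset ℕ) := fun p hp q _ hpq ↦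
    (Finset.insert_inj (Finset.mem_sdiff.1 hp).2).1 hpq
  have himage : (P \ B).image (insert · B) ⊆ smallSubsets P (k + 1) :=
    Finset.image_subset_iff.2 fun p hp ↦
      insert_mem_smallSubsets_succ hB (Finset.mem_sdiff.1 hp).1
  calc c * (resCoeff ε ρ B ^ 2 * ∑ p ∈ P \ B, ρ p * (p : ℝ) ^ (-(1 / 2) : ℝ))
      ≤ ∑ p ∈ P \ B, resonanceTerm ε ρ v (insert p B) B := by
        rw [Finset.mul_sum, Finset.mul_sum]
        refine Finset.sum_le_sum fun p hp ↦ ?_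
        obtain ⟨hpP, hpB⟩ := Finset.mem_sdiff.1 hp
        have := hρ p hpP
        rw [resonanceTerm_insert hε (fun q hq ↦ hP q (hBP hq)) (hP p hpP) hpB, mul_comm c]
        exact mul_le_mul_of_nonneg_left (hv p hpP) (by positivity)
    _ = ∑ A ∈ (P \ B).image (insert · B), resonanceTerm ε ρ v A B := by rw [Finset.sum_image hinj]
    _ ≤ _ := Finset.sum_le_sum_of_subset_of_nonneg himage fun A hA _ ↦
        resonanceTerm_nonneg hP hε hρ hc hv (mem_smallSubsets.1 hA).1 hBP

lemma le_mul_resonanceMain (k : ℕ) :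
    c * ∑ B ∈ smallSubsets P k, resCoeff ε ρ B ^ 2 * ∑ p ∈ P \ B, ρ p * (p : ℝ) ^ (-(1 / 2) : ℝ) ≤
      ε * resonanceMain (smallSubsets P (k + 1)) resInt (resCoeff ε ρ) (1 / 2) v := by
  rw [mul_resonanceMain_eq_sum, Finset.mul_sum]
  refine (Finset.sum_le_sum fun B hB ↦
    mul_sum_sdiff_le_sum_resonanceTerm hP hε hρ hc hv hB).trans ?_
  exact Finset.sum_le_sum_of_subset_of_nonneg (smallSubsets_mono k.le_succ) fun B hB _ ↦
    Finset.sum_nonneg fun A hA ↦ resonanceTerm_nonneg hP hε hρ hc hv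
      (mem_smallSubsets.1 hA).1 (mem_smallSubsets.1 hB).1

end PrimeResonator

lemma integrable_uncurry_comp_sub_mul {w G : ℝ → ℝ} (hw : ∀ x y, IntervalIntegrable w volume x y)
    (hG : Continuous G) {K : ℝ} (hK : ∀ t, |G t| ≤ K) {a b c d : ℝ} (hab : a ≤ b) (hcd : c ≤ d) :
    Integrable (Function.uncurry fun t v ↦ w (t - v) * G t)
      ((volume.restrict (Ioc a b)).prod (volume.restrict (Ioc c d))) := by
  set J := Ioc (a - d - 1) (b - c) with hJ
  have hwJ : Integrable (J.indicator w) := by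
    rw [hJ, integrable_indicator_iff measurableSet_Ioc]
    exact (intervalIntegrable_iff_integrableOn_Ioc_of_le (by linarith)).1 (hw _ _)
  have hone : Integrable ((Ioc c d).indicator fun _ ↦ (1 : ℝ)) := by
    rw [integrable_indicator_iff measurableSet_Ioc]
    exact integrableOn_const (by simp)
  have hprod := (hone.convolution_integrand (ContinuousLinearMap.mul ℝ ℝ) hwJ).bdd_mul
    (f := fun p : ℝ × ℝ ↦ G p.1) (hG.comp continuous_fst).aestronglyMeasurable
    (ae_of_all _ fun p ↦ hK p.1)
  rw [Measure.prod_restrict]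
  refine (Integrable.integrableOn hprod).congr_fun (fun p hp ↦ ?_)
    (measurableSet_Ioc.prod measurableSet_Ioc)
  obtain ⟨ht, hv⟩ := hp
  have hmem : p.1 - p.2 ∈ J := ⟨by linarith [ht.1, hv.2], by linarith [ht.2, hv.1]⟩
  simp only [indicator_of_mem hv, indicator_of_mem hmem, ContinuousLinearMap.mul_apply', one_mul,
    Function.uncurry, mul_comm (G _)]

lemma two_mul_le_mul_integral_of_averages {w G : ℝ → ℝ}
    (hw : ∀ x y, IntervalIntegrable w volume x y) (hG : Continuous G) (hG0 : ∀ t, 0 ≤ G t) {K : ℝ}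
    (hK : ∀ t, G t ≤ K) {a b h B Y : ℝ} (hab : a ≤ b) (hh : 0 ≤ h)
    (hB : ∀ v ∈ Icc (-h) h, B ≤ ∫ t in a..b, w (t - v) * G t)
    (hY : ∀ t ∈ Icc a b, ∫ u in (t - h)..(t + h), w u ≤ Y) :
    2 * h * B ≤ Y * ∫ t in a..b, G t := by
  have hhh : -h ≤ h := by linarith
  have hprod := integrable_uncurry_comp_sub_mul hw hG
    (fun t ↦ (abs_of_nonneg (hG0 t)).trans_le (hK t)) hab hhh
  rw [intervalIntegral.integral_of_le hab]
  calc 2 * h * B = ∫ _ in Ioc (-h) h, B := by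
        rw [setIntegral_const, Measure.real, Real.volume_Ioc,
          ENNReal.toReal_ofReal (by linarith), smul_eq_mul]
        ring
    _ ≤ ∫ v in Ioc (-h) h, ∫ t in Ioc a b, w (t - v) * G t := by
        refine setIntegral_mono_on (integrableOn_const (by simp)) hprod.integral_prod_right
          measurableSet_Ioc fun v hv ↦ ?_
        rw [← intervalIntegral.integral_of_le hab]
        exact hB v (Ioc_subset_Icc_self hv)
    _ = ∫ t in Ioc a b, ∫ v in Ioc (-h) h, w (t - v) * G t := (integral_integral_swap hprod).symm
    _ ≤ ∫ t in Ioc a b, Y * G t := by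
        refine setIntegral_mono_on hprod.integral_prod_left
          ((hG.integrableOn_Icc.mono_set Ioc_subset_Icc_self).const_mul Y) measurableSet_Ioc
          fun t ht ↦ ?_
        rw [integral_mul_const, ← intervalIntegral.integral_of_le hhh,
          intervalIntegral.integral_comp_sub_left, sub_neg_eq_add]
        exact mul_le_mul_of_nonneg_right (hY t (Ioc_subset_Icc_self ht)) (hG0 t)
    _ = Y * ∫ t in Ioc a b, G t := integral_const_mul _ _

lemma exists_mul_le_mul_integral_of_averages {w G : ℝ → ℝ}
    (hw : ∀ x y, IntervalIntegrable w volume x y) (hG : Continuous G) (hG0 : ∀ t, 0 ≤ G t) {K : ℝ}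
    (hK : ∀ t, G t ≤ K) {a b h B M : ℝ} (hab : a ≤ b) (hh : 0 ≤ h) (hM0 : 0 < M)
    (hM : ∫ t in a..b, G t ≤ M) (hB0 : 0 < B)
    (hB : ∀ v ∈ Icc (-h) h, B ≤ ∫ t in a..b, w (t - v) * G t) :
    ∃ t ∈ Icc a b, h * B ≤ M * ∫ u in (t - h)..(t + h), w u := by
  by_contra! hsmall
  have hh0 : 0 < h := hh.lt_of_ne' fun h0 ↦ by
    simpa [h0] using hsmall a (left_mem_Icc.2 hab)
  have hY : ∀ t ∈ Icc a b, ∫ u in (t - h)..(t + h), w u ≤ h * B / M := fun t ht ↦ by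
    rw [le_div_iff₀' hM0]
    exact (hsmall t ht).le
  have hcontra : 2 * h * B ≤ h * B :=
    calc 2 * h * B ≤ h * B / M * ∫ t in a..b, G t :=
          two_mul_le_mul_integral_of_averages hw hG hG0 hK hab hh hB hY
      _ ≤ h * B / M * M := by gcongr
      _ = h * B := div_mul_cancel₀ _ hM0.ne'
  linarith [mul_pos hh0 hB0]

/-- The weights which the resonator attaches to the primes in `P`: proportional to `p ^ (-1 / 2)`
and normalised so that their squares add up to `m`. -/
noncomputable def resWeight (P : Finset ℕ) (m : ℝ) (p : ℕ) : ℝ :=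
  √(m / ∑ q ∈ P, (q : ℝ)⁻¹) * (p : ℝ) ^ (-(1 / 2) : ℝ)

lemma rpow_neg_half_sq {a : ℝ} (ha : 0 ≤ a) : (a ^ (-(1 / 2) : ℝ)) ^ 2 = a⁻¹ := by
  rw [← Real.rpow_mul_natCast ha, ← Real.rpow_neg_one]
  norm_num

lemma resWeight_nonneg (P : Finset ℕ) (m : ℝ) (p : ℕ) : 0 ≤ resWeight P m p := by
  unfold resWeight; positivity

lemma resWeight_mul_rpow (P : Finset ℕ) (m : ℝ) (p : ℕ) :
    resWeight P m p * (p : ℝ) ^ (-(1 / 2) : ℝ) = √(m / ∑ q ∈ P, (q : ℝ)⁻¹) * (p : ℝ)⁻¹ := by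
  rw [resWeight, mul_assoc, ← sq, rpow_neg_half_sq p.cast_nonneg]

lemma sum_resWeight_sq {P : Finset ℕ} {m : ℝ} (hm : 0 ≤ m) (hP : ∑ p ∈ P, (p : ℝ)⁻¹ ≠ 0) :
    ∑ p ∈ P, resWeight P m p ^ 2 = m := by
  have : 0 ≤ ∑ p ∈ P, (p : ℝ)⁻¹ := Finset.sum_nonneg fun p _ ↦ by positivity
  simp only [resWeight, mul_pow, rpow_neg_half_sq (Nat.cast_nonneg _)]
  rw [← Finset.mul_sum, Real.sq_sqrt (by positivity), div_mul_cancel₀ _ hP]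

lemma sqrt_mul_sum_inv_le_sum_sdiff {P B : Finset ℕ} (hBP : B ⊆ P) {m : ℝ} (hm : 0 ≤ m)
    (hB : 2 * ∑ p ∈ B, (p : ℝ)⁻¹ ≤ ∑ p ∈ P, (p : ℝ)⁻¹) :
    √(m * ∑ p ∈ P, (p : ℝ)⁻¹) / 2 ≤
      ∑ p ∈ P \ B, resWeight P m p * (p : ℝ) ^ (-(1 / 2) : ℝ) := by
  simp_rw [resWeight_mul_rpow]
  rw [← Finset.mul_sum]
  have hsplit := Finset.sum_sdiff (f := fun p : ℕ ↦ (p : ℝ)⁻¹) hBP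
  have hs : 0 ≤ ∑ p ∈ P, (p : ℝ)⁻¹ := Finset.sum_nonneg fun p _ ↦ by positivity
  set s := ∑ p ∈ P, (p : ℝ)⁻¹
  have hsqrt : √(m * s) = √(m / s) * s := by
    rw [← Real.sqrt_sq hs, ← Real.sqrt_mul (by positivity), Real.sqrt_sq hs]
    congr 1
    rcases eq_or_ne s 0 with h | h
    · simp [h]
    · field_simp
  rw [hsqrt, mul_div_assoc]
  gcongr
  linarith

lemma injOn_resInt {S : Finset (Finset ℕ)} (hS : ∀ A ∈ S, ∀ p ∈ A, p.Prime) :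
    InjOn resInt (S : Set (Finset ℕ)) := fun A hA B hB hAB ↦ by
  rw [← primeFactors_resInt (hS A hA), ← primeFactors_resInt (hS B hB), hAB]

lemma exists_nat_succ_mem_Icc {y : ℝ} (hy : 1 ≤ y) : ∃ k : ℕ, (k + 1 : ℝ) ∈ Icc (y / 2) y := by
  obtain ⟨k, hk⟩ := Nat.exists_eq_succ_of_ne_zero (Nat.floor_pos.2 hy).ne'
  have hle := Nat.floor_le (zero_le_one.trans hy)
  have hlt := Nat.lt_floor_add_one y
  rw [hk] at hle hlt
  push_cast at hle hlt
  have : (0 : ℝ) ≤ k := k.cast_nonneg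
  exact ⟨k, by linarith, hle⟩

lemma eventually_twelve_mul_log_le : ∀ᶠ x : ℝ in atTop, 12 * Real.log x ≤ x := by
  filter_upwards [Real.isLittleO_log_id_atTop.bound (show (0 : ℝ) < 1 / 12 by norm_num),
    eventually_ge_atTop 1] with x hx hx1
  rw [Real.norm_of_nonneg (Real.log_nonneg hx1), id, Real.norm_of_nonneg (by linarith)] at hx
  linarith

section PrimeRange

variable {x : ℝ} {k : ℕ} {P : Finset ℕ}

lemma log_mem_Ioc_of_mem_primesIoc (hx : 1 < x) {p : ℕ}
    (hp : p ∈ primesIoc x (x ^ (3 / 2 : ℝ))) :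
    Real.log p ∈ Ioc (Real.log x) (3 / 2 * Real.log x) := by
  have hx0 : 0 < x := by linarith
  obtain ⟨hxp, hpx, -⟩ := (mem_primesIoc hx0.le (by positivity)).1 hp
  rw [← Real.log_rpow hx0]
  exact ⟨Real.log_lt_log hx0 hxp, Real.log_le_log (hx0.trans hxp) hpx⟩

lemma prime_of_mem_primesIoc (hx : 1 < x) {p : ℕ} (hp : p ∈ primesIoc x (x ^ (3 / 2 : ℝ))) :
    p.Prime :=
  ((mem_primesIoc (by linarith) (by positivity)).1 hp).2.2

lemma resInt_le_exp (hx : 1 < x) (hP : P ⊆ primesIoc x (x ^ (3 / 2 : ℝ)))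
    (hk : k ≤ x / (12 * Real.log x)) {A : Finset ℕ} (hA : A ∈ smallSubsets P k) :
    (resInt A : ℝ) ≤ Real.exp (x / 8) := by
  obtain ⟨hAP, hAk⟩ := mem_smallSubsets.1 hA
  have hlx : 0 < Real.log x := Real.log_pos hx
  have hcard : A.card * (12 * Real.log x) ≤ x :=
    (le_div_iff₀ (by positivity)).1 (le_trans (mod_cast hAk) hk)
  calc (resInt A : ℝ) = ∏ p ∈ A, (p : ℝ) := Nat.cast_prod _ _
    _ ≤ ∏ _p ∈ A, Real.exp (3 / 2 * Real.log x) := by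
        gcongr with p hp
        have hp0 : (0 : ℝ) < p := mod_cast (prime_of_mem_primesIoc hx (hP (hAP hp))).pos
        rw [← Real.log_le_iff_le_exp hp0]
        exact (log_mem_Ioc_of_mem_primesIoc hx (hP (hAP hp))).2
    _ = Real.exp (A.card * (3 / 2 * Real.log x)) := by
        rw [Finset.prod_const, ← Real.exp_nat_mul]
    _ ≤ Real.exp (x / 8) := by
        gcongr
        linarith

lemma cos_le_cos_log_mul (hx : 1 < x) {p : ℕ} (hp : p ∈ primesIoc x (x ^ (3 / 2 : ℝ))) {v : ℝ}
    (hv : |v| ≤ (Real.log x)⁻¹) : Real.cos (3 / 2) ≤ Real.cos (Real.log p * v) := by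
  have hlx : 0 < Real.log x := Real.log_pos hx
  rw [← Real.cos_abs (Real.log p * v)]
  refine Real.cos_le_cos_of_nonneg_of_le_pi (abs_nonneg _) (by linarith [Real.pi_gt_three]) ?_
  rw [abs_mul, abs_of_nonneg (Real.log_natCast_nonneg p)]
  calc Real.log p * |v| ≤ 3 / 2 * Real.log x * (Real.log x)⁻¹ := by
        have := (log_mem_Ioc_of_mem_primesIoc hx hp).2
        gcongr
    _ = 3 / 2 := by field_simp

lemma sum_inv_le_of_mem_smallSubsets (hx : 1 < x) (hP : P ⊆ primesIoc x (x ^ (3 / 2 : ℝ)))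
    (hlx : 5 ≤ Real.log x) (hk : k ≤ x / (12 * Real.log x)) {B : Finset ℕ}
    (hB : B ∈ smallSubsets P k) : ∑ p ∈ B, (p : ℝ)⁻¹ ≤ 1 / 60 := by
  obtain ⟨hBP, hBk⟩ := mem_smallSubsets.1 hB
  have hx0 : 0 < x := by linarith
  calc ∑ p ∈ B, (p : ℝ)⁻¹ ≤ B.card • x⁻¹ := Finset.sum_le_card_nsmul _ _ _ fun p hp ↦
        inv_anti₀ hx0 ((mem_primesIoc hx0.le (by positivity)).1 (hP (hBP hp))).1.le
    _ = B.card * x⁻¹ := nsmul_eq_mul _ _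
    _ ≤ x / (12 * Real.log x) * x⁻¹ := by
        gcongr
        exact le_trans (mod_cast hBk) hk
    _ = 1 / (12 * Real.log x) := by field_simp
    _ ≤ 1 / 60 := one_div_le_one_div_of_le (by norm_num) (by linarith)

lemma sqrt_div_le_sum_sdiff (hx : 1 < x) (hP : P ⊆ primesIoc x (x ^ (3 / 2 : ℝ)))
    (hlx : 5 ≤ Real.log x) (hs : 1 / 30 ≤ ∑ p ∈ P, (p : ℝ)⁻¹)
    (hk : (k + 1 : ℝ) ∈ Icc (x / (12 * Real.log x) / 2) (x / (12 * Real.log x))) {B : Finset ℕ}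
    (hB : B ∈ smallSubsets P k) :
    √(x / Real.log x) / 54 ≤
      ∑ p ∈ P \ B, resWeight P (k + 1) p * (p : ℝ) ^ (-(1 / 2) : ℝ) := by
  have hB60 := sum_inv_le_of_mem_smallSubsets hx hP hlx (by linarith [hk.2]) hB
  refine le_trans ?_
    (sqrt_mul_sum_inv_le_sum_sdiff (mem_smallSubsets.1 hB).1 (by positivity) (by linarith))
  set s := ∑ p ∈ P, (p : ℝ)⁻¹
  have hsq : x / Real.log x ≤ 27 ^ 2 * ((k + 1) * s) :=
    calc x / Real.log x = 720 * (x / (12 * Real.log x) / 2 * (1 / 30)) := by field_simp; norm_num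
      _ ≤ 720 * ((k + 1) * s) := by gcongr; exact hk.1
      _ ≤ 27 ^ 2 * ((k + 1) * s) := by gcongr; norm_num
  have hsqrt := Real.sqrt_le_sqrt hsq
  rw [Real.sqrt_mul (by norm_num), Real.sqrt_sq (by norm_num)] at hsqrt
  linarith

lemma mul_sum_resCoeff_sq_le_mul_resonanceMain (hx : 1 < x)
    (hP : P ⊆ primesIoc x (x ^ (3 / 2 : ℝ)))
    (hlx : 5 ≤ Real.log x) (hs : 1 / 30 ≤ ∑ p ∈ P, (p : ℝ)⁻¹)
    (hk : (k + 1 : ℝ) ∈ Icc (x / (12 * Real.log x) / 2) (x / (12 * Real.log x))) {ε v : ℝ}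
    (hε : ε ^ 2 = 1) (hv : |v| ≤ (Real.log x)⁻¹) :
    Real.cos (3 / 2) / 108 * √(x / Real.log x) *
        ∑ A ∈ smallSubsets P (k + 1), resCoeff ε (resWeight P (k + 1)) A ^ 2 ≤
      ε * resonanceMain (smallSubsets P (k + 1)) resInt (resCoeff ε (resWeight P (k + 1)))
        (1 / 2) v := by
  have hcos : 0 ≤ Real.cos (3 / 2) :=
    Real.cos_nonneg_of_neg_pi_div_two_le_of_le (by linarith [Real.pi_pos])
      (by linarith [Real.pi_gt_d2])
  have hlast := sum_smallSubsets_succ_le (fun p _ ↦ sq_nonneg (resWeight P (k + 1) p))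
    (sum_resWeight_sq (by positivity) (by linarith)).le
  simp_rw [← resCoeff_sq hε] at hlast
  calc _ ≤ Real.cos (3 / 2) / 108 * √(x / Real.log x) *
        (2 * ∑ B ∈ smallSubsets P k, resCoeff ε (resWeight P (k + 1)) B ^ 2) := by gcongr
    _ = Real.cos (3 / 2) * ∑ B ∈ smallSubsets P k,
          resCoeff ε (resWeight P (k + 1)) B ^ 2 * (√(x / Real.log x) / 54) := by
        rw [← Finset.sum_mul]
        ring
    _ ≤ Real.cos (3 / 2) * ∑ B ∈ smallSubsets P k, resCoeff ε (resWeight P (k + 1)) B ^ 2 *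
          ∑ p ∈ P \ B, resWeight P (k + 1) p * (p : ℝ) ^ (-(1 / 2) : ℝ) := by
        gcongr with B hB
        exact sqrt_div_le_sum_sdiff hx hP hlx hs hk hB
    _ ≤ _ := le_mul_resonanceMain (fun p hp ↦ prime_of_mem_primesIoc hx (hP hp)) hε
        (fun p _ ↦ resWeight_nonneg _ _ p) hcos (fun p hp ↦ cos_le_cos_log_mul hx (hP hp) hv) k

end PrimeRange

lemma eventually_exists_resonator : ∃ c > 0, ∀ᶠ T : ℝ in atTop, ∀ ε : ℝ, ε ^ 2 = 1 →
    ∃ (S : Finset (Finset ℕ)) (r : Finset ℕ → ℝ),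
      (∀ A ∈ S, 0 < resInt A ∧ (resInt A : ℝ) ≤ T ^ (1 / 8 : ℝ)) ∧ InjOn resInt S ∧
      0 < ∑ A ∈ S, r A ^ 2 ∧ ∀ v : ℝ, |v| ≤ (Real.log (Real.log T))⁻¹ →
        c * √(Real.log T / Real.log (Real.log T)) * ∑ A ∈ S, r A ^ 2 ≤
          ε * resonanceMain S resInt r (1 / 2) v := by
  have hcos : 0 < Real.cos (3 / 2) :=
    Real.cos_pos_of_mem_Ioo ⟨by linarith [Real.pi_pos], by linarith [Real.pi_gt_d2]⟩
  refine ⟨Real.cos (3 / 2) / 108, by positivity, ?_⟩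
  have hlog := Real.tendsto_log_atTop
  filter_upwards [hlog.eventually_gt_atTop 1, (hlog.comp hlog).eventually_ge_atTop 5,
    hlog.eventually eventually_twelve_mul_log_le, hlog.eventually eventually_sum_inv_primesIoc,
    eventually_gt_atTop 0] with T hx hlx h12 hs hT ε hε
  rw [Function.comp_apply] at hlx
  rw [Real.rpow_def_of_pos hT, mul_one_div]
  set x := Real.log T
  obtain ⟨k, hk⟩ := exists_nat_succ_mem_Icc ((one_le_div (by positivity)).2 h12)
  set P := primesIoc x (x ^ (3 / 2 : ℝ))
  have hprime : ∀ A ∈ smallSubsets P (k + 1), ∀ p ∈ A, p.Prime := fun A hA p hp ↦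
    prime_of_mem_primesIoc hx ((mem_smallSubsets.1 hA).1 hp)
  refine ⟨smallSubsets P (k + 1), resCoeff ε (resWeight P (k + 1)), fun A hA ↦
    ⟨resInt_pos (hprime A hA), resInt_le_exp hx subset_rfl (mod_cast hk.2) hA⟩,
    injOn_resInt hprime, ?_,
    fun v hv ↦ mul_sum_resCoeff_sq_le_mul_resonanceMain hx subset_rfl hlx hs hk hε hv⟩
  have hempty : ∅ ∈ smallSubsets P (k + 1) :=
    mem_smallSubsets.2 ⟨Finset.empty_subset _, Nat.zero_le _⟩
  refine lt_of_lt_of_le ?_ (Finset.single_le_sum (fun A _ ↦ sq_nonneg _) hempty)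
  simp [resCoeff]

lemma sq_sum_abs_le {ι : Type*} {S : Finset ι} {n : ι → ℕ} {y : ℝ}
    (hn : ∀ a ∈ S, 0 < n a ∧ (n a : ℝ) ≤ y) (hinj : InjOn n S) (hy : 0 ≤ y) (r : ι → ℝ) :
    (∑ a ∈ S, |r a|) ^ 2 ≤ y * ∑ a ∈ S, r a ^ 2 := by
  have hcard : S.card ≤ ⌊y⌋₊ := by
    simpa using Finset.card_le_card_of_injOn (t := Finset.Icc 1 ⌊y⌋₊) n
      (fun a ha ↦ Finset.mem_coe.2 (Finset.mem_Icc.2 ⟨(hn a ha).1, Nat.le_floor (hn a ha).2⟩)) hinj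
  calc (∑ a ∈ S, |r a|) ^ 2 ≤ S.card * ∑ a ∈ S, |r a| ^ 2 := sq_sum_le_card_mul_sum_sq
    _ ≤ y * ∑ a ∈ S, r a ^ 2 := by
        simp only [sq_abs]
        gcongr
        exact (Nat.le_floor_iff hy).1 hcard

lemma exp_neg_le_six_div_cube {z : ℝ} (hz : 0 < z) : Real.exp (-z) ≤ 6 / z ^ 3 := by
  have h := Real.pow_div_factorial_le_exp z hz.le 3
  rw [Real.exp_neg, inv_le_comm₀ (Real.exp_pos z) (by positivity)]
  simpa [Nat.factorial] using h

/-- The constant in the error terms of the resonance method: the first summand bounds the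
off-diagonal terms, the second the tails of the Gaussian outside `[T, 2T]`. -/
noncomputable def resonanceErrorConst : ℝ :=
  2 * twistConst + 11000 * logL1Const

section Parameters

variable {y : ℝ}

lemma twistConst_mul_le {N q : ℝ} (hy : 1 ≤ y) (hN0 : 0 ≤ N) (hN : N ≤ y) (hq : y ^ 8 ≤ q) :
    twistConst * N ^ 2 * (N ^ 2 / y ^ 4 + (y ^ 4) ^ 2 / (1 + q)) ≤ 2 * twistConst * y ^ 2 := by
  have htwist := twistConst_nonneg
  have hq0 : 0 < 1 + q := by linarith [pow_nonneg (zero_le_one.trans hy) 8]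
  have hleft : N ^ 2 / y ^ 4 ≤ 1 := by
    rw [div_le_one (by positivity)]
    calc N ^ 2 ≤ y ^ 2 := by gcongr
      _ ≤ y ^ 4 := pow_le_pow_right₀ hy (by norm_num)
  have hright : (y ^ 4) ^ 2 / (1 + q) ≤ 1 := by
    rw [div_le_one hq0, (by ring : (y ^ 4) ^ 2 = y ^ 8)]
    linarith
  calc _ ≤ twistConst * y ^ 2 * (1 + 1) := by gcongr
    _ = _ := by ring

lemma exp_mul_logL1Const_mul_le {q : ℝ} (hy : 1 ≤ y) (hq0 : 0 ≤ q)
    (hq : 1 + q ≤ 2 * y ^ 8) :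
    Real.exp (-(3 / 16 * y ^ 8)) * (logL1Const * (1 + q) * (2 * y ^ 4) ^ 2) ≤
      11000 * logL1Const * y ^ 2 := by
  have hL1 := logL1Const_nonneg
  calc _ ≤ 6 / (3 / 16 * y ^ 8) ^ 3 * (logL1Const * (2 * y ^ 8) * (2 * y ^ 4) ^ 2) := by
        gcongr
        exact exp_neg_le_six_div_cube (by positivity)
    _ = 65536 / 9 * logL1Const * (y ^ 8)⁻¹ := by
        field_simp
        ring
    _ ≤ 11000 * logL1Const * y ^ 2 := by
        have hinv : (y ^ 8)⁻¹ ≤ y ^ 2 :=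
          (inv_le_one_of_one_le₀ (one_le_pow₀ hy)).trans (one_le_pow₀ hy)
        gcongr
        norm_num

variable {ι : Type*} {S : Finset ι} {n : ι → ℕ} {r : ι → ℝ} (hy : 2 ≤ y)
  (hn : ∀ a ∈ S, 0 < n a ∧ (n a : ℝ) ≤ y) (hinj : InjOn n S)
include hy hn hinj

lemma intervalIntegral_resonatorWeight_le :
    ∫ t in (y ^ 8)..(2 * y ^ 8), resonatorWeight S n r (y ^ 4) (3 / 2 * y ^ 8) t ≤
      2 * (y ^ 4 * √Real.pi * ∑ a ∈ S, r a ^ 2) := by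
  have hy0 : 0 < y := by linarith
  have hfloor : ((⌊y⌋₊ : ℕ) : ℝ) ≤ y := Nat.floor_le hy0.le
  set D := ∑ a ∈ S, r a ^ 2
  have : 0 ≤ D := Finset.sum_nonneg fun a _ ↦ sq_nonneg (r a)
  have hoffdiag : (∑ a ∈ S, |r a|) ^ 2 * (16 * (⌊y⌋₊ : ℝ) ^ 2 / (y ^ 4) ^ 2) ≤ D :=
    calc _ ≤ y * D * (16 * y ^ 2 / (y ^ 4) ^ 2) := by
          gcongr
          exact sq_sum_abs_le hn hinj hy0.le r
      _ = D * (2 ^ 4 / y ^ 5) := by field_simp; norm_num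
      _ ≤ D * 1 := by
          gcongr
          rw [div_le_one (by positivity)]
          calc (2 : ℝ) ^ 4 ≤ 2 ^ 5 := by norm_num
            _ ≤ y ^ 5 := by gcongr
      _ = D := mul_one D
  rw [intervalIntegral.integral_of_le (by linarith [pow_pos hy0 8])]
  calc _ ≤ ∫ t, resonatorWeight S n r (y ^ 4) (3 / 2 * y ^ 8) t :=
        setIntegral_le_integral (integrable_resonatorWeight (by positivity) _)
          (ae_of_all _ fun t ↦ resonatorWeight_nonneg _ _ t)
    _ ≤ y ^ 4 * √Real.pi * (D + (∑ a ∈ S, |r a|) ^ 2 * (16 * (⌊y⌋₊ : ℝ) ^ 2 / (y ^ 4) ^ 2)) :=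
        integral_resonatorWeight_le (by positivity) _
          (fun a ha ↦ ⟨(hn a ha).1, Nat.le_floor (hn a ha).2⟩) hinj
    _ ≤ y ^ 4 * √Real.pi * (D + D) := by gcongr
    _ = _ := by ring

lemma IsLogZetaQuot.abs_setIntegral_sub_resonanceMain_le_mul_sum_sq {l : ℂ → ℂ}
    (hl : IsLogZetaQuot l) (hRH : RiemannHypothesis) {v : ℝ} (hv : |v| ≤ 1) :
    |(∫ t in (y ^ 8)..(2 * y ^ 8),
        logNormQuot (1 / 2) (t - v) * resonatorWeight S n r (y ^ 4) (3 / 2 * y ^ 8) t) -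
      y ^ 4 * √Real.pi * resonanceMain S n r (1 / 2) (-v)| ≤
        resonanceErrorConst * y ^ 3 * ∑ a ∈ S, r a ^ 2 := by
  have hy0 : 0 < y := by linarith
  have hfloor : ((⌊y⌋₊ : ℕ) : ℝ) ≤ y := Nat.floor_le hy0.le
  have hT : (2 : ℝ) ^ 8 ≤ y ^ 8 := by gcongr
  have hL : (2 : ℝ) ^ 4 ≤ y ^ 4 := by gcongr
  have hNL : 32 * (⌊y⌋₊ : ℝ) ≤ (y ^ 4) ^ 2 := by
    have : (2 : ℝ) ^ 7 ≤ y ^ 7 := by gcongr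
    nlinarith
  rw [abs_le] at hv
  have hbound := hl.abs_setIntegral_sub_resonanceMain_le (r := r) hRH (by linarith)
    (by ring : (y ^ 4) ^ 2 = y ^ 8) v
    (fun a ha ↦ ⟨(hn a ha).1, Nat.le_floor (hn a ha).2⟩) hNL
  rw [abs_of_nonneg (by linarith : 0 ≤ 3 / 2 * y ^ 8 - v)] at hbound
  have htwist := twistConst_nonneg
  have hL1 := logL1Const_nonneg
  have herror := add_le_add
    (twistConst_mul_le (by linarith) (Nat.cast_nonneg _) hfloor
      (by linarith : y ^ 8 ≤ 3 / 2 * y ^ 8 - v))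
    (exp_mul_logL1Const_mul_le (by linarith) (by linarith)
      (by linarith : 1 + (3 / 2 * y ^ 8 - v) ≤ 2 * y ^ 8))
  calc _ ≤ _ := hbound
    _ ≤ y * (∑ a ∈ S, r a ^ 2) * (2 * twistConst * y ^ 2 + 11000 * logL1Const * y ^ 2) := by
        have hq : 0 ≤ 1 + (3 / 2 * y ^ 8 - v) := by linarith
        exact mul_le_mul (sq_sum_abs_le hn hinj hy0.le r) herror (by positivity) (by positivity)
    _ = _ := by
        rw [resonanceErrorConst]
        ring

lemma IsLogZetaQuot.le_setIntegral_logNormQuot {l : ℂ → ℂ} (hl : IsLogZetaQuot l)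
    (hRH : RiemannHypothesis) {v : ℝ} (hv : |v| ≤ 1) {ε : ℝ} (hε : ε ^ 2 = 1) {c X : ℝ}
    (hc : 0 ≤ c) (hcy : 2 * resonanceErrorConst ≤ c * y) (hX : 1 ≤ X)
    (hmain : c * X * ∑ a ∈ S, r a ^ 2 ≤ ε * resonanceMain S n r (1 / 2) (-v)) :
    c / 2 * X * (y ^ 4 * √Real.pi * ∑ a ∈ S, r a ^ 2) ≤
      ∫ t in (y ^ 8)..(2 * y ^ 8), ε * logNormQuot (1 / 2) (t - v) *
        resonatorWeight S n r (y ^ 4) (3 / 2 * y ^ 8) t := by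
  have hpi : 1 ≤ √Real.pi := Real.one_le_sqrt.2 (by linarith [Real.pi_gt_three])
  have herror := hl.abs_setIntegral_sub_resonanceMain_le_mul_sum_sq (r := r) hy hn hinj hRH hv
  simp only [mul_assoc ε, intervalIntegral.integral_const_mul]
  set J := ∫ t in (y ^ 8)..(2 * y ^ 8),
    logNormQuot (1 / 2) (t - v) * resonatorWeight S n r (y ^ 4) (3 / 2 * y ^ 8) t
  set D := ∑ a ∈ S, r a ^ 2
  have : 0 ≤ D := Finset.sum_nonneg fun a _ ↦ sq_nonneg (r a)
  set M := resonanceMain S n r (1 / 2) (-v)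
  have hεabs : |ε| = 1 := (pow_eq_one_iff_of_nonneg (abs_nonneg ε) two_ne_zero).1 (by rwa [sq_abs])
  have hsigned : |ε * J - y ^ 4 * √Real.pi * (ε * M)| ≤ resonanceErrorConst * y ^ 3 * D := by
    rwa [mul_left_comm, ← mul_sub, abs_mul, hεabs, one_mul]
  have hsmall : resonanceErrorConst * y ^ 3 * D ≤ c / 2 * X * (y ^ 4 * √Real.pi * D) :=
    calc resonanceErrorConst * y ^ 3 * D ≤ c * y / 2 * y ^ 3 * D := by gcongr; linarith
      _ = c / 2 * 1 * (y ^ 4 * 1 * D) := by ring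
      _ ≤ c / 2 * X * (y ^ 4 * √Real.pi * D) := by gcongr
  have hlarge : c * X * (y ^ 4 * √Real.pi * D) ≤ y ^ 4 * √Real.pi * (ε * M) := by
    rw [mul_left_comm]
    gcongr
  linarith [(abs_le.1 hsigned).1]

end Parameters

lemma sqrt_log_div_log_log_le {T t : ℝ} (hT : 4 ≤ T) (ht : t ∈ Icc T (2 * T)) :
    √(Real.log t / Real.log (Real.log t)) ≤ 2 * √(Real.log T / Real.log (Real.log T)) := by
  have hlogT : 1 < Real.log T := by
    rw [Real.lt_log_iff_exp_lt (by linarith)]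
    linarith [Real.exp_one_lt_d9]
  have hmono : Real.log T ≤ Real.log t := Real.log_le_log (by linarith) ht.1
  have hdouble : Real.log t ≤ 2 * Real.log T := by
    rw [← Real.log_rpow (by linarith)]
    refine Real.log_le_log (by linarith [ht.1]) (ht.2.trans ?_)
    norm_cast
    nlinarith
  have hloglogT : 0 < Real.log (Real.log T) := Real.log_pos hlogT
  have hquot : Real.log t / Real.log (Real.log t) ≤
      2 ^ 2 * (Real.log T / Real.log (Real.log T)) := by
    rw [mul_div_assoc']
    exact div_le_div₀ (by linarith) (by linarith) hloglogT
      (Real.log_le_log (by linarith) hmono)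
  refine (Real.sqrt_le_sqrt hquot).trans_eq ?_
  rw [Real.sqrt_mul (by positivity), Real.sqrt_sq (by norm_num)]

lemma one_le_sqrt_log_div_log_log {T : ℝ} (hT : 0 < Real.log (Real.log T))
    (hT1 : 0 < Real.log T) : 1 ≤ √(Real.log T / Real.log (Real.log T)) := by
  rw [Real.one_le_sqrt, one_le_div hT]
  exact Real.log_le_self hT1.le

lemma IsLogZetaQuot.exists_le_mul_integral_log_norm_zeta {l : ℂ → ℂ} (hl : IsLogZetaQuot l)
    (hRH : RiemannHypothesis) {ι : Type*} {S : Finset ι} {n : ι → ℕ} {r : ι → ℝ} {y c ε h X : ℝ}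
    (hy : 2 ≤ y) (hn : ∀ a ∈ S, 0 < n a ∧ (n a : ℝ) ≤ y) (hinj : InjOn n S)
    (hD : 0 < ∑ a ∈ S, r a ^ 2) (hε : ε ^ 2 = 1) (hc : 0 < c)
    (hcy : 2 * resonanceErrorConst ≤ c * y) (hX : 1 ≤ X) (hh : h ∈ Icc 0 1)
    (hmain : ∀ v, |v| ≤ h → c * X * ∑ a ∈ S, r a ^ 2 ≤ ε * resonanceMain S n r (1 / 2) v) :
    ∃ t ∈ Icc (y ^ 8) (2 * y ^ 8), c / 4 * (h * X) ≤
      ε * ∫ u in (t - h)..(t + h), Real.log ‖riemannZeta (1 / 2 + Complex.I * u)‖ := by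
  have hy0 : 0 < y := by linarith
  set Z := y ^ 4 * √Real.pi * ∑ a ∈ S, r a ^ 2
  have : 0 < Z := by positivity
  obtain ⟨t, ht, hle⟩ := exists_mul_le_mul_integral_of_averages
    (fun x y ↦ (intervalIntegrable_logNormQuot_half x y).const_mul ε)
    (continuous_resonatorWeight (y ^ 4) (3 / 2 * y ^ 8))
    (fun t ↦ resonatorWeight_nonneg _ _ t)
    (fun t ↦ (resonatorWeight_le _ _ t).trans
      (mul_le_of_le_one_right (by positivity) (gaussW_le_one _ _ _)))
    (by linarith [pow_pos hy0 8]) hh.1 (by positivity : 0 < 2 * Z)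
    (intervalIntegral_resonatorWeight_le hy hn hinj) (by positivity : 0 < c / 2 * X * Z)
    fun v hv ↦ hl.le_setIntegral_logNormQuot hy hn hinj hRH ((abs_le.2 hv).trans hh.2) hε hc.le
      hcy hX (hmain (-v) (by rw [abs_neg]; exact abs_le.2 hv))
  refine ⟨t, ht, le_of_mul_le_mul_left ?_ (by positivity : 0 < 2 * Z)⟩
  simp only [intervalIntegral.integral_const_mul, logNormQuot_half] at hle
  linarith

lemma eventually_exists_integral_log_norm_zeta (hRH : RiemannHypothesis) :
    ∃ c > 0, ∀ᶠ T : ℝ in atTop, ∀ ε : ℝ, ε ^ 2 = 1 →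
      ∀ h ∈ Icc (0 : ℝ) (Real.log (Real.log T))⁻¹, ∃ t ∈ Icc T (2 * T),
        c * (h * √(Real.log t / Real.log (Real.log t))) ≤
          ε * ∫ u in (t - h)..(t + h), Real.log ‖riemannZeta (1 / 2 + Complex.I * u)‖ := by
  obtain ⟨l, hl⟩ := exists_isLogZetaQuot hRH
  obtain ⟨c, hc, hres⟩ := eventually_exists_resonator
  refine ⟨c / 8, by positivity, ?_⟩
  have hlog := Real.tendsto_log_atTop
  filter_upwards [hres, (tendsto_rpow_atTop (by norm_num : (0 : ℝ) < 1 / 8)).eventually_ge_atTop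
    (max 2 (2 * resonanceErrorConst / c)), hlog.eventually_gt_atTop 0,
    (hlog.comp hlog).eventually_ge_atTop 1, eventually_ge_atTop 4]
    with T hres hy hlogT hloglogT hT ε hε h hh
  rw [Function.comp_apply] at hloglogT
  obtain ⟨S, r, hn, hinj, hD, hmain⟩ := hres ε hε
  have hcy : 2 * resonanceErrorConst ≤ c * T ^ (1 / 8 : ℝ) :=
    (div_le_iff₀' hc).1 ((le_max_right _ _).trans hy)
  obtain ⟨t, ht, hle⟩ := hl.exists_le_mul_integral_log_norm_zeta hRH ((le_max_left _ _).trans hy)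
    hn hinj hD hε hc hcy (one_le_sqrt_log_div_log_log (by linarith) hlogT)
    ⟨hh.1, hh.2.trans (inv_le_one_of_one_le₀ hloglogT)⟩ fun v hv ↦ hmain v (hv.trans hh.2)
  have hpow : (T ^ (1 / 8 : ℝ)) ^ 8 = T := by
    rw [← Real.rpow_mul_natCast (by linarith)]
    norm_num
  rw [hpow] at ht
  refine ⟨t, ht, le_trans ?_ hle⟩
  calc _ ≤ c / 8 * (h * (2 * √(Real.log T / Real.log (Real.log T)))) := by
        have := hh.1
        gcongr
        exact sqrt_log_div_log_log_le hT ht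
    _ = _ := by ring

theorem theorem3 (hRH : RiemannHypothesis) :
    (∃ c : ℝ, 0 < c ∧ ∀ᶠ T : ℝ in atTop,
      ∀ h ∈ Set.Icc (0 : ℝ) (Real.log (Real.log T))⁻¹, ∃ t ∈ Set.Icc T (2 * T),
        c * (h * Real.sqrt (Real.log t / Real.log (Real.log t))) ≤
          ∫ u in (t - h)..(t + h), Real.log ‖riemannZeta (1 / 2 + Complex.I * (u : ℂ))‖) ∧
    (∃ c : ℝ, 0 < c ∧ ∀ᶠ T : ℝ in atTop,
      ∀ h ∈ Set.Icc (0 : ℝ) (Real.log (Real.log T))⁻¹, ∃ t ∈ Set.Icc T (2 * T),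
        (∫ u in (t - h)..(t + h), Real.log ‖riemannZeta (1 / 2 + Complex.I * (u : ℂ))‖) ≤
          -(c * (h * Real.sqrt (Real.log t / Real.log (Real.log t))))) := by
  obtain ⟨c, hc, hev⟩ := eventually_exists_integral_log_norm_zeta hRH
  refine ⟨⟨c, hc, ?_⟩, c, hc, ?_⟩
  · filter_upwards [hev] with T hT h hh
    obtain ⟨t, ht, hle⟩ := hT 1 (one_pow 2) h hh
    exact ⟨t, ht, by rwa [one_mul] at hle⟩
  · filter_upwards [hev] with T hT h hh
    obtain ⟨t, ht, hle⟩ := hT (-1) neg_one_sq h hh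
    rw [neg_one_mul] at hle
    exact ⟨t, ht, le_neg_of_le_neg hle⟩
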